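/- All graphs are finite and simple with vertex set $\{0,\dots,n-1\}$; graphs are given to machines by the $n^2$ bits of their adjacency matrix. A treedepth decomposition of $G$ is a rooted forest $F$ with an injection $\psi:V(G)\to V(F)$ mapping adjacent vertices to ancestor–descendant pairs; the treedepth $\mathrm{td}(G)$ is the least height (maximum number of vertices on a root-to-node path) of such an $F$. **Partial decompositions.** Let $G^+$ be $G$ with an added universal vertex $r$. A partial decomposition is a triple $(F,X,h)$ with $F$ a rooted forest, $X\subseteq V(F)$ a set of vertices of $G^+$ and $h:V(F)\to\mathbb N^+$ such that $h(x)>h(y)$ whenever $x$ is an ancestor of $y$; its height is the maximum of $h$ over the roots. Two of them are equivalent if they have the same $X$ and there is an isomorphism of rooted forests that fixes $X$ pointwise and preserves $h$. The restriction to $X'\subseteq X$ is obtained by iteratively deleting leaves not in $X'$. A table is a list of pairwise inequivalent partial decompositions. * $\mathrm{forget}(R',X,u)$ is a table with one representative of each class among the restrictions of members of $R'$ to $X\setminus\{u\}$. * $\mathrm{intro}_s(R',X',u)$, with $X=X'\cup\{u\}$, is a table with one representative of each class among the following $(F,X,h)$ of height at most $s$: $F$ is a tree with root $r$ and at most $|X|s$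 nodes, $X\subseteq V(F)$, all leaves of $F$ are in $X$, every edge of $G^+[X]$ joins an ancestor–descendant pair of $F$, and for some $(F',X',h')\in R'$ there is an injection $f:V(F')\to V(F)$ that is the identity on $X'$, preserves the ancestor relation and has image $V(F)\setminus\{u\}$; moreover (with $\max\emptyset=0$, and $c$ ranging over the children in $F$ of the node concerned) $h(u)=\max_c h(c)+1$ and $h(f(z'))=\max\{\max_c h(c)+1,\;h'(z')\}$ for all $z'\in V(F')$. **The simple algorithm** with parameter $t$, on input $G$. Run a depth-first search of $G$ (always choosing the least vertex available, restarted in every component); the bag is the current search stack (the path from the root of the search tree to the current vertex) together with $r$. Start with the bag $\{r\}$ and the table consisting of the one-node tree $r$ with $h(r)=1$. When the search discovers $u$, replace the current table $R$ by $\mathrm{intro}_{t+1}(R,\cdot,u)$; when it leaves $u$, replace it by $\mathrm{forget}(R,\cdot,u)$, where $\cdot$ is the bag before the step. If the depth of the search would exceed $2^t$, answer No. When the search is complete, answer Yes if and only if the last table is nonempty. (Representatives may be chosen arbitrarily.) The stored data at any moment are the search stack and two tables: that of the previous bag (empty at the start) and that of the current bag. **Lemma.** For every fixed $t$ the simple algorithm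 can be implemented in logarithmic space. Precisely, for every $t\in\mathbb N$ there is $B\in\mathbb N$ such that: 1. For every graph $G$, every execution of the algorithm on $G$ answers Yes if and only if $\mathrm{td}(G)\le t$; throughout, the stack has at most $2^t$ vertices, and both stored tables have at most $B$ entries, each with at most $B$ nodes and with values of $h$ at most $B$. If the search is completed, the sequence of bags is a nice path decomposition of $G^+$ (the first bag is a single vertex, and each later bag introduces or forgets exactly one vertex). 2. There are a deterministic Turing machine $M$ with a read-only two-way input tape and finitely many work tapes, a constant $c$, and for each $n$ a decoding function $\mathrm{dec}_n$ from contents of the work tapes to possible stored data (a stack and two tables), such that for every $n$ and every graph $G$ on $n$ vertices, on input $G$: $M$ uses at most $c\,(\lfloor\log_2 n\rfloor+1)$ cells of each work tape (with $\lfloor\log_2 0\rfloor:=0$); and there is an execution of the algorithm on $G$ which $M$ carries out step by step, in the sense that at every time up to halting the contents of the work tapes decode under $\mathrm{dec}_n$ to the stored data of a state of this execution, this state being the initial one at the beginning, the final one at the end, and in each step of $M$ either unchanged or replaced by the next one; and $M$ halts with the answer of the execution. -/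

import Mathlib

/-! ### Rooted forests and treedepth -/

/-- A finite rooted forest whose nodes are taken from a type `N`, given by its parent map
(`none` for roots and for elements of `N` that are not nodes). -/
structure RootedForest (N : Type*) where
  nodes : Finset N
  parent : N → Option N
  parent_mem : ∀ x y, parent x = some y → x ∈ nodes ∧ y ∈ nodes
  acyclic : ∀ x, ¬ Relation.TransGen (fun a b => parent a = some b) x x

namespace RootedForest

variable {N : Type*}

/-- `F.IsAncestor y x`: the node `y` is a (proper) ancestor of the node `x`. -/
def IsAncestor (F : RootedForest N) (y x : N) : Prop :=
  Relation.TransGen (fun a b => F.parent a = some b) x y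

open Classical in
/-- The children of `x`. -/
noncomputable def children (F : RootedForest N) (x : N) : Finset N :=
  F.nodes.filter (fun y => F.parent y = some x)

open Classical in
/-- The roots of the forest. -/
noncomputable def roots (F : RootedForest N) : Finset N :=
  F.nodes.filter (fun x => F.parent x = none)

open Classical in
/-- The depth of a node: the number of vertices on the path from its root to it. -/
noncomputable def depth (F : RootedForest N) (x : N) : ℕ :=
  (F.nodes.filter (fun y => F.IsAncestor y x)).card + 1

/-- The height of a forest: the maximum depth of a node (`0` for the empty forest). -/
noncomputable def height (F : RootedForest N) : ℕ := F.nodes.sup F.depth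

end RootedForest

/-- `(F, ψ)` is a treedepth decomposition of `G`. -/
def IsTreedepthDecomposition {V N : Type*} (G : SimpleGraph V) (F : RootedForest N)
    (ψ : V → N) : Prop :=
  Function.Injective ψ ∧ (∀ v, ψ v ∈ F.nodes) ∧
    ∀ u v, G.Adj u v → F.IsAncestor (ψ u) (ψ v) ∨ F.IsAncestor (ψ v) (ψ u)

/-- The treedepth of a (finite) graph: the minimum height of a treedepth decomposition. -/
noncomputable def treedepth {V : Type} (G : SimpleGraph V) : ℕ :=
  sInf {k | ∃ (N : Type) (F : RootedForest N) (ψ : V → N),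
    IsTreedepthDecomposition G F ψ ∧ F.height = k}

/-! ### The graph with an added universal vertex, path decompositions -/

/-- `G` together with a new universal vertex `none`. -/
def rootedGraph {V : Type*} (G : SimpleGraph V) : SimpleGraph (Option V) where
  Adj a b := a ≠ b ∧
    (a = none ∨ b = none ∨ ∃ u v, a = some u ∧ b = some v ∧ G.Adj u v)
  symm := ⟨by
    rintro a b ⟨hne, h | h | ⟨u, v, hu, hv, h⟩⟩
    · exact ⟨hne.symm, Or.inr (Or.inl h)⟩
    · exact ⟨hne.symm, Or.inl h⟩
    · exact ⟨hne.symm, Or.inr (Or.inr ⟨v, u, hv, hu, h.symm⟩)⟩⟩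
  loopless := ⟨fun _ h => h.1 rfl⟩

/-- The sequence `bag 0, …, bag m` is a nice path decomposition of `G`, the bag `bag 0` being its
leaf: it is a path decomposition, the leaf bag contains a single vertex, and every later bag
either introduces one vertex or forgets one vertex. -/
structure IsNicePathDecomposition {V : Type*} [DecidableEq V] (G : SimpleGraph V) (m : ℕ)
    (bag : ℕ → Finset V) : Prop where
  cover_vertex : ∀ v, ∃ i ≤ m, v ∈ bag i
  cover_edge : ∀ u v, G.Adj u v → ∃ i ≤ m, u ∈ bag i ∧ v ∈ bag i
  interval : ∀ v i j k, i ≤ j → j ≤ k → k ≤ m → v ∈ bag i → v ∈ bag k → v ∈ bag j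
  leaf : (bag 0).card = 1
  nice : ∀ i < m, (∃ u, u ∉ bag i ∧ bag (i + 1) = insert u (bag i)) ∨
    ∃ u, u ∈ bag i ∧ bag (i + 1) = (bag i).erase u

/-! ### Partial decompositions and the dynamic programming operations -/

/-- Names for the nodes of partial decompositions of the graph `G` with added universal vertex:
`Sum.inl x` is the vertex `x : Option V` itself, and `Sum.inr k` are further names. -/
abbrev Node (V : Type*) := Option V ⊕ ℕ

/-- A partial decomposition `(F, X, h)`. Only the values of `h` on the nodes of `F` matter. -/
structure PartialDecomposition (V : Type*) where
  forest : RootedForest (Node V)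
  X : Finset (Option V)
  h : Node V → ℕ
  X_subset : ∀ x ∈ X, Sum.inl x ∈ forest.nodes
  h_pos : ∀ x ∈ forest.nodes, 0 < h x
  h_lt : ∀ x y, forest.IsAncestor x y → h y < h x

namespace PartialDecomposition

variable {V : Type*}

/-- The height of a partial decomposition: the maximum value of `h` on a root. -/
noncomputable def height (P : PartialDecomposition V) : ℕ := P.forest.roots.sup P.h

/-- Equivalence of partial decompositions. -/
def Equivalent (P Q : PartialDecomposition V) : Prop :=
  P.X = Q.X ∧ ∃ ψ : {x // x ∈ P.forest.nodes} ≃ {x // x ∈ Q.forest.nodes},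
    (∀ a b, P.forest.parent a.1 = some b.1 ↔ Q.forest.parent (ψ a).1 = some (ψ b).1) ∧
    (∀ a, ∀ x ∈ P.X, a.1 = Sum.inl x → (ψ a).1 = Sum.inl x) ∧
    ∀ a, P.h a.1 = Q.h (ψ a).1

/-- `Q` is the restriction of `P` to `X'`. Iteratively deleting the leaves that are not in `X'`
leaves exactly the nodes that are in `X'` or have a descendant in `X'`. -/
def IsRestriction (P : PartialDecomposition V) (X' : Finset (Option V))
    (Q : PartialDecomposition V) : Prop :=
  Q.X = X' ∧
  (∀ z, z ∈ Q.forest.nodes ↔ z ∈ P.forest.nodes ∧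
    ∃ x ∈ X', z = Sum.inl x ∨ P.forest.IsAncestor z (Sum.inl x)) ∧
  (∀ z ∈ Q.forest.nodes, Q.forest.parent z = P.forest.parent z) ∧
  ∀ z ∈ Q.forest.nodes, Q.h z = P.h z

end PartialDecomposition

/-- `f` witnesses that `F₁` topologically generalizes `F₂` under `X`. -/
def TopologicallyGeneralizes {V : Type*} (F₁ F₂ : RootedForest (Node V)) (X : Finset (Option V))
    (f : Node V → Node V) : Prop :=
  Set.MapsTo f F₂.nodes F₁.nodes ∧ Set.InjOn f F₂.nodes ∧
  (∀ x ∈ X, f (Sum.inl x) = Sum.inl x) ∧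
  ∀ x ∈ F₂.nodes, ∀ y ∈ F₂.nodes, F₂.IsAncestor y x → F₁.IsAncestor (f y) (f x)

/-- A table of the dynamic program: a list of partial decompositions. -/
abbrev Table (V : Type*) := List (PartialDecomposition V)

/-- The list `A` contains exactly one representative of each equivalence class of partial
decompositions that meets the set `S`, and this representative is in `S`. -/
def IsTableOf {V : Type*} (S : Set (PartialDecomposition V)) (A : Table V) : Prop :=
  A.Pairwise (fun P Q => ¬ P.Equivalent Q) ∧ (∀ P ∈ A, P ∈ S) ∧
    ∀ Q ∈ S, ∃ P ∈ A, P.Equivalent Q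

/-- The table of the leaf bag `{r}`, `r = none`: one partial decomposition, consisting of the
root `r` with height `1`. -/
def IsLeafTable {V : Type*} (A : Table V) : Prop :=
  ∃ P : PartialDecomposition V, A = [P] ∧ P.X = {none} ∧
    P.forest.nodes = {Sum.inl none} ∧ P.h (Sum.inl none) = 1

/-- `A` is a possible result of the operation `forget(R', X, u)`. -/
def IsForget {V : Type*} [DecidableEq V] (R' : Table V) (X : Finset (Option V)) (u : Option V)
    (A : Table V) : Prop :=
  IsTableOf {Q | ∃ P ∈ R', P.IsRestriction (X.erase u) Q} A

/-- The partial decompositions `P = (F, X' ∪ {u}, h)` generated by the operation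
`intro_t(R', X', u, G)` on the graph `G` with universal vertex `none`. -/
def IntroCandidate {V : Type*} [DecidableEq V] (t : ℕ) (G : SimpleGraph (Option V))
    (R' : Table V) (X' : Finset (Option V)) (u : Option V) (P : PartialDecomposition V) : Prop :=
  P.X = insert u X' ∧
  P.forest.nodes.card ≤ P.X.card * t ∧
  P.forest.roots = {Sum.inl none} ∧
  (∀ z ∈ P.forest.nodes, P.forest.children z = ∅ → ∃ x ∈ P.X, z = Sum.inl x) ∧
  (∀ x ∈ P.X, ∀ y ∈ P.X, G.Adj x y →
    P.forest.IsAncestor (Sum.inl x) (Sum.inl y) ∨ P.forest.IsAncestor (Sum.inl y) (Sum.inl x)) ∧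
  (∃ P' ∈ R', ∃ f : Node V → Node V,
    TopologicallyGeneralizes P.forest P'.forest X' f ∧
    f '' P'.forest.nodes = (P.forest.nodes : Set (Node V)) \ {Sum.inl u} ∧
    P.h (Sum.inl u) = (P.forest.children (Sum.inl u)).sup P.h + 1 ∧
    ∀ z ∈ P'.forest.nodes,
      P.h (f z) = max ((P.forest.children (f z)).sup P.h + 1) (P'.h z)) ∧
  P.height ≤ t

/-- `A` is a possible result of the operation `intro_t(R', X', u, G)`. -/
def IsIntro {V : Type*} [DecidableEq V] (t : ℕ) (G : SimpleGraph (Option V))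
    (R' : Table V) (X' : Finset (Option V)) (u : Option V) (A : Table V) : Prop :=
  IsTableOf {P | IntroCandidate t G R' X' u P} A

/-! ### The simple algorithm

A depth first search of `G` is carried out, smallest vertices first, restarted in every component.
At every moment the search stack is the path from the root of the search tree to the current
vertex, and together with the universal vertex it is the current bag of a nice path decomposition:
a vertex is introduced when the search discovers it and forgotten when the search leaves it.
The dynamic program is run along these bags. -/

/-- What the algorithm stores: the stack of the search (top first), and two tables, those of the
previous bag and of the current bag. -/
structure Memory (V : Type*) where
  stack : List V
  previous : Table V
  current : Table V

/-- A state of the algorithm: the stored data, and the set of vertices discovered so far. This set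
determines what the search does next but is not part of the stored data. -/
structure AlgState (V : Type*) where
  memory : Memory V
  visited : Set V

namespace AlgState

variable {V : Type*}

/-- The vertices the search may discover next: the undiscovered neighbours of the top of the
stack, or all undiscovered vertices if the stack is empty. -/
def choices (G : SimpleGraph V) (s : AlgState V) : Set V :=
  {u | u ∉ s.visited ∧ ∀ v ∈ s.memory.stack.head?, G.Adj v u}

/-- The current bag: the stack and the universal vertex. -/
def bag [DecidableEq V] (s : AlgState V) : Finset (Option V) :=
  insert none (s.memory.stack.map some).toFinset

/-- The initial state. -/
def IsInitial (s : AlgState V) : Prop :=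
  s.memory.stack = [] ∧ s.memory.previous = [] ∧ IsLeafTable s.memory.current ∧ s.visited = ∅

/-- One step of the algorithm with parameter `t` on the graph `G`. As the universal vertex raises
the treedepth by one, the dynamic program is run with `t + 1`. -/
inductive Step [LinearOrder V] (t : ℕ) (G : SimpleGraph V) : AlgState V → AlgState V → Prop
  | discover (s : AlgState V) (u : V) (A : Table V)
      (hu : IsLeast (s.choices G) u)
      (hdepth : s.memory.stack.length + 1 ≤ 2 ^ t)
      (hA : IsIntro (t + 1) (rootedGraph G) s.memory.current s.bag (some u) A) :
      Step t G s ⟨⟨u :: s.memory.stack, s.memory.current, A⟩, insert u s.visited⟩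
  | leave (s : AlgState V) (u : V) (l : List V) (A : Table V)
      (hnone : s.choices G = ∅)
      (hstack : s.memory.stack = u :: l)
      (hA : IsForget s.memory.current s.bag (some u) A) :
      Step t G s ⟨⟨l, s.memory.current, A⟩, s.visited⟩

/-- The search is complete. -/
def Complete (G : SimpleGraph V) (s : AlgState V) : Prop :=
  s.choices G = ∅ ∧ s.memory.stack = []

/-- In the state `s` the algorithm stops with answer `b`: with `false` if the depth of the search
tree would exceed `2 ^ t`; when the search is complete, with the truth value of the
statement that the table of the last bag is not empty. -/
inductive Returns (t : ℕ) (G : SimpleGraph V) : AlgState V → Bool → Prop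
  | tooDeep (s : AlgState V) (hne : (s.choices G).Nonempty)
      (hdepth : 2 ^ t < s.memory.stack.length + 1) : Returns t G s false
  | done (s : AlgState V) (hs : s.Complete G) : Returns t G s (!s.memory.current.isEmpty)

end AlgState

/-- A complete execution of the algorithm with parameter `t` on the graph `G`. -/
structure Execution {V : Type*} [LinearOrder V] (t : ℕ) (G : SimpleGraph V) where
  length : ℕ
  state : ℕ → AlgState V
  answer : Bool
  initial : (state 0).IsInitial
  step : ∀ i < length, AlgState.Step t G (state i) (state (i + 1))
  returns : AlgState.Returns t G (state length) answer

/-- The table `A` has size at most `B`: it has at most `B` entries, each with at most `B` nodes,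
and all heights stored in it are at most `B`. -/
def TableSizeAtMost {V : Type*} (B : ℕ) (A : Table V) : Prop :=
  A.length ≤ B ∧ ∀ P ∈ A, P.forest.nodes.card ≤ B ∧ ∀ x ∈ P.forest.nodes, P.h x ≤ B

/-! ### Space bounded Turing machines -/

/-- What the head on the input tape sees: an end marker or an input bit. -/
inductive InputSymbol where
  | leftEnd
  | bit (b : Bool)
  | rightEnd

/-- Head moves. -/
inductive HeadMove where
  | left
  | stay
  | right

/-- A deterministic Turing machine with a read-only two-way input tape and finitely many
work tapes that are infinite to the right. In each step it either halts with an answer, or enters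
a new state, moves the input head, and writes and moves on every work tape. -/
structure OfflineTM where
  tapes : ℕ
  State : Type
  Symbol : Type
  finite_state : Finite State
  finite_symbol : Finite Symbol
  start : State
  blank : Symbol
  transition : State → InputSymbol → (Fin tapes → Symbol) →
    Bool ⊕ (State × HeadMove × (Fin tapes → Symbol × HeadMove))

namespace OfflineTM

/-- The contents of the work tapes. -/
abbrev Work (M : OfflineTM) := Fin M.tapes → ℕ → M.Symbol

/-- A configuration. The input head is at a position in `0, …, |w| + 1`, the two extreme positions
carrying the end markers. -/
structure Config (M : OfflineTM) where
  state : M.State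
  inputHead : ℕ
  work : M.Work
  head : Fin M.tapes → ℕ

/-- The symbol at position `p` of the input tape with input word `w`. -/
def readInput (w : List Bool) (p : ℕ) : InputSymbol :=
  if p = 0 then .leftEnd else
    match w[p - 1]? with
    | some b => .bit b
    | none => .rightEnd

/-- Head movement; a move to the left at position `0` has no effect. -/
def moveHead : HeadMove → ℕ → ℕ
  | .left, p => p - 1
  | .stay, p => p
  | .right, p => p + 1

variable (M : OfflineTM)

/-- The transition applicable in a configuration. -/
def action (w : List Bool) (c : M.Config) :
    Bool ⊕ (M.State × HeadMove × (Fin M.tapes → M.Symbol × HeadMove)) :=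
  M.transition c.state (readInput w c.inputHead) (fun i => c.work i (c.head i))

/-- The next configuration; halting configurations stay as they are. -/
def next (w : List Bool) (c : M.Config) : M.Config :=
  match M.action w c with
  | .inl _ => c
  | .inr (q, d, a) =>
    { state := q
      inputHead := min (moveHead d c.inputHead) (w.length + 1)
      work := fun i => Function.update (c.work i) (c.head i) (a i).1
      head := fun i => moveHead (a i).2 (c.head i) }

/-- The configuration after `j` steps on input `w`; initially all work tapes are blank and
all heads are at position `0`. -/
def config (w : List Bool) (j : ℕ) : M.Config :=
  (M.next w)^[j] ⟨M.start, 0, fun _ _ => M.blank, fun _ => 0⟩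

/-- On input `w` the machine has halted with answer `b` at time `T`. -/
def HaltsAt (w : List Bool) (T : ℕ) (b : Bool) : Prop := M.action w (M.config w T) = .inl b

/-- On input `w` the machine uses at most `s` cells of each work tape. -/
def SpaceAtMost (w : List Bool) (s : ℕ) : Prop := ∀ j i, (M.config w j).head i < s

end OfflineTM

open Classical in
/-- The adjacency matrix of a graph on `n` vertices, written row by row as a word of length
`n * n`. -/
noncomputable def encodeGraph {n : ℕ} (G : SimpleGraph (Fin n)) : List Bool :=
  (List.ofFn fun i : Fin n => List.ofFn fun j : Fin n => decide (G.Adj i j)).flatten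

/-- On input `w` the machine `M` carries out the execution `ρ` of the algorithm and
halts with its answer. Here `idx j` is the number of steps of the algorithm completed after `j` steps of
the machine; at every time the contents of the work tapes represent, via the decoding `dec`,
the data that the algorithm stores: the current search path and two tables. -/
def OfflineTM.Implements (M : OfflineTM) {V : Type*} [LinearOrder V] {t : ℕ} {G : SimpleGraph V}
    (dec : M.Work → Memory V) (w : List Bool) (ρ : Execution t G) : Prop :=
  ∃ (T : ℕ) (idx : ℕ → ℕ), idx 0 = 0 ∧
    (∀ j < T, idx (j + 1) = idx j ∨ idx (j + 1) = idx j + 1) ∧ idx T = ρ.length ∧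
    (∀ j ≤ T, dec (M.config w j).work = (ρ.state (idx j)).memory) ∧
    M.HaltsAt w T ρ.answer

/-! ### Rooted forests: ancestors, roots, induction -/

namespace RootedForest

variable {N : Type*} {F : RootedForest N}

/-! Treedepth is handled through ranked orders: strict orders in which the elements above a given
one form a chain, with a positive rank that grows strictly towards the ancestors
(`treedepth_le_iff`). Deleting the top vertex of a path splits it into two paths of smaller rank, so
a path in a graph of treedepth at most `k` has fewer than `2 ^ k` vertices
(`RankedOrder.length_lt`). The search stack together with the next vertex is a path, which justifies
the answer No when the depth would exceed `2 ^ t`.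

A vertex that has been left has no undiscovered neighbour. Hence the discovered neighbours of a new
vertex are all on the stack, the bags form a nice path decomposition, and the dynamic program may
proceed bag by bag. Its invariant `TableInv` has two halves. Soundness (`Realizes`): every table
entry is the part above the bag of a ranked order on all vertices seen so far; when `u` is
introduced, the new entry is spliced into the old order. Completeness (`Follows`): every ranked
order of the whole graph with the universal vertex on top and rank at most `t + 1` leaves its trace
in the table; the new entry is the order restricted to the old nodes and `u`, with heights computed
from the leaves upwards. Both bag sizes and heights are bounded in terms of `t`, so there are
boundedly many classes (`exists_length_bound`).

Two things must be overcome for logarithmic space. The set of discovered vertices is not stored. It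
is replaced by a test (`SearchInv.mem_choices_iff`): a vertex `x` off the stack and adjacent to its
top was discovered before exactly if a walk of at most `2 ^ t` edges avoiding the stack leads from
`x` to a vertex that is adjacent to the top and not larger than the last child left. Such walks have
bounded length and can be tried one after the other. When the stack is empty, every vertex counts as
adjacent to the top.

Secondly, tables mention vertices. Only boundedly many vertices occur at any time, so tables are
written over a fixed finite set of names and become part of the finite control, while a register for
every name holds the number of its vertex. The table operations are invariant under isomorphism, so
an operation carried out on names is one on vertices (`IsIntro.transport`, `IsForget.transport`).

The resulting program compares registers and reads matrix entries at pairs of registers. It is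
simulated by a register machine that scans the input, and this by a Turing machine keeping the
registers in binary on parallel tracks. Register contents are at most `n * n + 1`, so
logarithmically many cells suffice. The relation `Produces` carries the sequence of displayed
memories through all layers. -/

theorem IsAncestor.trans {x y z : N} (h₁ : F.IsAncestor z y) (h₂ : F.IsAncestor y x) :
    F.IsAncestor z x :=
  Relation.TransGen.trans h₂ h₁

theorem IsAncestor.of_parent {x y : N} (h : F.parent x = some y) : F.IsAncestor y x :=
  Relation.TransGen.single h

theorem not_isAncestor_self (x : N) : ¬ F.IsAncestor x x := F.acyclic x

/-- The step from a node to its parent, as a way to decompose the ancestor relation. -/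
theorem isAncestor_iff_parent {x y : N} :
    F.IsAncestor y x ↔ ∃ p, F.parent x = some p ∧ (p = y ∨ F.IsAncestor y p) := by
  constructor
  · intro h
    rcases (Relation.TransGen.head'_iff).1 h with ⟨p, hp, h'⟩
    rcases Relation.reflTransGen_iff_eq_or_transGen.1 h' with h'' | h''
    · exact ⟨p, hp, Or.inl h''.symm⟩
    · exact ⟨p, hp, Or.inr h''⟩
  · rintro ⟨p, hp, rfl | h⟩
    · exact .of_parent hp
    · exact h.trans (.of_parent hp)

/-- The step from a node to its child, as a way to decompose the ancestor relation. -/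
theorem isAncestor_iff_child {x y : N} :
    F.IsAncestor y x ↔ ∃ c, F.parent c = some y ∧ (c = x ∨ F.IsAncestor c x) := by
  constructor
  · intro h
    rcases (Relation.TransGen.tail'_iff).1 h with ⟨c, h', hc⟩
    rcases Relation.reflTransGen_iff_eq_or_transGen.1 h' with h'' | h''
    · exact ⟨c, hc, Or.inl h''⟩
    · exact ⟨c, hc, Or.inr h''⟩
  · rintro ⟨c, hc, rfl | h⟩
    · exact .of_parent hc
    · exact (IsAncestor.of_parent hc).trans h

theorem IsAncestor.mem_left {x y : N} (h : F.IsAncestor y x) : y ∈ F.nodes := by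
  rcases isAncestor_iff_child.1 h with ⟨c, hc, -⟩
  exact (F.parent_mem _ _ hc).2

theorem IsAncestor.mem_right {x y : N} (h : F.IsAncestor y x) : x ∈ F.nodes := by
  rcases isAncestor_iff_parent.1 h with ⟨c, hc, -⟩
  exact (F.parent_mem _ _ hc).1

/-- Parents are unique, so the ancestors of a node are met one after the other on a single path
upwards. -/
theorem IsAncestor.total {x y z : N} (hy : F.IsAncestor y x) (hz : F.IsAncestor z x) :
    y = z ∨ F.IsAncestor y z ∨ F.IsAncestor z y := by
  have hu : Relator.RightUnique (fun a b => F.parent a = some b) := by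
    intro a b c hb hc
    exact Option.some.inj (hb.symm.trans hc)
  rcases Relation.ReflTransGen.total_of_right_unique hu hy.to_reflTransGen hz.to_reflTransGen
    with h | h
  · rcases Relation.reflTransGen_iff_eq_or_transGen.1 h with h | h
    · exact Or.inl h.symm
    · exact Or.inr (Or.inr h)
  · rcases Relation.reflTransGen_iff_eq_or_transGen.1 h with h | h
    · exact Or.inl h
    · exact Or.inr (Or.inl h)

theorem mem_children {x c : N} : c ∈ F.children x ↔ F.parent c = some x := by
  classical
  unfold children
  rw [Finset.mem_filter]
  exact ⟨fun h => h.2, fun h => ⟨(F.parent_mem _ _ h).1, h⟩⟩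

theorem mem_roots {x : N} : x ∈ F.roots ↔ x ∈ F.nodes ∧ F.parent x = none := by
  classical
  unfold roots
  rw [Finset.mem_filter]

theorem children_nonempty_of_isAncestor {x y : N} (h : F.IsAncestor y x) :
    F.children y ≠ ∅ := by
  rcases isAncestor_iff_child.1 h with ⟨c, hc, -⟩
  intro he
  have := mem_children.2 hc
  simp [he] at this

/-- The set of nodes is finite and a proper ancestor has strictly fewer ancestors. This permits
induction from the roots downwards. -/
theorem wellFounded_isAncestor (F : RootedForest N) : WellFounded F.IsAncestor := by
  classical
  refine Subrelation.wf (r := InvImage (· < ·) F.depth) ?_ (InvImage.wf _ Nat.lt_wfRel.wf)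
  intro y x h
  simp only [InvImage, depth, Nat.add_lt_add_iff_right]
  refine Finset.card_lt_card ⟨?_, ?_⟩
  · intro z hz
    rw [Finset.mem_filter] at hz ⊢
    exact ⟨hz.1, hz.2.trans h⟩
  · intro hs
    have := hs (Finset.mem_filter.2 ⟨h.mem_left, h⟩)
    rw [Finset.mem_filter] at this
    exact F.acyclic _ this.2

/-- The dual measure, the number of descendants, permits recursion from the leaves upwards. -/
theorem wellFounded_descendant (F : RootedForest N) :
    WellFounded (fun x y => F.IsAncestor y x) := by
  classical
  refine Subrelation.wf
    (r := InvImage (· < ·) (fun x => (F.nodes.filter (fun y => F.IsAncestor x y)).card)) ?_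
    (InvImage.wf _ Nat.lt_wfRel.wf)
  intro x y h
  simp only [InvImage]
  refine Finset.card_lt_card ⟨?_, ?_⟩
  · intro z hz
    rw [Finset.mem_filter] at hz ⊢
    exact ⟨hz.1, h.trans hz.2⟩
  · intro hs
    have := hs (Finset.mem_filter.2 ⟨h.mem_right, h⟩)
    rw [Finset.mem_filter] at this
    exact F.acyclic _ this.2

theorem exists_root (F : RootedForest N) {x : N} (hx : x ∈ F.nodes) :
    ∃ r ∈ F.roots, r = x ∨ F.IsAncestor r x := by
  induction x using F.wellFounded_isAncestor.induction with
  | _ x ih =>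
    rcases hp : F.parent x with _ | p
    · exact ⟨x, mem_roots.2 ⟨hx, hp⟩, Or.inl rfl⟩
    · have ha := IsAncestor.of_parent hp
      rcases ih p ha ha.mem_left with ⟨r, hr, rfl | h⟩
      · exact ⟨r, hr, Or.inr ha⟩
      · exact ⟨r, hr, Or.inr (h.trans ha)⟩

/-- Every finite strict order in which the elements above a given one form a chain is the ancestor
relation of a rooted forest. -/
theorem exists_of_order {N : Type*} (S : Finset N) (A : N → N → Prop)
    (irrefl : ∀ x, ¬ A x x)
    (trans : ∀ x y z, A z y → A y x → A z x)
    (total : ∀ x y z, A y x → A z x → y = z ∨ A y z ∨ A z y) :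
    ∃ F : RootedForest N, F.nodes = S ∧
      ∀ y x, F.IsAncestor y x ↔ y ∈ S ∧ x ∈ S ∧ A y x := by
  classical
  -- The parent of `x` is to be its lowest ancestor. It is found as the ancestor that itself has the
  -- most ancestors; the chain condition makes it lie below all the others.
  have hmin : ∀ x, (∃ y ∈ S, A y x) → ∃ y ∈ S, A y x ∧ ∀ z ∈ S, A z x → z = y ∨ A z y := by
    rintro x ⟨y₀, hy₀, hA₀⟩
    obtain ⟨y, hy, hmax⟩ := Finset.exists_max_image (S.filter (fun y => A y x))
      (fun y => (S.filter (fun z => A z y)).card) ⟨y₀, Finset.mem_filter.2 ⟨hy₀, hA₀⟩⟩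
    rw [Finset.mem_filter] at hy
    refine ⟨y, hy.1, hy.2, fun z hz hzx => ?_⟩
    rcases total x z y hzx hy.2 with h | h | h
    · exact Or.inl h
    · exact Or.inr h
    · exfalso
      have h1 := hmax z (Finset.mem_filter.2 ⟨hz, hzx⟩)
      refine absurd h1 (not_le.2 (Finset.card_lt_card ⟨?_, ?_⟩))
      · intro w hw
        rw [Finset.mem_filter] at hw ⊢
        exact ⟨hw.1, trans _ _ _ hw.2 h⟩
      · intro hs
        have := hs (Finset.mem_filter.2 ⟨hy.1, h⟩)
        rw [Finset.mem_filter] at this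
        exact irrefl _ this.2
  choose! m hmS hmA hmm using hmin
  let par : N → Option N := fun x => if x ∈ S ∧ ∃ y ∈ S, A y x then some (m x) else none
  have hpar : ∀ x y, par x = some y ↔ x ∈ S ∧ (∃ y ∈ S, A y x) ∧ m x = y := by
    intro x y
    by_cases h : x ∈ S ∧ ∃ y ∈ S, A y x
    · simp [par, h.1, h.2]
    · simp only [par, h, if_false]
      constructor
      · intro h'; cases h'
      · rintro ⟨h1, h2, -⟩; exact absurd ⟨h1, h2⟩ h
  have key : ∀ y x, Relation.TransGen (fun a b => par a = some b) x y →
      y ∈ S ∧ x ∈ S ∧ A y x := by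
    intro y x h
    induction h with
    | single h =>
      obtain ⟨h1, h2, rfl⟩ := (hpar _ _).1 h
      exact ⟨hmS _ h2, h1, hmA _ h2⟩
    | tail _ h ih =>
      obtain ⟨h1, h2, rfl⟩ := (hpar _ _).1 h
      exact ⟨hmS _ h2, ih.2.1, trans _ _ _ (hmA _ h2) ih.2.2⟩
  refine ⟨⟨S, par, ?_, ?_⟩, rfl, ?_⟩
  · intro x y h
    obtain ⟨h1, h2, rfl⟩ := (hpar _ _).1 h
    exact ⟨h1, hmS _ h2⟩
  · intro x h
    exact irrefl _ (key _ _ h).2.2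
  · intro y x
    refine ⟨key y x, ?_⟩
    rintro ⟨hy, hx, h⟩
    show Relation.TransGen (fun a b => par a = some b) x y
    -- Climbing from `x` to its parent `m x` strictly lowers the number of elements above, so the
    -- climb reaches `y`.
    induction hn : (S.filter (fun z => A z x)).card using Nat.strong_induction_on generalizing x with
    | _ n ih =>
      have h2 : ∃ y ∈ S, A y x := ⟨y, hy, h⟩
      have hp : par x = some (m x) := (hpar _ _).2 ⟨hx, h2, rfl⟩
      rcases hmm x h2 y hy h with rfl | h'
      · exact .single hp
      · refine .head hp (ih _ ?_ _ (hmS _ h2) h' rfl)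
        rw [← hn]
        refine Finset.card_lt_card ⟨?_, ?_⟩
        · intro w hw
          rw [Finset.mem_filter] at hw ⊢
          exact ⟨hw.1, trans _ _ _ hw.2 (hmA _ h2)⟩
        · intro hs
          have := hs (Finset.mem_filter.2 ⟨hmS _ h2, hmA _ h2⟩)
          rw [Finset.mem_filter] at this
          exact irrefl _ this.2

/-- A height function can be defined from the leaves upwards. -/
theorem exists_height_function (F : RootedForest N) (b : N → ℕ) :
    ∃ h : N → ℕ, ∀ x, h x = max ((F.children x).sup h + 1) (b x) := by
  classical
  -- The children are attached so that the recursive call receives the proof that its argument is a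
  -- descendant.
  let g : ∀ x : N, (∀ c, F.IsAncestor x c → ℕ) → ℕ := fun x r =>
    max ((F.children x).attach.sup
      (fun c => r c.1 (.of_parent (mem_children.1 c.2))) + 1) (b x)
  refine ⟨F.wellFounded_descendant.fix g, fun x => ?_⟩
  rw [F.wellFounded_descendant.fix_eq g x]
  simp only [g]
  rw [Finset.sup_attach (F.children x) (F.wellFounded_descendant.fix g)]

/-- The nodes in a set closed under taking ancestors form a rooted forest. -/
noncomputable def restrictTo (F : RootedForest N) (S : Finset N)
    (hup : ∀ x ∈ S, ∀ y, F.parent x = some y → y ∈ S) : RootedForest N where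
  nodes := S
  parent := by classical exact fun x => if x ∈ S then F.parent x else none
  parent_mem := by
    intro x y h
    by_cases hx : x ∈ S
    · rw [if_pos hx] at h
      exact ⟨hx, hup x hx y h⟩
    · rw [if_neg hx] at h; cases h
  acyclic := by
    intro x h
    refine F.acyclic x ((Relation.TransGen.mono (fun a b hab => ?_)) _ _ h)
    by_cases hx : a ∈ S
    · rwa [if_pos hx] at hab
    · rw [if_neg hx] at hab; cases hab

/-- If the parent maps of two forests agree on the nodes of the first, so do the ancestors. -/
theorem isAncestor_congr {F F' : RootedForest N}
    (h : ∀ z ∈ F'.nodes, F'.parent z = F.parent z) {x y : N} (hx : x ∈ F'.nodes) :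
    F'.IsAncestor y x ↔ F.IsAncestor y x := by
  induction x using F'.wellFounded_isAncestor.induction with
  | _ x ih =>
    rw [isAncestor_iff_parent, isAncestor_iff_parent, h x hx]
    refine exists_congr fun p => and_congr_right fun hp => ?_
    rw [← h x hx] at hp
    rw [ih p (.of_parent hp) (F'.parent_mem _ _ hp).2]

end RootedForest

/-! ### Heights and equivalence of partial decompositions -/

namespace PartialDecomposition

variable {V : Type*}

/-- Heights drop strictly along every path from a root, so the bound on the roots imposed by `intro`
bounds all stored heights. -/
theorem h_le_height (P : PartialDecomposition V) {x : Node V} (hx : x ∈ P.forest.nodes) :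
    P.h x ≤ P.height := by
  obtain ⟨r, hr, h⟩ := P.forest.exists_root hx
  refine le_trans ?_ (Finset.le_sup (f := P.h) hr)
  rcases h with rfl | h
  · exact le_rfl
  · exact (P.h_lt _ _ h).le

theorem Equivalent.symm {P Q : PartialDecomposition V} (h : P.Equivalent Q) :
    Q.Equivalent P := by
  obtain ⟨hX, ψ, h1, h2, h3⟩ := h
  refine ⟨hX.symm, ψ.symm, fun a b => ?_, fun a x hx ha => ?_, fun a => ?_⟩
  · rw [h1]; simp
  · have hx' : x ∈ P.X := hX ▸ hx
    have : ψ ⟨Sum.inl x, P.X_subset x hx'⟩ = a :=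
      Subtype.ext ((h2 _ x hx' rfl).trans ha.symm)
    rw [← this]; simp
  · rw [h3]; simp

theorem Equivalent.trans {P Q R : PartialDecomposition V} (h : P.Equivalent Q)
    (h' : Q.Equivalent R) : P.Equivalent R := by
  obtain ⟨hX, ψ, h1, h2, h3⟩ := h
  obtain ⟨hX', φ, h1', h2', h3'⟩ := h'
  refine ⟨hX.trans hX', ψ.trans φ, fun a b => ?_, fun a x hx ha => ?_, fun a => ?_⟩
  · rw [h1, h1']; rfl
  · exact h2' _ x (hX ▸ hx) (h2 a x hx ha)
  · rw [h3, h3']; rfl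

end PartialDecomposition

/-! ### Isomorphisms of partial decompositions, possibly of different graphs -/

namespace PartialDecomposition

variable {V V' V'' : Type*}

/-- `τ` maps the nodes of `P` to those of `Q`, acting as `σ` on the vertices of the bag. -/
structure IsIso (σ : Option V → Option V') (τ : Node V → Node V')
    (P : PartialDecomposition V) (Q : PartialDecomposition V') : Prop where
  X_eq : (Q.X : Set (Option V')) = σ '' P.X
  bijOn : Set.BijOn τ P.forest.nodes Q.forest.nodes
  parent_iff : ∀ a ∈ P.forest.nodes, ∀ b ∈ P.forest.nodes,
    P.forest.parent a = some b ↔ Q.forest.parent (τ a) = some (τ b)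
  apply_inl : ∀ x ∈ P.X, τ (Sum.inl x) = Sum.inl (σ x)
  h_apply : ∀ a ∈ P.forest.nodes, Q.h (τ a) = P.h a

/-- Replacing the bijection of subtypes by a total map on names lets one notion, `IsIso`, serve both
for equivalence (`σ = id`) and for the renaming of vertices between different graphs. -/
theorem equivalent_iff {P Q : PartialDecomposition V} :
    P.Equivalent Q ↔ ∃ τ, IsIso id τ P Q := by
  classical
  constructor
  · rintro ⟨hX, ψ, h1, h2, h3⟩
    refine ⟨fun a => if h : a ∈ P.forest.nodes then (ψ ⟨a, h⟩).1 else a, ?_, ?_, ?_, ?_, ?_⟩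
    · simp [hX]
    · refine ⟨fun a ha => ?_, fun a ha b hb hab => ?_, fun b hb => ?_⟩
      · rw [Finset.mem_coe] at ha
        simp only [dif_pos ha]; exact (ψ ⟨a, ha⟩).2
      · rw [Finset.mem_coe] at ha hb
        simp only [dif_pos ha, dif_pos hb] at hab
        exact congrArg Subtype.val (ψ.injective (Subtype.ext hab))
      · refine ⟨(ψ.symm ⟨b, hb⟩).1, (ψ.symm ⟨b, hb⟩).2, ?_⟩
        simp
    · intro a ha b hb
      simp only [dif_pos ha, dif_pos hb]
      exact h1 ⟨a, ha⟩ ⟨b, hb⟩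
    · intro x hx
      simp only [dif_pos (P.X_subset x hx)]
      exact h2 ⟨_, _⟩ x hx rfl
    · intro a ha
      simp only [dif_pos ha]
      exact (h3 ⟨a, ha⟩).symm
  · rintro ⟨τ, hτ⟩
    refine ⟨?_, hτ.bijOn.equiv, ?_, ?_, ?_⟩
    · have := hτ.X_eq
      simp only [Set.image_id] at this
      exact (Finset.coe_injective this).symm
    · intro a b
      exact hτ.parent_iff a.1 a.2 b.1 b.2
    · intro a x hx ha
      show τ a.1 = _
      rw [ha, hτ.apply_inl x hx]; rfl
    · intro a
      exact (hτ.h_apply a.1 a.2).symm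

namespace IsIso

variable {σ : Option V → Option V'} {τ : Node V → Node V'} {P : PartialDecomposition V}
  {Q : PartialDecomposition V'}

theorem mem (h : IsIso σ τ P Q) {a : Node V} (ha : a ∈ P.forest.nodes) :
    τ a ∈ Q.forest.nodes := h.bijOn.mapsTo ha

theorem inj (h : IsIso σ τ P Q) {a b : Node V} (ha : a ∈ P.forest.nodes)
    (hb : b ∈ P.forest.nodes) (hab : τ a = τ b) : a = b := h.bijOn.injOn ha hb hab

theorem surj (h : IsIso σ τ P Q) {b : Node V'} (hb : b ∈ Q.forest.nodes) :
    ∃ a ∈ P.forest.nodes, τ a = b := h.bijOn.surjOn hb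

theorem injOn_X (h : IsIso σ τ P Q) : Set.InjOn σ P.X := by
  intro x hx y hy hxy
  have := h.inj (P.X_subset x hx) (P.X_subset y hy)
    (by rw [h.apply_inl x hx, h.apply_inl y hy, hxy])
  exact Sum.inl_injective this

theorem mem_X_iff (h : IsIso σ τ P Q) {y : Option V'} : y ∈ Q.X ↔ ∃ x ∈ P.X, σ x = y := by
  rw [← Finset.mem_coe, h.X_eq]; simp

theorem card_X (h : IsIso σ τ P Q) : Q.X.card = P.X.card := by
  classical
  have : Q.X = P.X.image σ := Finset.coe_injective (by rw [h.X_eq]; simp)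
  rw [this, Finset.card_image_of_injOn h.injOn_X]

theorem card_nodes (h : IsIso σ τ P Q) : Q.forest.nodes.card = P.forest.nodes.card :=
  (Finset.card_nbij τ (fun _ ha => h.bijOn.mapsTo ha) h.bijOn.injOn h.bijOn.surjOn).symm

theorem parent_some (h : IsIso σ τ P Q) {a : Node V} {b : Node V'} (ha : a ∈ P.forest.nodes) :
    Q.forest.parent (τ a) = some b ↔ ∃ c ∈ P.forest.nodes, P.forest.parent a = some c ∧ τ c = b := by
  constructor
  · intro hb
    obtain ⟨c, hc, rfl⟩ := h.surj (Q.forest.parent_mem _ _ hb).2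
    exact ⟨c, hc, (h.parent_iff a ha c hc).2 hb, rfl⟩
  · rintro ⟨c, hc, hp, rfl⟩
    exact (h.parent_iff a ha c hc).1 hp

/-- Only parents are preserved by definition; ancestors follow by induction from the root to `b`. -/
theorem isAncestor_iff (h : IsIso σ τ P Q) {a b : Node V} (ha : a ∈ P.forest.nodes)
    (hb : b ∈ P.forest.nodes) :
    P.forest.IsAncestor a b ↔ Q.forest.IsAncestor (τ a) (τ b) := by
  induction b using P.forest.wellFounded_isAncestor.induction with
  | _ b ih =>
    rw [RootedForest.isAncestor_iff_parent, RootedForest.isAncestor_iff_parent]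
    constructor
    · rintro ⟨p, hp, h'⟩
      have hpm := (P.forest.parent_mem _ _ hp).2
      refine ⟨τ p, (h.parent_iff b hb p hpm).1 hp, ?_⟩
      rcases h' with rfl | h'
      · exact Or.inl rfl
      · exact Or.inr ((ih p (.of_parent hp) hpm).1 h')
    · rintro ⟨p', hp', h'⟩
      obtain ⟨p, hpm, hp, rfl⟩ := (h.parent_some hb).1 hp'
      refine ⟨p, hp, ?_⟩
      rcases h' with h' | h'
      · exact Or.inl (h.inj hpm ha h')
      · exact Or.inr ((ih p (.of_parent hp) hpm).2 h')

theorem parent_none (h : IsIso σ τ P Q) {a : Node V} (ha : a ∈ P.forest.nodes) :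
    Q.forest.parent (τ a) = none ↔ P.forest.parent a = none := by
  rw [Option.eq_none_iff_forall_ne_some, Option.eq_none_iff_forall_ne_some]
  constructor
  · intro hn c hc
    exact hn _ ((h.parent_some ha).2 ⟨c, (P.forest.parent_mem _ _ hc).2, hc, rfl⟩)
  · intro hn c hc
    obtain ⟨d, -, hd, -⟩ := (h.parent_some ha).1 hc
    exact hn d hd

theorem mem_children_iff (h : IsIso σ τ P Q) {a : Node V} (ha : a ∈ P.forest.nodes)
    {c : Node V'} :
    c ∈ Q.forest.children (τ a) ↔ ∃ d ∈ P.forest.children a, τ d = c := by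
  simp only [RootedForest.mem_children]
  constructor
  · intro hc
    obtain ⟨d, hd, rfl⟩ := h.surj (Q.forest.parent_mem _ _ hc).1
    exact ⟨d, (h.parent_iff d hd a ha).2 hc, rfl⟩
  · rintro ⟨d, hd, rfl⟩
    exact (h.parent_iff d (P.forest.parent_mem _ _ hd).1 a ha).1 hd

theorem children_sup (h : IsIso σ τ P Q) {a : Node V} (ha : a ∈ P.forest.nodes) :
    (Q.forest.children (τ a)).sup Q.h = (P.forest.children a).sup P.h := by
  apply le_antisymm
  · refine Finset.sup_le fun c hc => ?_
    obtain ⟨d, hd, rfl⟩ := (h.mem_children_iff ha).1 hc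
    rw [h.h_apply d (P.forest.parent_mem _ _ (RootedForest.mem_children.1 hd)).1]
    exact Finset.le_sup hd
  · refine Finset.sup_le fun d hd => ?_
    rw [← h.h_apply d (P.forest.parent_mem _ _ (RootedForest.mem_children.1 hd)).1]
    exact Finset.le_sup ((h.mem_children_iff ha).2 ⟨d, hd, rfl⟩)

theorem mem_roots_iff (h : IsIso σ τ P Q) {c : Node V'} :
    c ∈ Q.forest.roots ↔ ∃ d ∈ P.forest.roots, τ d = c := by
  simp only [RootedForest.mem_roots]
  constructor
  · rintro ⟨hc, hn⟩
    obtain ⟨d, hd, rfl⟩ := h.surj hc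
    exact ⟨d, ⟨hd, (h.parent_none hd).1 hn⟩, rfl⟩
  · rintro ⟨d, ⟨hd, hn⟩, rfl⟩
    exact ⟨h.mem hd, (h.parent_none hd).2 hn⟩

theorem height_eq (h : IsIso σ τ P Q) : Q.height = P.height := by
  apply le_antisymm
  · refine Finset.sup_le fun c hc => ?_
    obtain ⟨d, hd, rfl⟩ := h.mem_roots_iff.1 hc
    rw [h.h_apply d (RootedForest.mem_roots.1 hd).1]
    exact Finset.le_sup hd
  · refine Finset.sup_le fun d hd => ?_
    rw [← h.h_apply d (RootedForest.mem_roots.1 hd).1]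
    exact Finset.le_sup (h.mem_roots_iff.2 ⟨d, hd, rfl⟩)

theorem trans {σ' : Option V' → Option V''} {τ' : Node V' → Node V''}
    {R : PartialDecomposition V''} (h : IsIso σ τ P Q) (h' : IsIso σ' τ' Q R) :
    IsIso (σ' ∘ σ) (τ' ∘ τ) P R where
  X_eq := by rw [h'.X_eq, h.X_eq, Set.image_comp]
  bijOn := h'.bijOn.comp h.bijOn
  parent_iff a ha b hb := by
    rw [h.parent_iff a ha b hb, h'.parent_iff _ (h.mem ha) _ (h.mem hb)]; rfl
  apply_inl x hx := by
    simp only [Function.comp]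
    rw [h.apply_inl x hx, h'.apply_inl _ (h.mem_X_iff.2 ⟨x, hx, rfl⟩)]
  h_apply a ha := by
    simp only [Function.comp]
    rw [h'.h_apply _ (h.mem ha), h.h_apply a ha]

/-- The map `σ` need not be injective off the bag, so a left inverse on the bag is all that can be
asked for. -/
theorem symm (h : IsIso σ τ P Q) {σ' : Option V' → Option V} (hσ : ∀ x ∈ P.X, σ' (σ x) = x) :
    ∃ τ', IsIso σ' τ' Q P := by
  classical
  have hinv := h.bijOn.invOn_invFunOn
  have hl : ∀ a ∈ P.forest.nodes, Function.invFunOn τ P.forest.nodes (τ a) = a :=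
    fun a ha => hinv.1 ha
  refine ⟨Function.invFunOn τ P.forest.nodes, ?_, ?_, ?_, ?_, ?_⟩
  · rw [h.X_eq, ← Set.image_comp]
    ext x
    constructor
    · intro hx
      exact ⟨x, hx, hσ x hx⟩
    · rintro ⟨y, hy, rfl⟩
      simp only [Function.comp]
      rwa [hσ y hy]
  · exact hinv.symm.bijOn h.bijOn.surjOn.mapsTo_invFunOn h.bijOn.mapsTo
  · intro a ha b hb
    obtain ⟨a, ha', rfl⟩ := h.surj ha
    obtain ⟨b, hb', rfl⟩ := h.surj hb
    rw [hl a ha', hl b hb', h.parent_iff a ha' b hb']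
  · intro x hx
    obtain ⟨y, hy, rfl⟩ := h.mem_X_iff.1 hx
    rw [← h.apply_inl y hy, hl _ (P.X_subset y hy), hσ y hy]
  · intro a ha
    obtain ⟨a, ha', rfl⟩ := h.surj ha
    rw [hl a ha', h.h_apply a ha']

end IsIso

/-- There is an isomorphic copy in which the node `a` is named `τ a`. -/
theorem exists_isIso_of_injOn [DecidableEq V'] [DecidableEq (Node V')]
    (P : PartialDecomposition V) (σ : Option V → Option V')
    (τ : Node V → Node V') (hτ : Set.InjOn τ P.forest.nodes)
    (hσ : ∀ x ∈ P.X, τ (Sum.inl x) = Sum.inl (σ x)) :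
    ∃ Q : PartialDecomposition V', IsIso σ τ P Q ∧ Q.X = P.X.image σ ∧
      Q.forest.nodes = P.forest.nodes.image τ ∧ ∀ a ∉ Q.forest.nodes, Q.h a = 0 := by
  classical
  let inv : Node V' → Node V := Function.invFunOn τ P.forest.nodes
  have hinv : ∀ a ∈ P.forest.nodes, inv (τ a) = a := fun a ha => hτ.leftInvOn_invFunOn ha
  have hinv' : ∀ b ∈ P.forest.nodes.image τ, inv b ∈ P.forest.nodes ∧ τ (inv b) = b := by
    intro b hb
    obtain ⟨a, ha, rfl⟩ := Finset.mem_image.1 hb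
    rw [hinv a ha]; exact ⟨ha, rfl⟩
  let par : Node V' → Option (Node V') := fun b =>
    if b ∈ P.forest.nodes.image τ then (P.forest.parent (inv b)).map τ else none
  have hpar : ∀ b c, par b = some c → b ∈ P.forest.nodes.image τ ∧
      c ∈ P.forest.nodes.image τ ∧ P.forest.parent (inv b) = some (inv c) := by
    intro b c h
    by_cases hb : b ∈ P.forest.nodes.image τ
    · simp only [par, if_pos hb, Option.map_eq_some_iff] at h
      obtain ⟨d, hd, rfl⟩ := h
      have hdm := (P.forest.parent_mem _ _ hd).2
      exact ⟨hb, Finset.mem_image_of_mem _ hdm, by rw [hinv d hdm]; exact hd⟩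
    · simp only [par, if_neg hb] at h; cases h
  have hanc : ∀ b c, Relation.TransGen (fun a b => par a = some b) b c →
      P.forest.IsAncestor (inv c) (inv b) := by
    intro b c h
    induction h with
    | single h => exact .of_parent (hpar _ _ h).2.2
    | tail _ h ih => exact (RootedForest.IsAncestor.of_parent (hpar _ _ h).2.2).trans ih
  let F : RootedForest (Node V') :=
    { nodes := P.forest.nodes.image τ
      parent := par
      parent_mem := fun x y h => ⟨(hpar x y h).1, (hpar x y h).2.1⟩
      acyclic := fun x h => P.forest.acyclic _ (hanc x x h) }
  -- Only the heights of nodes matter. Setting the others to `0` makes normal forms finite in number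
  -- later on.
  refine ⟨⟨F, P.X.image σ, fun b => if b ∈ F.nodes then P.h (inv b) else 0, ?_, ?_, ?_⟩,
    ⟨?_, ?_, ?_, hσ, ?_⟩, rfl, rfl, ?_⟩
  · intro x hx
    obtain ⟨y, hy, rfl⟩ := Finset.mem_image.1 hx
    rw [← hσ y hy]
    exact Finset.mem_image_of_mem _ (P.X_subset y hy)
  · intro x hx
    rw [if_pos hx]
    exact P.h_pos _ (hinv' x hx).1
  · intro x y h
    rw [if_pos h.mem_left, if_pos h.mem_right]
    exact P.h_lt _ _ (hanc _ _ h)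
  · simp
  · refine ⟨fun a ha => ?_, hτ, ?_⟩
    · exact Finset.mem_coe.2 (Finset.mem_image_of_mem _ ha)
    · show Set.SurjOn τ P.forest.nodes (P.forest.nodes.image τ : Finset _)
      rw [Finset.coe_image]
      exact Set.surjOn_image _ _
  · intro a ha b hb
    have hm : τ a ∈ P.forest.nodes.image τ := Finset.mem_image_of_mem _ ha
    show _ ↔ par (τ a) = some (τ b)
    simp only [par, if_pos hm, hinv a ha, Option.map_eq_some_iff]
    constructor
    · intro h; exact ⟨b, h, rfl⟩
    · rintro ⟨c, hc, hcb⟩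
      rw [← hτ (P.forest.parent_mem _ _ hc).2 hb hcb]; exact hc
  · intro a ha
    have hm : τ a ∈ P.forest.nodes.image τ := Finset.mem_image_of_mem _ ha
    show (if τ a ∈ P.forest.nodes.image τ then P.h (inv (τ a)) else 0) = _
    rw [if_pos hm, hinv a ha]
  · intro a ha
    exact if_neg ha

/-! ### The number of inequivalent partial decompositions of bounded size -/

/-- One value more than necessary, so that `0` is available off `s` even when `m = 0`. -/
theorem _root_.Finset.exists_injOn_fin {α : Type*} (s : Finset α) {m : ℕ} (hs : s.card ≤ m) :
    ∃ ε : α → Fin (m + 1), Set.InjOn ε s := by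
  classical
  refine ⟨fun a => if h : a ∈ s then
    Fin.castLE (hs.trans (Nat.le_succ m)) (s.equivFin ⟨a, h⟩) else 0, fun a ha b hb hab => ?_⟩
  rw [Finset.mem_coe] at ha hb
  simp only [dif_pos ha, dif_pos hb] at hab
  exact congrArg Subtype.val (s.equivFin.injective (Fin.castLE_injective _ hab))

/-- Pairwise inequivalent partial decompositions with the same bag and of bounded size are bounded
in number. -/
theorem exists_length_bound (p m T : ℕ) : ∃ C, ∀ (V : Type) (X : Finset (Option V)),
    X.card ≤ p → ∀ A : Table V, A.Pairwise (fun P Q => ¬ P.Equivalent Q) →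
    (∀ P ∈ A, P.X = X ∧ P.forest.nodes.card ≤ m ∧ ∀ x ∈ P.forest.nodes, P.h x ≤ T) →
    A.length ≤ C := by
  classical
  -- After numbering the nodes and the bag, a partial decomposition is coded by the numbers of its
  -- nodes, the parent relation, the position of every bag vertex, and the graph of `h`. Finitely
  -- many codes have heights at most `T`.
  let Code := Set (Fin (m + 1)) × Set (Fin (m + 1) × Fin (m + 1)) ×
    Set (Fin (p + 1) × Fin (m + 1)) × Set (Fin (m + 1) × ℕ)
  let small : Set Code := {c | ∀ q ∈ c.2.2.2, q.2 ≤ T}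
  have hfin : small.Finite := by
    have h1 : {H : Set (Fin (m + 1) × ℕ) | ∀ q ∈ H, q.2 ≤ T}.Finite := by
      have h2 : {q : Fin (m + 1) × ℕ | q.2 ≤ T}.Finite := by
        refine Set.Finite.subset ((Set.finite_univ (α := Fin (m + 1))).prod (Set.finite_Iic T)) ?_
        intro q hq
        exact ⟨Set.mem_univ _, hq⟩
      exact h2.finite_subsets
    refine Set.Finite.subset ((Set.finite_univ).prod ((Set.finite_univ).prod
      ((Set.finite_univ).prod h1))) ?_
    intro c hc
    exact ⟨Set.mem_univ _, Set.mem_univ _, Set.mem_univ _, hc⟩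
  refine ⟨hfin.toFinset.card, fun V X hX A hA hb => ?_⟩
  obtain ⟨e, he⟩ := X.exists_injOn_fin hX
  have hemb : ∀ P : PartialDecomposition V, ∃ ε : Node V → Fin (m + 1), P ∈ A →
      Set.InjOn ε P.forest.nodes := by
    intro P
    by_cases hP : P ∈ A
    · obtain ⟨ε, hε⟩ := P.forest.nodes.exists_injOn_fin (hb P hP).2.1
      exact ⟨ε, fun _ => hε⟩
    · exact ⟨fun _ => 0, fun h => absurd h hP⟩
  choose ε hε using hemb
  let code : PartialDecomposition V → Code := fun P =>
    (ε P '' P.forest.nodes,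
     {q | ∃ a ∈ P.forest.nodes, ∃ b ∈ P.forest.nodes, P.forest.parent a = some b ∧
        (ε P a, ε P b) = q},
     {q | ∃ x ∈ X, (e x, ε P (Sum.inl x)) = q},
     {q | ∃ a ∈ P.forest.nodes, (ε P a, P.h a) = q})
  -- Equal codes give an isomorphism: `τ a` is the node of `Q` with the same number as `a`.
  have hcode : ∀ P ∈ A, ∀ Q ∈ A, code P = code Q → P.Equivalent Q := by
    intro P hP Q hQ h
    have h1 := congrArg Prod.fst h
    have h2 := congrArg (fun c => c.2.1) h
    have h3 := congrArg (fun c => c.2.2.1) h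
    have h4 := congrArg (fun c => c.2.2.2) h
    simp only [code] at h1 h2 h3 h4
    have hiP := hε P hP
    have hiQ := hε Q hQ
    have hex : ∀ a ∈ P.forest.nodes, ∃ b ∈ Q.forest.nodes, ε Q b = ε P a := by
      intro a ha
      have : ε P a ∈ ε P '' P.forest.nodes := ⟨a, ha, rfl⟩
      rw [h1] at this
      exact this
    choose! τ hτm hτe using hex
    refine equivalent_iff.2 ⟨τ, ?_, ⟨hτm, ?_, ?_⟩, ?_, ?_, ?_⟩
    · rw [Set.image_id, (hb P hP).1, (hb Q hQ).1]
    · intro a ha b hb hab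
      exact hiP ha hb (by rw [← hτe a ha, ← hτe b hb, hab])
    · intro b hb
      have : ε Q b ∈ ε Q '' Q.forest.nodes := ⟨b, hb, rfl⟩
      rw [← h1] at this
      obtain ⟨a, ha, hab⟩ := this
      exact ⟨a, ha, hiQ (hτm a ha) hb ((hτe a ha).trans hab)⟩
    · intro a ha b hb
      have := Set.ext_iff.1 h2 (ε P a, ε P b)
      simp only [Set.mem_ofPred_eq, Prod.mk.injEq] at this
      constructor
      · intro hp
        obtain ⟨a', ha', b', hb', hp', e1, e2⟩ := this.1 ⟨a, ha, b, hb, hp, rfl, rfl⟩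
        rw [← hτe a ha] at e1
        rw [← hτe b hb] at e2
        rw [← hiQ ha' (hτm a ha) e1, ← hiQ hb' (hτm b hb) e2]; exact hp'
      · intro hp
        obtain ⟨a', ha', b', hb', hp', e1, e2⟩ := this.2
          ⟨τ a, hτm a ha, τ b, hτm b hb, hp, hτe a ha, hτe b hb⟩
        rw [← hiP ha' ha e1, ← hiP hb' hb e2]; exact hp'
    · intro x hx
      rw [(hb P hP).1] at hx
      have hxP : Sum.inl x ∈ P.forest.nodes := P.X_subset x ((hb P hP).1 ▸ hx)
      have hxQ : Sum.inl x ∈ Q.forest.nodes := Q.X_subset x ((hb Q hQ).1 ▸ hx)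
      have := (Set.ext_iff.1 h3 (e x, ε P (Sum.inl x))).1 ⟨x, hx, rfl⟩
      obtain ⟨y, hy, hxy⟩ := this
      rw [Prod.mk.injEq] at hxy
      have := he hy hx hxy.1
      subst this
      exact hiQ (hτm _ hxP) hxQ ((hτe _ hxP).trans hxy.2.symm)
    · intro a ha
      have := (Set.ext_iff.1 h4 (ε P a, P.h a)).1 ⟨a, ha, rfl⟩
      obtain ⟨b, hb, hab⟩ := this
      rw [Prod.mk.injEq] at hab
      rw [hiQ (hτm a ha) hb ((hτe a ha).trans hab.1.symm), hab.2]
  have hnd : (A.map code).Nodup := by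
    rw [List.Nodup, List.pairwise_map]
    refine List.Pairwise.imp_of_mem ?_ hA
    intro P Q hP hQ hne h
    exact hne (hcode P hP Q hQ h)
  have hsub : (A.map code).toFinset ⊆ hfin.toFinset := by
    intro c hc
    rw [List.mem_toFinset, List.mem_map] at hc
    obtain ⟨P, hP, rfl⟩ := hc
    rw [Set.Finite.mem_toFinset]
    rintro q ⟨a, ha, rfl⟩
    exact (hb P hP).2.2 a ha
  have := Finset.card_le_card hsub
  rwa [List.toFinset_card_of_nodup hnd, List.length_map] at this

end PartialDecomposition

/-- If pairwise inequivalent members of `S` are bounded in number, `S` has a table, and its entries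
may be chosen in `S' ⊆ S` if this meets every class. -/
theorem exists_isTableOf {V : Type*} (S S' : Set (PartialDecomposition V)) (hS' : S' ⊆ S)
    (hrep : ∀ Q ∈ S, ∃ P ∈ S', P.Equivalent Q) (C : ℕ)
    (hC : ∀ A : Table V, A.Pairwise (fun P Q => ¬ P.Equivalent Q) → (∀ P ∈ A, P ∈ S') →
      A.length ≤ C) :
    ∃ A : Table V, IsTableOf S A ∧ ∀ P ∈ A, P ∈ S' := by
  classical
  let p : ℕ → Prop := fun k => ∃ A : Table V,
    A.Pairwise (fun P Q => ¬ P.Equivalent Q) ∧ (∀ P ∈ A, P ∈ S') ∧ A.length = k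
  have h0 : p 0 := ⟨[], List.Pairwise.nil, by simp, rfl⟩
  -- A longest list of pairwise inequivalent members of `S'` meets every class, since otherwise a
  -- missing representative could be put in front of it.
  have hspec := Nat.findGreatest_spec (P := p) (Nat.zero_le C) h0
  obtain ⟨A, hA, hAS, hlen⟩ := hspec
  refine ⟨A, ⟨hA, fun P hP => hS' (hAS P hP), fun Q hQ => ?_⟩, hAS⟩
  obtain ⟨P, hP, hPQ⟩ := hrep Q hQ
  by_contra hne
  push Not at hne
  have hp : p (A.length + 1) := by
    refine ⟨P :: A, List.pairwise_cons.2 ⟨fun R hR hPR => ?_, hA⟩, ?_, rfl⟩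
    · exact hne R hR (hPR.symm.trans hPQ)
    · intro R hR
      rcases List.mem_cons.1 hR with rfl | hR
      · exact hP
      · exact hAS R hR
  have hle : A.length + 1 ≤ C := by
    obtain ⟨A', h1, h2, h3⟩ := hp
    rw [← h3]; exact hC A' h1 h2
  have := Nat.le_findGreatest hle hp
  omega

/-! ### The depth first search -/

namespace AlgState

variable {V : Type*}

/-- `x` may follow the stack `l`: it is adjacent to its top, if there is one. -/
def Near (G : SimpleGraph V) (l : List V) (x : V) : Prop := ∀ v ∈ l.head?, G.Adj v x

/-- There is a walk of at most `L` edges from `x` to `y` that avoids `l`, presented as a sequence of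
`L` steps some of which may be stationary. -/
def Walks (G : SimpleGraph V) (L : ℕ) (l : List V) (x y : V) : Prop :=
  ∃ p : ℕ → V, p 0 = x ∧ p L = y ∧ (∀ i < L, p i = p (i + 1) ∨ G.Adj (p i) (p (i + 1))) ∧
    ∀ i ≤ L, p i ∉ l

theorem Walks.refl (G : SimpleGraph V) (L : ℕ) {l : List V} {x : V} (hx : x ∉ l) :
    Walks G L l x x :=
  ⟨fun _ => x, rfl, rfl, fun _ _ => Or.inl rfl, fun _ _ => hx⟩

/-- A path given by a list yields a walk between its ends. -/
theorem walks_of_isChain (G : SimpleGraph V) {L : ℕ} {l m : List V} {x y : V}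
    (hne : m ≠ []) (hx : m.head hne = x) (hy : m.getLast hne = y) (hm : m.IsChain G.Adj)
    (hlen : m.length ≤ L + 1) (hl : ∀ z ∈ m, z ∉ l) : Walks G L l x y := by
  have hpos : 0 < m.length := List.length_pos_iff.2 hne
  have hlt : ∀ i, min i (m.length - 1) < m.length := fun i => by omega
  -- The walk stops at the last vertex of the path and remains there for the rest of the `L` steps.
  refine ⟨fun i => m[min i (m.length - 1)]'(hlt i), ?_, ?_, fun i _ => ?_, fun i _ => ?_⟩
  · simp only [Nat.zero_min]
    rw [← hx, List.head_eq_getElem]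
  · have : min L (m.length - 1) = m.length - 1 := by omega
    simp only [this]
    rw [← hy, List.getLast_eq_getElem]
  · by_cases h : i < m.length - 1
    · right
      have h1 : min i (m.length - 1) = i := by omega
      have h2 : min (i + 1) (m.length - 1) = i + 1 := by omega
      simp only [h1, h2]
      exact List.isChain_iff_getElem.1 hm i (by omega)
    · left
      have h1 : min i (m.length - 1) = min (i + 1) (m.length - 1) := by omega
      simp only [h1]
  · exact hl _ (List.getElem_mem _)

theorem mem_choices {G : SimpleGraph V} {s : AlgState V} {u : V} :
    u ∈ s.choices G ↔ u ∉ s.visited ∧ Near G s.memory.stack u := Iff.rfl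

variable [LinearOrder V]

/-- The invariant of the search. The set `W` consists of the vertices up to the child of the top of
the stack that was left last. -/
structure SearchInv (L : ℕ) (G : SimpleGraph V) (s : AlgState V) (W : Set V) : Prop where
  nodup : s.memory.stack.Nodup
  visited_of_mem : ∀ v ∈ s.memory.stack, v ∈ s.visited
  isChain : s.memory.stack.IsChain G.Adj
  length_le : s.memory.stack.length ≤ L
  closed : ∀ v ∈ s.visited, v ∉ s.memory.stack → ∀ x, G.Adj v x → x ∈ s.visited
  suffix_least : ∀ l' u l, s.memory.stack = l' ++ u :: l → ∀ x < u, Near G l x → x ∈ s.visited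
  suffix_walks : ∀ l' u l, s.memory.stack = l' ++ u :: l → ∀ x ∈ s.visited, x ∉ l →
    Near G l x → ∃ y ≤ u, Near G l y ∧ Walks G L l x y
  lower : IsLowerSet W
  low : ∀ x ∈ W, Near G s.memory.stack x → x ∈ s.visited
  reach : ∀ x ∈ s.visited, x ∉ s.memory.stack → Near G s.memory.stack x →
    ∃ y ∈ W, Near G s.memory.stack y ∧ Walks G L s.memory.stack x y

theorem SearchInv.initial (L : ℕ) (G : SimpleGraph V) {s : AlgState V}
    (hs : s.memory.stack = []) (hv : s.visited = ∅) : SearchInv L G s ∅ where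
  nodup := by simp [hs]
  visited_of_mem := by simp [hs]
  isChain := by simp [hs]
  length_le := by simp [hs]
  closed := by simp [hv]
  suffix_least := by simp [hs]
  suffix_walks := by simp [hs]
  lower := isLowerSet_empty
  low := by simp
  reach := by simp [hv]

/-- Which vertices the search may discover next can be told without knowing the vertices
discovered before. -/
theorem SearchInv.mem_choices_iff {L : ℕ} {G : SimpleGraph V} {s : AlgState V} {W : Set V}
    (h : SearchInv L G s W) (u : V) :
    u ∈ s.choices G ↔ u ∉ s.memory.stack ∧ Near G s.memory.stack u ∧
      ¬ ∃ y ∈ W, Near G s.memory.stack y ∧ Walks G L s.memory.stack u y := by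
  rw [mem_choices]
  constructor
  · rintro ⟨hu, hn⟩
    refine ⟨fun hm => hu (h.visited_of_mem u hm), hn, ?_⟩
    rintro ⟨y, hy, hny, p, hp0, hpL, hp, hoff⟩
    -- Followed backwards from its visited end `y`, the walk meets only visited vertices: it avoids
    -- the stack, and neighbours of visited vertices off the stack are visited.
    have : ∀ i ≤ L, p (L - i) ∈ s.visited := by
      intro i
      induction i with
      | zero => intro _; rw [Nat.sub_zero, hpL]; exact h.low y hy hny
      | succ i ih =>
        intro hi
        have hv := ih (by omega)
        have he : L - i = L - (i + 1) + 1 := by omega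
        rw [he] at hv
        rcases hp (L - (i + 1)) (by omega) with h' | h'
        · rwa [h']
        · exact h.closed _ hv (hoff _ (by omega)) _ h'.symm
    have h0 := this L le_rfl
    rw [Nat.sub_self, hp0] at h0
    exact hu h0
  · rintro ⟨hu, hn, hw⟩
    exact ⟨fun hv => hw (h.reach u hv hu hn), hn⟩

/-- The two suffix conditions store, for every stack vertex, what will be needed once it has been
left and the part below it is the whole stack. A vertex discovered while `l` is on the stack is
joined to the child of `l` by the stack itself, a walk avoiding `l` whose length is at most that of
the stack. This is why walks of length `L` suffice. -/
theorem SearchInv.discover {L : ℕ} {G : SimpleGraph V} {s : AlgState V} {W : Set V}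
    (h : SearchInv L G s W) {u : V} (hu : IsLeast (s.choices G) u)
    (hlen : s.memory.stack.length + 1 ≤ L) (A B : Table V) :
    SearchInv L G ⟨⟨u :: s.memory.stack, A, B⟩, insert u s.visited⟩ ∅ := by
  have hunv : u ∉ s.visited := hu.1.1
  have hust : u ∉ s.memory.stack := fun hm => hunv (h.visited_of_mem u hm)
  have hchain : (u :: s.memory.stack).IsChain G.Adj :=
    h.isChain.cons (fun y hy => (hu.1.2 y hy).symm)
  have hnear : ∀ l' v l, s.memory.stack = l' ++ v :: l → Near G l v := by
    intro l' v l hs y hy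
    have := h.isChain
    rw [hs, List.isChain_append] at this
    exact ((List.isChain_cons.1 this.2.1).1 y hy).symm
  refine ⟨?_, ?_, hchain, hlen, ?_, ?_, ?_, isLowerSet_empty, by simp, ?_⟩
  · exact List.nodup_cons.2 ⟨hust, h.nodup⟩
  · intro v hv
    rcases List.mem_cons.1 hv with rfl | hv
    · exact Set.mem_insert _ _
    · exact Set.mem_insert_of_mem _ (h.visited_of_mem v hv)
  · intro v hv hvs x hx
    have hvs : v ≠ u ∧ v ∉ s.memory.stack := by simpa using hvs
    exact Set.mem_insert_of_mem _
      (h.closed v (hv.resolve_left hvs.1) hvs.2 x hx)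
  · intro l' v l hs x hxv hx
    rcases l' with _ | ⟨a, l'⟩
    · simp only [List.nil_append, List.cons.injEq] at hs
      obtain ⟨rfl, rfl⟩ := hs
      by_contra hxn
      have hxn' : x ∉ s.visited := fun h' => hxn (Set.mem_insert_of_mem _ h')
      exact absurd (hu.2 ⟨hxn', hx⟩) (not_le.2 hxv)
    · simp only [List.cons_append, List.cons.injEq] at hs
      exact Set.mem_insert_of_mem _ (h.suffix_least l' v l hs.2 x hxv hx)
  · intro l' v l hs x hx hxl hxn
    rcases l' with _ | ⟨a, l'⟩
    · simp only [List.nil_append, List.cons.injEq] at hs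
      obtain ⟨rfl, rfl⟩ := hs
      rcases hx with rfl | hx
      · exact ⟨x, le_rfl, hxn, Walks.refl G L hxl⟩
      -- The witness `y` for the old stack is at most `u`: were `u` smaller, it would lie in the
      -- lower set `W` and hence have been visited.
      · obtain ⟨y, hyW, hyn, hw⟩ := h.reach x hx hxl hxn
        refine ⟨y, ?_, hyn, hw⟩
        by_contra hlt
        exact hunv (h.low u (h.lower (not_le.1 hlt).le hyW) hu.1.2)
    · simp only [List.cons_append, List.cons.injEq] at hs
      obtain ⟨rfl, hs⟩ := hs
      rcases hx with rfl | hx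
      -- For the new vertex the walk descends along the stack to `v`.
      · refine ⟨v, le_rfl, hnear l' v l hs, ?_⟩
        have hsplit : x :: s.memory.stack = (x :: (l' ++ [v])) ++ l := by simp [hs]
        refine walks_of_isChain G (m := x :: (l' ++ [v])) (by simp) (by simp) (by simp) ?_ ?_ ?_
        · have hc := hchain
          rw [hsplit, List.isChain_append] at hc
          exact hc.1
        · have := congrArg List.length hsplit
          rw [List.length_append] at this
          simp only [List.length_cons] at this ⊢
          omega
        · have hnd : (x :: s.memory.stack).Nodup := List.nodup_cons.2 ⟨hust, h.nodup⟩
          rw [hsplit, List.nodup_append] at hnd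
          intro z hz hzl
          exact hnd.2.2 z hz z hzl rfl
      · exact h.suffix_walks l' v l hs x hx hxl hxn
  · intro x hx hxs hxn
    -- A visited vertex off the stack next to the new top would have had `u` visited already. So
    -- nothing has to be reached and `W` may be empty.
    exfalso
    have hxs : x ≠ u ∧ x ∉ s.memory.stack := by simpa using hxs
    have hxv := hx.resolve_left hxs.1
    exact hunv (h.closed x hxv hxs.2 u (hxn u rfl).symm)

/-- The suffix conditions for the top `u` turn into the conditions `low` and `reach` for the
remaining stack with `W = Set.Iic u`. The vertex `u` is closed because an unvisited neighbour would
have been a choice. -/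
theorem SearchInv.leave {L : ℕ} {G : SimpleGraph V} {s : AlgState V} {W : Set V}
    (h : SearchInv L G s W) {u : V} {l : List V} (hnone : s.choices G = ∅)
    (hs : s.memory.stack = u :: l) (A B : Table V) :
    SearchInv L G ⟨⟨l, A, B⟩, s.visited⟩ (Set.Iic u) := by
  have hnd := h.nodup
  rw [hs, List.nodup_cons] at hnd
  refine ⟨hnd.2, ?_, ?_, ?_, ?_, ?_, ?_, isLowerSet_Iic u, ?_, ?_⟩
  · exact fun v hv => h.visited_of_mem v (hs ▸ List.mem_cons_of_mem _ hv)
  · have := h.isChain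
    rw [hs] at this
    exact this.tail
  · have := h.length_le
    rw [hs, List.length_cons] at this
    exact (Nat.le_succ _).trans this
  · intro v hv hvl x hx
    by_cases hvu : v = u
    · subst hvu
      by_contra hxv
      have : x ∈ s.choices G := by
        refine ⟨hxv, fun y hy => ?_⟩
        rw [hs] at hy
        simp only [List.head?_cons, Option.mem_def, Option.some.injEq] at hy
        exact hy ▸ hx
      rw [hnone] at this
      exact this
    · exact h.closed v hv (by rw [hs]; simp [hvu]; exact hvl) x hx
  · intro l' v m hm
    exact h.suffix_least (u :: l') v m (by rw [hs]; exact congrArg _ hm)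
  · intro l' v m hm
    exact h.suffix_walks (u :: l') v m (by rw [hs]; exact congrArg _ hm)
  · intro x hx hxn
    rcases (show x ≤ u from hx).lt_or_eq with hlt | rfl
    · exact h.suffix_least [] u l hs x hlt hxn
    · exact h.visited_of_mem x (by simp [hs])
  · intro x hx hxl hxn
    exact h.suffix_walks [] u l hs x hx hxl hxn

theorem none_mem_bag (s : AlgState V) : none ∈ s.bag := Finset.mem_insert_self _ _

theorem some_mem_bag {s : AlgState V} {v : V} : some v ∈ s.bag ↔ v ∈ s.memory.stack := by
  simp [bag]

theorem card_bag_le (s : AlgState V) : s.bag.card ≤ s.memory.stack.length + 1 := by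
  refine (Finset.card_insert_le _ _).trans (Nat.add_le_add_right ?_ 1)
  exact (List.toFinset_card_le _).trans (by simp)

theorem bag_cons (l : List V) (u : V) (A B A' B' : Table V) (v v' : Set V) :
    bag ⟨⟨u :: l, A, B⟩, v⟩ = insert (some u) (bag ⟨⟨l, A', B'⟩, v'⟩) := by
  ext x
  simp only [bag, List.map_cons, List.toFinset_cons, Finset.mem_insert]
  tauto

theorem bag_congr {s s' : AlgState V} (h : s.memory.stack = s'.memory.stack) :
    s.bag = s'.bag := by
  simp [bag, h]

end AlgState

/-! ### The bags of an execution -/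

namespace Execution

open AlgState

variable {V : Type*} [LinearOrder V] {t : ℕ} {G : SimpleGraph V}

theorem exists_searchInv (ρ : Execution t G) : ∀ i ≤ ρ.length,
    ∃ W, SearchInv (2 ^ t) G (ρ.state i) W := by
  intro i
  induction i with
  | zero =>
    intro _
    exact ⟨∅, .initial _ _ ρ.initial.1 ρ.initial.2.2.2⟩
  | succ i ih =>
    intro hi
    obtain ⟨W, hW⟩ := ih (by omega)
    have hstep := ρ.step i hi
    generalize ρ.state i = s at hW hstep
    generalize ρ.state (i + 1) = s' at hstep
    cases hstep with
    | discover u A hu hdepth hA => exact ⟨_, hW.discover hu hdepth _ _⟩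
    | leave u l A hnone hstack hA => exact ⟨_, hW.leave hnone hstack _ _⟩

/-- Every vertex and every edge of the visited part of the graph is covered by an earlier bag, and
a vertex that has been left does not return. -/
theorem history (ρ : Execution t G) : ∀ k ≤ ρ.length,
    (∀ v ∈ (ρ.state k).visited, ∃ i ≤ k, v ∈ (ρ.state i).memory.stack) ∧
    (∀ u ∈ (ρ.state k).visited, ∀ v ∈ (ρ.state k).visited, G.Adj u v →
      ∃ i ≤ k, u ∈ (ρ.state i).memory.stack ∧ v ∈ (ρ.state i).memory.stack) ∧
    (∀ i j, i ≤ j → j ≤ k → ∀ v, v ∈ (ρ.state i).memory.stack →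
      v ∈ (ρ.state k).memory.stack → v ∈ (ρ.state j).memory.stack) ∧
    (∀ i ≤ k, ∀ v ∈ (ρ.state i).memory.stack, v ∈ (ρ.state k).visited) := by
  intro k
  induction k with
  | zero =>
    intro _
    have h := ρ.initial
    refine ⟨?_, ?_, ?_, ?_⟩
    · rw [h.2.2.2]; simp
    · rw [h.2.2.2]; simp
    · intro i j hij hj v hv hv'
      have : j = 0 := by omega
      subst this; exact hv'
    · intro i hi v hv
      have : i = 0 := by omega
      subst this
      rw [h.1] at hv; cases hv
  | succ k ih =>
    intro hk
    obtain ⟨ih1, ih2, ih3, ih4⟩ := ih (by omega)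
    obtain ⟨W, hW⟩ := ρ.exists_searchInv k (by omega)
    have hstep := ρ.step k hk
    have hcase : (∃ u A, IsLeast ((ρ.state k).choices G) u ∧
        ρ.state (k + 1) = ⟨⟨u :: (ρ.state k).memory.stack, (ρ.state k).memory.current, A⟩,
          insert u (ρ.state k).visited⟩) ∨
        ∃ u l A, (ρ.state k).memory.stack = u :: l ∧
          ρ.state (k + 1) = ⟨⟨l, (ρ.state k).memory.current, A⟩, (ρ.state k).visited⟩ := by
      generalize ρ.state k = s at hstep
      generalize ρ.state (k + 1) = s' at hstep
      cases hstep with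
      | discover u A hu hdepth hA => exact Or.inl ⟨u, A, hu, rfl⟩
      | leave u l A hnone hstack hA => exact Or.inr ⟨u, l, A, hstack, rfl⟩
    rcases hcase with ⟨u, A, hu, hs'⟩ | ⟨u, l, A, hst, hs'⟩
    · have hunv : u ∉ (ρ.state k).visited := hu.1.1
      have hstack : (ρ.state (k + 1)).memory.stack = u :: (ρ.state k).memory.stack := by rw [hs']
      have hvis : (ρ.state (k + 1)).visited = insert u (ρ.state k).visited := by rw [hs']
      -- A visited neighbour of the new vertex is still on the stack, so the edge is covered by the
      -- new bag.
      have hnew : ∀ v ∈ (ρ.state k).visited, G.Adj u v →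
          ∃ i ≤ k + 1, u ∈ (ρ.state i).memory.stack ∧ v ∈ (ρ.state i).memory.stack := by
        intro v hv huv
        refine ⟨k + 1, le_rfl, ?_⟩
        rw [hstack]
        refine ⟨List.mem_cons_self, ?_⟩
        by_contra hvs
        exact hunv (hW.closed v hv (fun h => hvs (List.mem_cons_of_mem _ h)) u huv.symm)
      refine ⟨?_, ?_, ?_, ?_⟩
      · rw [hvis]
        rintro v (rfl | hv)
        · exact ⟨k + 1, le_rfl, by rw [hstack]; exact List.mem_cons_self⟩
        · obtain ⟨i, hi, h⟩ := ih1 v hv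
          exact ⟨i, by omega, h⟩
      · rw [hvis]
        rintro a (rfl | ha) b (rfl | hb) hab
        · exact absurd hab (G.loopless.irrefl _)
        · exact hnew b hb hab
        · obtain ⟨i, hi, h⟩ := hnew a ha hab.symm
          exact ⟨i, hi, h.2, h.1⟩
        · obtain ⟨i, hi, h⟩ := ih2 a ha b hb hab
          exact ⟨i, by omega, h⟩
      · intro i j hij hj v hvi hvk
        rcases Nat.lt_or_ge k j with hjk | hjk
        · have : j = k + 1 := by omega
          subst this; exact hvk
        · have hvv := ih4 i (by omega) v hvi
          rw [hstack] at hvk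
          rcases List.mem_cons.1 hvk with rfl | hvk
          · exact absurd hvv hunv
          · exact ih3 i j hij hjk v hvi hvk
      · intro i hi v hv
        rw [hvis]
        rcases Nat.lt_or_ge k i with hik | hik
        · have : i = k + 1 := by omega
          subst this
          rw [hstack] at hv
          rcases List.mem_cons.1 hv with rfl | hv
          · exact Set.mem_insert _ _
          · exact Set.mem_insert_of_mem _ (hW.visited_of_mem v hv)
        · exact Set.mem_insert_of_mem _ (ih4 i hik v hv)
    · have hstack : (ρ.state (k + 1)).memory.stack = l := by rw [hs']
      have hvis : (ρ.state (k + 1)).visited = (ρ.state k).visited := by rw [hs']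
      have hsub : ∀ v ∈ l, v ∈ (ρ.state k).memory.stack := fun v hv => by
        rw [hst]; exact List.mem_cons_of_mem _ hv
      refine ⟨?_, ?_, ?_, ?_⟩
      · rw [hvis]
        intro v hv
        obtain ⟨i, hi, h⟩ := ih1 v hv
        exact ⟨i, by omega, h⟩
      · rw [hvis]
        intro a ha b hb hab
        obtain ⟨i, hi, h⟩ := ih2 a ha b hb hab
        exact ⟨i, by omega, h⟩
      · intro i j hij hj v hvi hvk
        rcases Nat.lt_or_ge k j with hjk | hjk
        · have : j = k + 1 := by omega
          subst this; exact hvk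
        · rw [hstack] at hvk
          exact ih3 i j hij hjk v hvi (hsub v hvk)
      · intro i hi v hv
        rw [hvis]
        rcases Nat.lt_or_ge k i with hik | hik
        · have : i = k + 1 := by omega
          subst this
          rw [hstack] at hv
          exact hW.visited_of_mem v (hsub v hv)
        · exact ih4 i hik v hv

theorem visited_of_complete (ρ : Execution t G) (h : (ρ.state ρ.length).Complete G) (v : V) :
    v ∈ (ρ.state ρ.length).visited := by
  by_contra hv
  have : v ∈ (ρ.state ρ.length).choices G := ⟨hv, by rw [h.2]; simp⟩
  rw [h.1] at this
  exact this

/-- The universal vertex is in every bag and its edges need no attention. Everything else is the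
history of the stack: a discovered vertex is new to it, and without repetitions removing the top of
the stack erases exactly one element of the bag. -/
theorem isNicePathDecomposition (ρ : Execution t G) (h : (ρ.state ρ.length).Complete G) :
    IsNicePathDecomposition (rootedGraph G) ρ.length (fun i => (ρ.state i).bag) := by
  obtain ⟨h1, h2, h3, -⟩ := ρ.history ρ.length le_rfl
  have hall := ρ.visited_of_complete h
  have hcov : ∀ v : Option V, ∃ i ≤ ρ.length, v ∈ (ρ.state i).bag := by
    rintro (_ | v)
    · exact ⟨0, Nat.zero_le _, none_mem_bag _⟩
    · obtain ⟨i, hi, hv⟩ := h1 v (hall v)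
      exact ⟨i, hi, some_mem_bag.2 hv⟩
  refine ⟨hcov, ?_, ?_, ?_, ?_⟩
  · rintro a b ⟨-, rfl | rfl | ⟨u, v, rfl, rfl, huv⟩⟩
    · obtain ⟨i, hi, hb⟩ := hcov b
      exact ⟨i, hi, none_mem_bag _, hb⟩
    · obtain ⟨i, hi, ha⟩ := hcov a
      exact ⟨i, hi, ha, none_mem_bag _⟩
    · obtain ⟨i, hi, hu, hv⟩ := h2 u (hall u) v (hall v) huv
      exact ⟨i, hi, some_mem_bag.2 hu, some_mem_bag.2 hv⟩
  · rintro (_ | v) i j k hij hjk hk hi hk'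
    · exact none_mem_bag _
    · exact some_mem_bag.2 ((ρ.history k hk).2.2.1 i j hij hjk v (some_mem_bag.1 hi)
        (some_mem_bag.1 hk'))
  · simp [bag, ρ.initial.1]
  · intro i hi
    obtain ⟨W, hW⟩ := ρ.exists_searchInv i hi.le
    have hstep := ρ.step i hi
    generalize ρ.state i = s at hW hstep
    generalize ρ.state (i + 1) = s' at hstep
    cases hstep with
    | discover u A hu hdepth hA =>
      refine Or.inl ⟨some u, fun h => hu.1.1 (hW.visited_of_mem u (some_mem_bag.1 h)), ?_⟩
      exact bag_cons _ _ _ _ _ _ _ _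
    | leave u l A hnone hstack hA =>
      refine Or.inr ⟨some u, some_mem_bag.2 (by simp [hstack]), ?_⟩
      have hnd := hW.nodup
      rw [hstack, List.nodup_cons] at hnd
      have hb : s.bag = insert (some u) (bag ⟨⟨l, s.memory.current, A⟩, s.visited⟩) := by
        rw [← bag_cons l u s.memory.previous s.memory.current _ _ s.visited]
        exact bag_congr hstack
      rw [hb, Finset.erase_insert]
      exact fun h => hnd.1 (some_mem_bag.1 h)

end Execution

/-! ### Ranked forest orders and treedepth -/

/-- `A y x` (`y` is an ancestor of `x`) is the ancestor relation of a forest on which the function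
`rk` decreases strictly from ancestors to descendants. -/
structure RankedOrder {V : Type*} (A : V → V → Prop) (rk : V → ℕ) : Prop where
  trans : ∀ {x y z}, A z y → A y x → A z x
  total : ∀ {x y z}, A y x → A z x → y = z ∨ A y z ∨ A z y
  rank : ∀ {x y}, A y x → rk x < rk y

namespace RankedOrder

variable {V : Type*} {A : V → V → Prop} {rk : V → ℕ}

theorem irrefl (h : RankedOrder A rk) (x : V) : ¬ A x x := fun hx => lt_irrefl _ (h.rank hx)

theorem exists_forest (h : RankedOrder A rk) (S : Finset V) : ∃ F : RootedForest V, F.nodes = S ∧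
    ∀ y x, F.IsAncestor y x ↔ y ∈ S ∧ x ∈ S ∧ A y x :=
  RootedForest.exists_of_order S A h.irrefl (fun _ _ _ => h.trans) (fun _ _ _ => h.total)

/-- The elements above `x` form a chain, on which the rank is injective with values in the interval
from `rk x + 1` to `k`. -/
theorem card_ancestors_le (h : RankedOrder A rk) {k : ℕ} {x : V} (S : Finset V)
    (hS : ∀ y ∈ S, A y x ∧ rk y ≤ k) : S.card ≤ k - rk x := by
  rw [← Nat.card_Ioc]
  refine Finset.card_le_card_of_injOn rk (fun y hy => ?_) (fun y hy z hz hyz => ?_)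
  · exact Finset.mem_coe.2 (Finset.mem_Ioc.2 ⟨h.rank (hS y hy).1, (hS y hy).2⟩)
  · rcases h.total (hS y hy).1 (hS z hz).1 with h' | h' | h'
    · exact h'
    · exact absurd hyz (h.rank h').ne'
    · exact absurd hyz (h.rank h').ne

/-- By induction along the list. The new element `a` is comparable to its neighbour `b`, which is
the top `c` of the rest or lies below it. If both `a` and `c` are above `b`, they are comparable,
because the elements above `b` form a chain; if `b` is above `a`, so is `c`. -/
theorem exists_top (h : RankedOrder A rk) {m : List V} (hne : m ≠ []) (hnd : m.Nodup)
    (hm : m.IsChain (fun a b => A a b ∨ A b a)) : ∃ a ∈ m, ∀ z ∈ m, z ≠ a → A a z := by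
  induction m with
  | nil => exact absurd rfl hne
  | cons a m ih =>
    rcases m with _ | ⟨b, m⟩
    · exact ⟨a, by simp, by simp⟩
    rw [List.isChain_cons_cons] at hm
    rw [List.nodup_cons] at hnd
    obtain ⟨c, hc, htop⟩ := ih (by simp) hnd.2 hm.2
    have hac : a ≠ c := fun h => hnd.1 (h ▸ hc)
    have hcase : A a c ∨ A c a := by
      by_cases hbc : b = c
      · exact hbc ▸ hm.1
      · have hcb := htop b (by simp) hbc
        rcases hm.1 with hab | hba
        · exact (h.total hab hcb).resolve_left hac
        · exact Or.inr (h.trans hcb hba)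
    rcases hcase with hac' | hca
    · refine ⟨a, by simp, fun z hz hza => ?_⟩
      have hz := (List.mem_cons.1 hz).resolve_left hza
      by_cases hzc : z = c
      · exact hzc ▸ hac'
      · exact h.trans hac' (htop z hz hzc)
    · refine ⟨c, List.mem_cons_of_mem _ hc, fun z hz hzc => ?_⟩
      rcases List.mem_cons.1 hz with rfl | hz
      · exact hca
      · exact htop z hz hzc

/-- A path in a graph of treedepth at most `k` has fewer than `2 ^ k` vertices. -/
theorem length_lt (h : RankedOrder A rk) (k : ℕ) : ∀ m : List V, m.Nodup →
    m.IsChain (fun a b => A a b ∨ A b a) → (∀ z ∈ m, 1 ≤ rk z ∧ rk z ≤ k) →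
    m.length < 2 ^ k := by
  induction k with
  | zero =>
    intro m _ _ hrk
    rcases m with _ | ⟨a, m⟩
    · simp
    · have := hrk a (by simp); omega
  | succ k ih =>
    intro m hnd hm hrk
    rcases eq_or_ne m [] with rfl | hne
    · simp
    obtain ⟨c, hc, htop⟩ := h.exists_top hne hnd hm
    -- Without the top `c` there remain two paths of ranks at most `k`, each with at most `2 ^ k -
    -- 1` vertices.
    obtain ⟨l, r, rfl⟩ := List.append_of_mem hc
    rw [List.nodup_append, List.nodup_cons] at hnd
    rw [List.isChain_append] at hm
    have hlow : ∀ z, z ∈ l ∨ z ∈ r → 1 ≤ rk z ∧ rk z ≤ k := by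
      intro z hz
      have hzm : z ∈ l ++ c :: r := by
        rcases hz with hz | hz <;> simp [hz]
      have hzc : z ≠ c := by
        rcases hz with hz | hz
        · exact hnd.2.2 z hz c (by simp)
        · rintro rfl; exact hnd.2.1.1 hz
      have h1 := h.rank (htop z hzm hzc)
      have h2 := (hrk c (by simp)).2
      exact ⟨(hrk z hzm).1, by omega⟩
    have h1 := ih l hnd.1 hm.1 (fun z hz => hlow z (Or.inl hz))
    have h2 := ih r hnd.2.1.2 hm.2.1.tail (fun z hz => hlow z (Or.inr hz))
    rw [List.length_append, List.length_cons, pow_succ]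
    omega

end RankedOrder

/-- Treedepth in terms of ranked orders on the vertices. -/
theorem treedepth_le_iff {V : Type} [Finite V] (G : SimpleGraph V) (t : ℕ) :
    treedepth G ≤ t ↔ ∃ (A : V → V → Prop) (rk : V → ℕ), RankedOrder A rk ∧
      (∀ x, 1 ≤ rk x ∧ rk x ≤ t) ∧ ∀ x y, G.Adj x y → A x y ∨ A y x := by
  classical
  cases nonempty_fintype V
  constructor
  · intro ht
    -- The infimum of the empty set would be `0`, so some decomposition is needed: all vertices in
    -- one chain.
    have hne : {k | ∃ (N : Type) (F : RootedForest N) (ψ : V → N),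
        IsTreedepthDecomposition G F ψ ∧ F.height = k}.Nonempty := by
      let e := Fintype.equivFin V
      have hr : RankedOrder (fun y x : V => e x < e y) (fun x => (e x : ℕ)) :=
        ⟨fun h1 h2 => lt_trans h2 h1, fun {x y z} _ _ => by
          rcases lt_trichotomy (e y) (e z) with h | h | h
          · exact Or.inr (Or.inr h)
          · exact Or.inl (e.injective h)
          · exact Or.inr (Or.inl h), fun h => h⟩
      obtain ⟨F, hF, hA⟩ := hr.exists_forest Finset.univ
      refine ⟨_, V, F, id, ⟨Function.injective_id, fun v => by simp [hF], fun u v huv => ?_⟩, rfl⟩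
      simp only [hA, Finset.mem_univ, true_and, id]
      exact (lt_or_gt_of_ne (fun h => huv.ne (e.injective h))).symm
    obtain ⟨N, F, ψ, ⟨hinj, hmem, hadj⟩, hh⟩ := Nat.sInf_mem hne
    have hht : F.height ≤ t := hh.trans_le ht
    have hdep : ∀ v, F.depth (ψ v) ≤ t := fun v =>
      (Finset.le_sup (f := F.depth) (hmem v)).trans hht
    -- The rank counts levels from below, so that depths `1, …, t` become ranks `t, …, 1`.
    refine ⟨fun u v => F.IsAncestor (ψ u) (ψ v), fun v => t + 1 - F.depth (ψ v),
      ⟨fun h1 h2 => h1.trans h2, fun h1 h2 => ?_, fun {x y} h => ?_⟩, fun x => ?_, hadj⟩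
    · rcases h1.total h2 with h | h
      · exact Or.inl (hinj h)
      · exact Or.inr h
    · have : F.depth (ψ y) < F.depth (ψ x) := by
        simp only [RootedForest.depth, Nat.add_lt_add_iff_right]
        refine Finset.card_lt_card ⟨?_, ?_⟩
        · intro z hz
          rw [Finset.mem_filter] at hz ⊢
          exact ⟨hz.1, hz.2.trans h⟩
        · intro hs
          have := hs (Finset.mem_filter.2 ⟨h.mem_left, h⟩)
          rw [Finset.mem_filter] at this
          exact F.acyclic _ this.2
      have := hdep x
      show t + 1 - F.depth (ψ x) < t + 1 - F.depth (ψ y)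
      omega
    · have h1 := hdep x
      have h2 : 1 ≤ F.depth (ψ x) := Nat.le_add_left _ _
      show 1 ≤ t + 1 - F.depth (ψ x) ∧ t + 1 - F.depth (ψ x) ≤ t
      omega
  · rintro ⟨A, rk, hr, hrk, hadj⟩
    obtain ⟨F, hF, hA⟩ := hr.exists_forest Finset.univ
    have hmem : F.height ∈ {k | ∃ (N : Type) (F : RootedForest N) (ψ : V → N),
        IsTreedepthDecomposition G F ψ ∧ F.height = k} := by
      refine ⟨V, F, id, ⟨Function.injective_id, fun v => by simp [hF], fun u v huv => ?_⟩, rfl⟩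
      simp only [hA, Finset.mem_univ, true_and, id]
      exact hadj u v huv
    refine (Nat.sInf_le hmem).trans ?_
    · refine Finset.sup_le fun x _ => ?_
      -- There are at most `t - rk x` ancestors of `x`, and `rk x ≥ 1` leaves room for `x` itself.
      have h1 := hr.card_ancestors_le (k := t) (x := x)
        (F.nodes.filter (fun y => F.IsAncestor y x)) (fun y hy => by
          rw [Finset.mem_filter, hA] at hy
          exact ⟨hy.2.2.2, (hrk y).2⟩)
      have h2 := hrk x
      simp only [RootedForest.depth]
      omega

namespace PartialDecomposition

variable {V : Type*}

/-! ### Restrictions -/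

/-- The restriction to `X'`, with `h` extended by `0`. -/
noncomputable def restrict (P : PartialDecomposition V) (X' : Finset (Option V)) (hX : X' ⊆ P.X) :
    PartialDecomposition V := by
  classical
  exact
  { forest := P.forest.restrictTo
      (P.forest.nodes.filter
        (fun z => ∃ x ∈ X', z = Sum.inl x ∨ P.forest.IsAncestor z (Sum.inl x)))
      (by
        intro x hx y hy
        rw [Finset.mem_filter] at hx ⊢
        refine ⟨(P.forest.parent_mem _ _ hy).2, ?_⟩
        obtain ⟨-, w, hw, rfl | h⟩ := hx
        · exact ⟨w, hw, Or.inr (.of_parent hy)⟩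
        · exact ⟨w, hw, Or.inr ((RootedForest.IsAncestor.of_parent hy).trans h)⟩)
    X := X'
    h := fun z => if z ∈ P.forest.nodes ∧ ∃ x ∈ X', z = Sum.inl x ∨
      P.forest.IsAncestor z (Sum.inl x) then P.h z else 0
    X_subset := fun x hx => Finset.mem_filter.2 ⟨P.X_subset x (hX hx), x, hx, Or.inl rfl⟩
    h_pos := fun x hx => by
      have hx' := Finset.mem_filter.1 hx
      rw [if_pos hx']
      exact P.h_pos x hx'.1
    h_lt := fun x y h => by
      have hy := Finset.mem_filter.1 h.mem_right
      have hx := Finset.mem_filter.1 h.mem_left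
      rw [if_pos hx, if_pos hy]
      refine P.h_lt x y ((RootedForest.isAncestor_congr ?_ h.mem_right).1 h)
      exact fun z hz => if_pos hz }

theorem restrict_isRestriction (P : PartialDecomposition V) (X' : Finset (Option V))
    (hX : X' ⊆ P.X) : P.IsRestriction X' (P.restrict X' hX) := by
  classical
  refine ⟨rfl, fun z => ?_, fun z hz => if_pos hz, fun z hz => if_pos (Finset.mem_filter.1 hz)⟩
  exact Finset.mem_filter

theorem restrict_h_of_notMem (P : PartialDecomposition V) (X' : Finset (Option V))
    (hX : X' ⊆ P.X) {z : Node V} (hz : z ∉ (P.restrict X' hX).forest.nodes) :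
    (P.restrict X' hX).h z = 0 := by
  classical
  exact if_neg (fun h => hz (Finset.mem_filter.2 h))

namespace IsRestriction

variable {P Q Q' : PartialDecomposition V} {X' : Finset (Option V)}

theorem nodes_subset (h : P.IsRestriction X' Q) : Q.forest.nodes ⊆ P.forest.nodes :=
  fun z hz => ((h.2.1 z).1 hz).1

theorem isAncestor_iff (h : P.IsRestriction X' Q) {y x : Node V} (hx : x ∈ Q.forest.nodes) :
    Q.forest.IsAncestor y x ↔ P.forest.IsAncestor y x :=
  RootedForest.isAncestor_congr h.2.2.1 hx

theorem mem_of_isAncestor (h : P.IsRestriction X' Q) {y x : Node V} (hx : x ∈ Q.forest.nodes)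
    (hyx : P.forest.IsAncestor y x) : y ∈ Q.forest.nodes :=
  ((h.isAncestor_iff hx).2 hyx).mem_left

/-- Restrictions can differ only in the values of the parent map and of `h` outside the nodes. -/
theorem equivalent (h : P.IsRestriction X' Q) (h' : P.IsRestriction X' Q') : Q.Equivalent Q' := by
  have hn : ∀ z, z ∈ Q.forest.nodes ↔ z ∈ Q'.forest.nodes := fun z => by
    rw [h.2.1, h'.2.1]
  refine equivalent_iff.2 ⟨id, ?_, ?_, ?_, ?_, ?_⟩
  · rw [h.1, h'.1, Set.image_id]
  · have : (Q'.forest.nodes : Set (Node V)) = Q.forest.nodes := by ext z; simp [hn]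
    rw [this]
    exact Set.bijOn_id _
  · intro a ha b hb
    simp only [id]
    rw [h.2.2.1 a ha, h'.2.2.1 a ((hn a).1 ha)]
  · intro x hx; rfl
  · intro a ha
    simp only [id]
    rw [h.2.2.2 a ha, h'.2.2.2 a ((hn a).1 ha)]

end IsRestriction

end PartialDecomposition

namespace PartialDecomposition

variable {V : Type*}

/-! ### Soundness of the dynamic program -/

/-- `P` is, up to names, the part above its bag of a ranked forest order on `W` in which adjacent
vertices are comparable, and its heights bound the ranks. -/
structure Realizes (H : SimpleGraph (Option V)) (W : Set (Option V))
    (A : Option V → Option V → Prop) (rk : Option V → ℕ) (j : Node V → Option V)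
    (P : PartialDecomposition V) : Prop where
  order : RankedOrder A rk
  mem : ∀ {x y}, A y x → y ∈ W ∧ x ∈ W
  pos : ∀ x ∈ W, 1 ≤ rk x
  top : ∀ x ∈ W, x ≠ none → A none x
  adj : ∀ x ∈ W, ∀ y ∈ W, H.Adj x y → A x y ∨ A y x
  mapsTo : ∀ a ∈ P.forest.nodes, j a ∈ W
  injOn : Set.InjOn j P.forest.nodes
  apply_inl : ∀ x ∈ P.X, j (Sum.inl x) = x
  anc_iff : ∀ a ∈ P.forest.nodes, ∀ b ∈ P.forest.nodes,
    P.forest.IsAncestor a b ↔ A (j a) (j b)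
  up : ∀ a ∈ P.forest.nodes, ∀ y, A y (j a) → ∃ b ∈ P.forest.nodes, j b = y
  rank_le : ∀ a ∈ P.forest.nodes, rk (j a) ≤ P.h a

namespace Realizes

variable {H : SimpleGraph (Option V)} {W : Set (Option V)} {A : Option V → Option V → Prop}
  {rk : Option V → ℕ} {j : Node V → Option V}

/-- The order remains as it is; only less of it is shown. The nodes that remain are closed under
ancestors. -/
theorem restrict {P Q : PartialDecomposition V} (h : Realizes H W A rk j P)
    {X' : Finset (Option V)} (hX : X' ⊆ P.X) (hQ : P.IsRestriction X' Q) :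
    Realizes H W A rk j Q where
  order := h.order
  mem := h.mem
  pos := h.pos
  top := h.top
  adj := h.adj
  mapsTo a ha := h.mapsTo a (hQ.nodes_subset ha)
  injOn := h.injOn.mono (Finset.coe_subset.2 hQ.nodes_subset)
  apply_inl x hx := h.apply_inl x (hX (hQ.1 ▸ hx))
  anc_iff a ha b hb := by
    rw [hQ.isAncestor_iff hb, h.anc_iff a (hQ.nodes_subset ha) b (hQ.nodes_subset hb)]
  up a ha y hy := by
    have ham := hQ.nodes_subset ha
    obtain ⟨b, hb, rfl⟩ := h.up a ham y hy
    exact ⟨b, hQ.mem_of_isAncestor ha ((h.anc_iff b hb a ham).2 hy), rfl⟩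
  rank_le a ha := by
    rw [hQ.2.2.2 a ha]
    exact h.rank_le a (hQ.nodes_subset ha)

theorem of_leaf {P : PartialDecomposition V} (hX : P.X = {none})
    (hn : P.forest.nodes = {Sum.inl none}) (hh : P.h (Sum.inl none) = 1) :
    Realizes H {none} (fun _ _ => False) (fun _ => 1) (fun _ => none) P where
  order := ⟨fun h _ => h, fun h _ => h.elim, fun h => h.elim⟩
  mem h := h.elim
  pos _ _ := le_rfl
  top x hx hne := absurd hx hne
  adj x hx y hy hxy := by
    rw [Set.mem_singleton_iff] at hx hy
    subst hx; subst hy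
    exact (H.loopless.irrefl _ hxy).elim
  mapsTo _ _ := rfl
  injOn := by rw [hn]; simp
  apply_inl x hx := by rw [hX, Finset.mem_singleton] at hx; exact hx.symm
  anc_iff a ha b hb := by
    rw [hn, Finset.mem_singleton] at ha hb
    subst ha; subst hb
    simp [RootedForest.not_isAncestor_self]
  up _ _ _ h := h.elim
  rank_le a ha := by
    rw [hn, Finset.mem_singleton] at ha
    subst ha
    exact hh.ge

/-- The order realizing `P'` and the forest of `P` are spliced. Vertices represented by nodes of `P`
are ordered as in `P`; vertices already forgotten keep their mutual order and hang below their
former ancestors, inheriting whatever `P` puts above these. Ranks remain monotone because heights of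
old nodes do not decrease from `P'` to `P`. Edges at `u` cause no trouble, since the seen neighbours
of `u` are in the bag. -/
theorem intro [DecidableEq V] {R' : Table V} {X' : Finset (Option V)} {T : ℕ} {u : Option V}
    {P : PartialDecomposition V}
    (hR' : ∀ P' ∈ R', P'.X = X' ∧ ∃ A rk j, Realizes H W A rk j P')
    (hu : u ∉ W) (hnone : none ∈ X') (hadj : ∀ y ∈ W, H.Adj u y → y ∈ X')
    (hP : IntroCandidate T H R' X' u P) :
    ∃ A rk j, Realizes H (insert u W) A rk j P := by
  classical
  obtain ⟨hX, -, hroots, -, hXadj, ⟨P', hP', f, ⟨hfm, hfinj, hfX, hfanc⟩, hfim, hhu, hhf⟩, -⟩ := hP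
  obtain ⟨hX', A, rk, j', hr⟩ := hR' P' hP'
  have hXW : ∀ x ∈ X', x ∈ W := fun x hx => by
    have := hr.mapsTo _ (P'.X_subset x (hX' ▸ hx))
    rwa [hr.apply_inl x (hX' ▸ hx)] at this
  have hun : Sum.inl u ∈ P.forest.nodes := P.X_subset u (hX ▸ Finset.mem_insert_self _ _)
  have hfu : ∀ z ∈ P'.forest.nodes, f z ≠ Sum.inl u := fun z hz h => by
    have : f z ∈ f '' (P'.forest.nodes : Set (Node V)) := ⟨z, hz, rfl⟩
    rw [hfim] at this
    exact this.2 h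
  -- A partial bijection between vertices and the nodes of `P`: `u` corresponds to its own node, and
  -- the vertex shown by a node `z` of `P'` to `f z`.
  let Rep : Option V → Node V → Prop := fun x b =>
    (x = u ∧ b = Sum.inl u) ∨ ∃ z ∈ P'.forest.nodes, j' z = x ∧ f z = b
  have rep_u : Rep u (Sum.inl u) := Or.inl ⟨rfl, rfl⟩
  have rep_f : ∀ z ∈ P'.forest.nodes, Rep (j' z) (f z) := fun z hz => Or.inr ⟨z, hz, rfl, rfl⟩
  have rep_X : ∀ x ∈ P.X, Rep x (Sum.inl x) := by
    intro x hx
    rw [hX, Finset.mem_insert] at hx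
    rcases hx with rfl | hx
    · exact rep_u
    · refine Or.inr ⟨Sum.inl x, P'.X_subset x (hX' ▸ hx), hr.apply_inl x (hX' ▸ hx), hfX x hx⟩
  have rep_fun : ∀ x b b', Rep x b → Rep x b' → b = b' := by
    rintro x b b' (⟨rfl, rfl⟩ | ⟨z, hz, rfl, rfl⟩) (⟨h, rfl⟩ | ⟨z', hz', h, rfl⟩)
    · rfl
    · exact absurd (h ▸ hr.mapsTo z' hz') hu
    · exact absurd (h ▸ hr.mapsTo z hz) hu
    · rw [hr.injOn hz hz' h.symm]
  have rep_inj : ∀ x x' b, Rep x b → Rep x' b → x = x' := by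
    rintro x x' b (⟨rfl, rfl⟩ | ⟨z, hz, rfl, rfl⟩) (⟨rfl, h⟩ | ⟨z', hz', rfl, h⟩)
    · rfl
    · exact absurd h (hfu z' hz')
    · exact absurd h (hfu z hz)
    · rw [hfinj hz' hz h]
  have rep_mem : ∀ x b, Rep x b → b ∈ P.forest.nodes ∧ x ∈ insert u W := by
    rintro x b (⟨rfl, rfl⟩ | ⟨z, hz, rfl, rfl⟩)
    · exact ⟨hun, Set.mem_insert _ _⟩
    · exact ⟨hfm hz, Set.mem_insert_of_mem _ (hr.mapsTo z hz)⟩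
  have rep_ex : ∀ b ∈ P.forest.nodes, ∃ x, Rep x b := by
    intro b hb
    by_cases hbu : b = Sum.inl u
    · exact ⟨u, Or.inl ⟨rfl, hbu⟩⟩
    · have : b ∈ f '' (P'.forest.nodes : Set (Node V)) := by rw [hfim]; exact ⟨hb, hbu⟩
      obtain ⟨z, hz, rfl⟩ := this
      exact ⟨j' z, rep_f z hz⟩
  have key : ∀ z ∈ P'.forest.nodes, ∀ z' ∈ P'.forest.nodes, A (j' z) (j' z') →
      P.forest.IsAncestor (f z) (f z') := fun z hz z' hz' h =>
    hfanc z' hz' z hz ((hr.anc_iff z hz z' hz').2 h)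
  choose! j hj using rep_ex
  -- The vertices that `P` shows. The others are forgotten vertices and form a downward closed part
  -- of the old order.
  let InS : Option V → Prop := fun x => ∃ b, Rep x b
  have inS_u : InS u := ⟨_, rep_u⟩
  have not_up : ∀ x y, InS x → x ≠ u → A y x → InS y := by
    rintro x y ⟨b, ⟨rfl, -⟩ | ⟨z, hz, rfl, rfl⟩⟩ hxu hyx
    · exact absurd rfl hxu
    · obtain ⟨z', hz', rfl⟩ := hr.up z hz y hyx
      exact ⟨_, rep_f z' hz'⟩
  -- The three cases: both vertices are shown; neither is; or `x` is not shown and `y` lies in `P`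
  -- at or above the image of an old shown ancestor of `x`.
  let A₁ : Option V → Option V → Prop := fun y x =>
    (∃ a b, Rep y a ∧ Rep x b ∧ P.forest.IsAncestor a b) ∨ (¬ InS x ∧ ¬ InS y ∧ A y x) ∨
    (¬ InS x ∧ ∃ z ∈ P'.forest.nodes, A (j' z) x ∧
      ∃ a, Rep y a ∧ (a = f z ∨ P.forest.IsAncestor a (f z)))
  -- Shown vertices get their height in `P` as rank, so `rank_le` holds with equality.
  let rk₁ : Option V → ℕ := fun x => if h : ∃ b, Rep x b then P.h h.choose else rk x
  have rk₁_rep : ∀ x b, Rep x b → rk₁ x = P.h b := by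
    intro x b hb
    have h : ∃ b, Rep x b := ⟨b, hb⟩
    simp only [rk₁, dif_pos h]
    rw [rep_fun x _ b h.choose_spec hb]
  have rk₁_not : ∀ x, ¬ InS x → rk₁ x = rk x := fun x hx => dif_neg hx
  have rk_le : ∀ z ∈ P'.forest.nodes, rk (j' z) ≤ P.h (f z) := fun z hz => by
    rw [hhf z hz]
    exact (hr.rank_le z hz).trans (le_max_right _ _)
  have sub : ∀ x y, A y x → A₁ y x := by
    intro x y h
    by_cases hx : InS x
    · have hxu : x ≠ u := by rintro rfl; exact hu (hr.mem h).2
      obtain ⟨b, ⟨rfl, -⟩ | ⟨z, hz, rfl, rfl⟩⟩ := hx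
      · exact absurd rfl hxu
      · obtain ⟨z', hz', rfl⟩ := hr.up z hz y h
        exact Or.inl ⟨_, _, rep_f z' hz', rep_f z hz, key z' hz' z hz h⟩
    · by_cases hy : InS y
      · have hyu : y ≠ u := by rintro rfl; exact hu (hr.mem h).1
        obtain ⟨b, ⟨rfl, -⟩ | ⟨z, hz, rfl, rfl⟩⟩ := hy
        · exact absurd rfl hyu
        · exact Or.inr (Or.inr ⟨hx, z, hz, h, _, rep_f z hz, Or.inl rfl⟩)
      · exact Or.inr (Or.inl ⟨hx, hy, h⟩)
  have anc : ∀ y a x b, Rep y a → Rep x b → (A₁ y x ↔ P.forest.IsAncestor a b) := by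
    intro y a x b ha hb
    constructor
    · rintro (⟨a', b', ha', hb', h⟩ | ⟨hx, -⟩ | ⟨hx, -⟩)
      · rwa [rep_fun _ _ _ ha ha', rep_fun _ _ _ hb hb']
      · exact absurd ⟨b, hb⟩ hx
      · exact absurd ⟨b, hb⟩ hx
    · exact fun h => Or.inl ⟨a, b, ha, hb, h⟩
  have up₁ : ∀ x y b, Rep x b → A₁ y x → ∃ a, Rep y a := by
    rintro x y b hb (⟨a, b', ha, hb', h⟩ | ⟨hx, -⟩ | ⟨hx, -⟩)
    · exact ⟨a, ha⟩
    · exact absurd ⟨b, hb⟩ hx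
    · exact absurd ⟨b, hb⟩ hx
  refine ⟨A₁, rk₁, j, ⟨?_, ?_, ?_⟩, ?_, ?_, ?_, ?_, ?_, ?_, ?_, ?_, ?_, ?_⟩
  · -- transitivity
    intro x y z hzy hyx
    rcases hyx with ⟨a, b, ha, hb, h⟩ | ⟨hx, hy, h⟩ | ⟨hx, c, hc, hcx, a, ha, h⟩
    · obtain ⟨d, hd⟩ := up₁ y z a ha hzy
      exact Or.inl ⟨d, b, hd, hb, ((anc z d y a hd ha).1 hzy).trans h⟩
    · rcases hzy with ⟨a, b, ha, hb, -⟩ | ⟨-, hz, h'⟩ | ⟨-, c, hc, hcy, a, ha, h'⟩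
      · exact absurd ⟨b, hb⟩ hy
      · exact Or.inr (Or.inl ⟨hx, hz, hr.order.trans h' h⟩)
      · exact Or.inr (Or.inr ⟨hx, c, hc, hr.order.trans hcy h, a, ha, h'⟩)
    · obtain ⟨d, hd⟩ := up₁ y z a ha hzy
      have hda := (anc z d y a hd ha).1 hzy
      refine Or.inr (Or.inr ⟨hx, c, hc, hcx, d, hd, Or.inr ?_⟩)
      rcases h with rfl | h
      · exact hda
      · exact hda.trans h
  · -- ancestors form a chain
    have tot : ∀ y z c a b, Rep y a → Rep z b → (a = c ∨ P.forest.IsAncestor a c) →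
        (b = c ∨ P.forest.IsAncestor b c) → y = z ∨ A₁ y z ∨ A₁ z y := by
      intro y z c a b ha hb hac hbc
      rw [anc y a z b ha hb, anc z b y a hb ha]
      rcases hac with rfl | hac <;> rcases hbc with rfl | hbc
      · exact Or.inl (rep_inj _ _ _ ha hb)
      · exact Or.inr (Or.inr hbc)
      · exact Or.inr (Or.inl hac)
      · rcases hac.total hbc with rfl | h
        · exact Or.inl (rep_inj _ _ _ ha hb)
        · exact Or.inr h
    -- The shown vertex of `c` and the hidden vertex `y` are both above `x`, hence comparable. As
    -- everything above a shown old vertex is shown, `c` must be the upper one.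
    have mixed : ∀ x y z, ¬ InS x → ¬ InS y → A y x → (∃ c ∈ P'.forest.nodes, A (j' c) x ∧
        ∃ a, Rep z a ∧ (a = f c ∨ P.forest.IsAncestor a (f c))) → A₁ z y := by
      rintro x y z hx hy hyx ⟨c, hc, hcx, a, ha, hac⟩
      rcases hr.order.total hcx hyx with h | h | h
      · exact absurd ⟨_, h ▸ rep_f c hc⟩ hy
      · exact Or.inr (Or.inr ⟨hy, c, hc, h, a, ha, hac⟩)
      · obtain ⟨d, hd, rfl⟩ := hr.up c hc y h
        exact absurd ⟨_, rep_f d hd⟩ hy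
    intro x y z hyx hzx
    rcases hyx with ⟨a, b, ha, hb, h⟩ | ⟨hx, hy, h⟩ | ⟨hx, c, hc, hcx, a, ha, hac⟩
    · obtain ⟨d, hd⟩ := up₁ x z b hb hzx
      exact tot y z b a d ha hd (Or.inr h) (Or.inr ((anc z d x b hd hb).1 hzx))
    · rcases hzx with ⟨a, b, ha, hb, -⟩ | ⟨-, hz, h'⟩ | ⟨-, hzx⟩
      · exact absurd ⟨b, hb⟩ hx
      · rcases hr.order.total h h' with h | h | h
        · exact Or.inl h
        · exact Or.inr (Or.inl (sub _ _ h))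
        · exact Or.inr (Or.inr (sub _ _ h))
      · exact Or.inr (Or.inr (mixed x y z hx hy h hzx))
    · rcases hzx with ⟨a', b, ha', hb, -⟩ | ⟨-, hz, h'⟩ | ⟨-, c', hc', hcx', a', ha', hac'⟩
      · exact absurd ⟨b, hb⟩ hx
      · exact Or.inr (Or.inl (mixed x z y hx hz h' ⟨c, hc, hcx, a, ha, hac⟩))
      · have low : ∀ d e g, (d = e ∨ P.forest.IsAncestor d e) → (e = g ∨ P.forest.IsAncestor e g) →
            (d = g ∨ P.forest.IsAncestor d g) := by
          rintro d e g (rfl | h1) (rfl | h2)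
          · exact Or.inl rfl
          · exact Or.inr h2
          · exact Or.inr h1
          · exact Or.inr (h1.trans h2)
        rcases hr.order.total hcx hcx' with h | h | h
        · rw [hr.injOn hc hc' h] at hac
          exact tot y z (f c') a a' ha ha' hac hac'
        · exact tot y z (f c') a a' ha ha' (low _ _ _ hac (Or.inr (key c hc c' hc' h))) hac'
        · exact tot y z (f c) a a' ha ha' hac (low _ _ _ hac' (Or.inr (key c' hc' c hc h)))
  · -- ranks
    rintro x y (⟨a, b, ha, hb, h⟩ | ⟨hx, hy, h⟩ | ⟨hx, c, hc, hcx, a, ha, hac⟩)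
    · rw [rk₁_rep _ _ ha, rk₁_rep _ _ hb]
      exact P.h_lt _ _ h
    · rw [rk₁_not _ hx, rk₁_not _ hy]
      exact hr.order.rank h
    · rw [rk₁_not _ hx, rk₁_rep _ _ ha]
      refine (hr.order.rank hcx).trans_le ((rk_le c hc).trans ?_)
      rcases hac with rfl | hac
      · exact le_rfl
      · exact (P.h_lt _ _ hac).le
  · rintro x y (⟨a, b, ha, hb, h⟩ | ⟨hx, hy, h⟩ | ⟨hx, c, hc, hcx, a, ha, hac⟩)
    · exact ⟨(rep_mem _ _ ha).2, (rep_mem _ _ hb).2⟩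
    · exact ⟨Set.mem_insert_of_mem _ (hr.mem h).1, Set.mem_insert_of_mem _ (hr.mem h).2⟩
    · exact ⟨(rep_mem _ _ ha).2, Set.mem_insert_of_mem _ (hr.mem hcx).2⟩
  · intro x hx
    by_cases hxS : InS x
    · obtain ⟨b, hb⟩ := hxS
      rw [rk₁_rep _ _ hb]
      exact P.h_pos b (rep_mem _ _ hb).1
    · rw [rk₁_not _ hxS]
      refine hr.pos x (hx.resolve_left ?_)
      rintro rfl; exact hxS inS_u
  · intro x hx hxn
    have hnX : none ∈ P.X := hX ▸ Finset.mem_insert_of_mem hnone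
    by_cases hxu : x = u
    · subst hxu
      refine (anc _ _ _ _ (rep_X none hnX) rep_u).2 ?_
      obtain ⟨r, hroot, h⟩ := P.forest.exists_root hun
      rw [hroots, Finset.mem_singleton] at hroot
      subst hroot
      exact h.resolve_left (fun h => hxn (Sum.inl_injective h).symm)
    · exact sub _ _ (hr.top x (hx.resolve_left hxu) hxn)
  · have hnew : ∀ y ∈ W, H.Adj u y → A₁ u y ∨ A₁ y u := by
      intro y hy huy
      have hyX : y ∈ P.X := hX ▸ Finset.mem_insert_of_mem (hadj y hy huy)
      have huX : u ∈ P.X := hX ▸ Finset.mem_insert_self _ _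
      rw [anc _ _ _ _ rep_u (rep_X y hyX), anc _ _ _ _ (rep_X y hyX) rep_u]
      exact hXadj u huX y hyX huy
    rintro x (rfl | hx) y (rfl | hy) hxy
    · exact (H.loopless.irrefl _ hxy).elim
    · exact hnew y hy hxy
    · exact (hnew x hx hxy.symm).symm
    · exact (hr.adj x hx y hy hxy).imp (sub _ _) (sub _ _)
  · exact fun a ha => (rep_mem _ _ (hj a ha)).2
  · intro a ha b hb hab
    have := hj b hb
    rw [← hab] at this
    exact rep_fun _ _ _ (hj a ha) this
  · intro x hx
    exact rep_inj _ _ _ (hj _ (P.X_subset x hx)) (rep_X x hx)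
  · intro a ha b hb
    exact (anc _ _ _ _ (hj a ha) (hj b hb)).symm
  · intro a ha y hy
    obtain ⟨b, hb⟩ := up₁ _ y a (hj a ha) hy
    have hbm := (rep_mem _ _ hb).1
    exact ⟨b, hbm, rep_inj _ _ _ (hj b hbm) hb⟩
  · intro a ha
    exact (rk₁_rep _ _ (hj a ha)).le

end Realizes

/-! ### Completeness of the dynamic program -/

/-- `P` consists of some of the vertices in `W`, ordered by `A`, and `rk` bounds its heights. -/
structure Follows (A : Option V → Option V → Prop) (rk : Option V → ℕ) (W : Set (Option V))
    (j : Node V → Option V) (P : PartialDecomposition V) : Prop where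
  mapsTo : ∀ a ∈ P.forest.nodes, j a ∈ W
  injOn : Set.InjOn j P.forest.nodes
  apply_inl : ∀ x ∈ P.X, j (Sum.inl x) = x
  anc_iff : ∀ a ∈ P.forest.nodes, ∀ b ∈ P.forest.nodes,
    P.forest.IsAncestor a b ↔ A (j a) (j b)
  h_le : ∀ a ∈ P.forest.nodes, P.h a ≤ rk (j a)
  leaf : ∀ a ∈ P.forest.nodes, ∃ x ∈ P.X, a = Sum.inl x ∨ P.forest.IsAncestor a (Sum.inl x)

namespace Follows

variable {A : Option V → Option V → Prop} {rk : Option V → ℕ} {W : Set (Option V)}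
  {j : Node V → Option V}

/-- A table holds an arbitrary representative of the class of the wanted entry, so the property has
to pass to equivalent decompositions. -/
theorem of_equivalent {P Q : PartialDecomposition V} (h : Follows A rk W j Q)
    (hPQ : P.Equivalent Q) : ∃ j, Follows A rk W j P := by
  obtain ⟨τ, hτ⟩ := equivalent_iff.1 hPQ
  have hX : ∀ x, x ∈ Q.X ↔ x ∈ P.X := fun x => by rw [hPQ.1]
  refine ⟨j ∘ τ, fun a ha => h.mapsTo _ (hτ.mem ha), fun a ha b hb hab => ?_, fun x hx => ?_,
    fun a ha b hb => ?_, fun a ha => ?_, fun a ha => ?_⟩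
  · exact hτ.inj ha hb (h.injOn (hτ.mem ha) (hτ.mem hb) hab)
  · simp only [Function.comp]
    rw [hτ.apply_inl x hx]
    exact h.apply_inl x ((hX x).2 hx)
  · rw [hτ.isAncestor_iff ha hb, h.anc_iff _ (hτ.mem ha) _ (hτ.mem hb)]; rfl
  · rw [← hτ.h_apply a ha]
    exact h.h_le _ (hτ.mem ha)
  · obtain ⟨x, hx, hax⟩ := h.leaf _ (hτ.mem ha)
    rw [hX] at hx
    have hxm := P.X_subset x hx
    refine ⟨x, hx, ?_⟩
    have hτx : τ (Sum.inl x) = Sum.inl x := hτ.apply_inl x hx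
    rw [← hτx] at hax
    rcases hax with hax | hax
    · exact Or.inl (hτ.inj ha hxm hax)
    · exact Or.inr ((hτ.isAncestor_iff ha hxm).2 hax)

theorem restrict {P Q : PartialDecomposition V} (h : Follows A rk W j P)
    {X' : Finset (Option V)} (hX : X' ⊆ P.X) (hQ : P.IsRestriction X' Q) :
    Follows A rk W j Q where
  mapsTo a ha := h.mapsTo a (hQ.nodes_subset ha)
  injOn := h.injOn.mono (Finset.coe_subset.2 hQ.nodes_subset)
  apply_inl x hx := h.apply_inl x (hX (hQ.1 ▸ hx))
  anc_iff a ha b hb := by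
    rw [hQ.isAncestor_iff hb, h.anc_iff a (hQ.nodes_subset ha) b (hQ.nodes_subset hb)]
  h_le a ha := by
    rw [hQ.2.2.2 a ha]
    exact h.h_le a (hQ.nodes_subset ha)
  leaf a ha := by
    obtain ⟨x, hx, hax⟩ := ((hQ.2.1 a).1 ha).2
    refine ⟨x, hQ.1.symm ▸ hx, hax.imp id fun hax => ?_⟩
    exact (hQ.isAncestor_iff (Q.X_subset x (hQ.1.symm ▸ hx))).2 hax

theorem of_leaf {P : PartialDecomposition V} (hA : RankedOrder A rk) (hrk : 1 ≤ rk none)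
    (hX : P.X = {none})
    (hn : P.forest.nodes = {Sum.inl none}) (hh : P.h (Sum.inl none) = 1) :
    Follows A rk {none} (fun _ => none) P where
  mapsTo _ _ := rfl
  injOn := by rw [hn]; simp
  apply_inl x hx := by rw [hX, Finset.mem_singleton] at hx; exact hx.symm
  anc_iff a ha b hb := by
    rw [hn, Finset.mem_singleton] at ha hb
    subst ha; subst hb
    simp [RootedForest.not_isAncestor_self, hA.irrefl]
  h_le a ha := by
    rw [hn, Finset.mem_singleton] at ha
    subst ha
    exact hh.trans_le hrk
  leaf a ha := by
    rw [hn, Finset.mem_singleton] at ha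
    exact ⟨none, by simp [hX], Or.inl ha⟩

/-- The entry consists of the vertices followed by `P'` and of `u`, ordered by `A`. Its heights are
the least ones allowed by the recursion in `intro`, and they stay below `rk`, because `rk` satisfies
the same inequalities. In particular the height is at most `T`. -/
theorem exists_intro [DecidableEq V] {H : SimpleGraph (Option V)} {R' : Table V}
    {X' : Finset (Option V)}
    {T : ℕ} {u : Option V} (hA : RankedOrder A rk) (hrk : ∀ x, 1 ≤ rk x) (hT : rk none ≤ T)
    (htop : ∀ x, x ≠ none → A none x) (hadj : ∀ x y, H.Adj x y → A x y ∨ A y x)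
    (hu : u ∉ W) (hnone : none ∈ X') {P' : PartialDecomposition V} (hP' : P' ∈ R')
    (hX' : P'.X = X') (hF' : Follows A rk W j P') :
    ∃ P j, IntroCandidate T H R' X' u P ∧ Follows A rk (insert u W) j P := by
  classical
  have hT' : ∀ x, rk x ≤ T := fun x => by
    rcases eq_or_ne x none with rfl | hx
    · exact hT
    · exact (hA.rank (htop x hx)).le.trans hT
  -- All nodes of the new entry are named by the vertices they stand for, so `g` reads off the name;
  -- its value on the other names is irrelevant.
  let g : Node V → Option V := Sum.elim id (fun _ => none)
  let A' : Node V → Node V → Prop := fun y x => ∃ a b, y = Sum.inl a ∧ x = Sum.inl b ∧ A a b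
  have hA' : RankedOrder A' (rk ∘ g) := by
    refine ⟨?_, ?_, ?_⟩
    · rintro _ _ _ ⟨a, b, rfl, rfl, h⟩ ⟨b', c, hb, rfl, h'⟩
      rw [← Sum.inl_injective hb] at h'
      exact ⟨a, c, rfl, rfl, hA.trans h h'⟩
    · rintro _ _ _ ⟨a, b, rfl, rfl, h⟩ ⟨a', b', rfl, hb, h'⟩
      rw [← Sum.inl_injective hb] at h'
      rcases hA.total h h' with rfl | h | h
      · exact Or.inl rfl
      · exact Or.inr (Or.inl ⟨_, _, rfl, rfl, h⟩)
      · exact Or.inr (Or.inr ⟨_, _, rfl, rfl, h⟩)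
    · rintro _ _ ⟨a, b, rfl, rfl, h⟩
      exact hA.rank h
  have hA'' : ∀ a b, A' (Sum.inl a) (Sum.inl b) ↔ A a b := by
    intro a b
    refine ⟨?_, fun h => ⟨a, b, rfl, rfl, h⟩⟩
    rintro ⟨a', b', ha, hb, h⟩
    rw [Sum.inl_injective ha, Sum.inl_injective hb]; exact h
  let S : Finset (Option V) := insert u (P'.forest.nodes.image j)
  obtain ⟨F, hF, hanc⟩ := hA'.exists_forest (S.image Sum.inl)
  have hmem : ∀ a, Sum.inl a ∈ F.nodes ↔ a ∈ S := by
    intro a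
    rw [hF, Finset.mem_image]
    exact ⟨fun ⟨b, hb, h⟩ => Sum.inl_injective h ▸ hb, fun h => ⟨a, h, rfl⟩⟩
  have hex : ∀ z ∈ F.nodes, ∃ a ∈ S, z = Sum.inl a := by
    intro z hz
    rw [hF, Finset.mem_image] at hz
    obtain ⟨a, ha, rfl⟩ := hz
    exact ⟨a, ha, rfl⟩
  have hanc' : ∀ a ∈ S, ∀ b ∈ S, (F.IsAncestor (Sum.inl a) (Sum.inl b) ↔ A a b) := by
    intro a ha b hb
    rw [hanc, ← hF, hmem, hmem, hA'']
    exact ⟨fun h => h.2.2, fun h => ⟨ha, hb, h⟩⟩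
  -- The lower bounds in the recursion: the old heights, and `0` for `u`, whose height is determined
  -- by its children alone.
  let base : Node V → ℕ := fun x =>
    if h : ∃ z ∈ P'.forest.nodes, Sum.inl (j z) = x then P'.h h.choose else 0
  have base_j : ∀ z ∈ P'.forest.nodes, base (Sum.inl (j z)) = P'.h z := by
    intro z hz
    have h : ∃ z' ∈ P'.forest.nodes, (Sum.inl (j z') : Node V) = Sum.inl (j z) := ⟨z, hz, rfl⟩
    simp only [base, dif_pos h]
    rw [hF'.injOn h.choose_spec.1 hz (Sum.inl_injective h.choose_spec.2)]
  have base_u : base (Sum.inl u) = 0 := by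
    refine dif_neg ?_
    rintro ⟨z, hz, h⟩
    exact hu (Sum.inl_injective h ▸ hF'.mapsTo z hz)
  have base_le : ∀ x, base x ≤ rk (g x) := by
    intro x
    by_cases h : ∃ z ∈ P'.forest.nodes, Sum.inl (j z) = x
    · obtain ⟨z, hz, rfl⟩ := h
      rw [base_j z hz]; exact hF'.h_le z hz
    · rw [show base x = 0 from dif_neg h]; exact Nat.zero_le _
  obtain ⟨h, hh⟩ := F.exists_height_function base
  have hj_mem : ∀ z ∈ P'.forest.nodes, j z ∈ S := fun z hz =>
    Finset.mem_insert_of_mem (Finset.mem_image_of_mem _ hz)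
  have hX'j : ∀ x ∈ X', Sum.inl x ∈ P'.forest.nodes ∧ j (Sum.inl x) = x := fun x hx =>
    ⟨P'.X_subset x (hX' ▸ hx), hF'.apply_inl x (hX' ▸ hx)⟩
  have hXS : ∀ x ∈ insert u X', x ∈ S := by
    intro x hx
    rcases Finset.mem_insert.1 hx with rfl | hx
    · exact Finset.mem_insert_self _ _
    · rw [← (hX'j x hx).2]; exact hj_mem _ (hX'j x hx).1
  have h_le : ∀ x, h x ≤ rk (g x) := by
    intro x
    induction x using F.wellFounded_descendant.induction with
    | _ x ih =>
      rw [hh]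
      refine max_le ?_ (base_le x)
      -- The subtraction also covers a leaf, where the supremum is `0`; positivity of the rank then
      -- restores the missing one.
      have : (F.children x).sup h ≤ rk (g x) - 1 := by
        refine Finset.sup_le fun c hc => ?_
        have hcx := RootedForest.IsAncestor.of_parent (RootedForest.mem_children.1 hc)
        have h1 := ih c hcx
        have h2 : rk (g c) < rk (g x) := hA'.rank ((hanc _ _).1 hcx).2.2
        omega
      have := hrk (g x)
      omega
  have h_lt : ∀ x y, F.IsAncestor x y → h y < h x := by
    intro x y hxy
    induction y using F.wellFounded_isAncestor.induction with
    | _ y ih =>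
      obtain ⟨p, hp, hpx⟩ := RootedForest.isAncestor_iff_parent.1 hxy
      have h1 : h y < h p := by
        rw [hh p]
        have := Finset.le_sup (f := h) (RootedForest.mem_children.2 hp)
        omega
      rcases hpx with rfl | hpx
      · exact h1
      · exact h1.trans (ih p (.of_parent hp) hpx)
  have hleaf : ∀ a ∈ S, ∃ x ∈ insert u X', a = x ∨ A a x := by
    intro a ha
    rcases Finset.mem_insert.1 ha with rfl | ha
    · exact ⟨a, Finset.mem_insert_self _ _, Or.inl rfl⟩
    · obtain ⟨z, hz, rfl⟩ := Finset.mem_image.1 ha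
      obtain ⟨x, hx, hzx⟩ := hF'.leaf z hz
      rw [hX'] at hx
      obtain ⟨hxm, hjx⟩ := hX'j x hx
      refine ⟨x, Finset.mem_insert_of_mem hx, ?_⟩
      rcases hzx with rfl | hzx
      · exact Or.inl hjx
      · rw [hF'.anc_iff z hz _ hxm, hjx] at hzx
        exact Or.inr hzx
  have hroot : F.roots = {Sum.inl none} := by
    have hn : none ∈ S := hXS none (Finset.mem_insert_of_mem hnone)
    ext z
    rw [RootedForest.mem_roots, Finset.mem_singleton]
    constructor
    · rintro ⟨hz, hp⟩
      obtain ⟨a, ha, rfl⟩ := hex z hz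
      by_contra hne
      have han : a ≠ none := fun h => hne (congrArg _ h)
      obtain ⟨p, hp', -⟩ := RootedForest.isAncestor_iff_parent.1
        ((hanc' none hn a ha).2 (htop a han))
      rw [hp] at hp'; cases hp'
    · rintro rfl
      refine ⟨(hmem _).2 hn, Option.eq_none_iff_forall_ne_some.2 fun p hp => ?_⟩
      have hpm := (F.parent_mem _ _ hp).2
      obtain ⟨a, ha, rfl⟩ := hex p hpm
      have h1 := (hanc' a ha none hn).1 (.of_parent hp)
      rcases eq_or_ne a none with rfl | han
      · exact hA.irrefl _ h1
      · exact hA.irrefl _ (hA.trans h1 (htop a han))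
  have hcard : F.nodes.card ≤ (insert u X').card * T := by
    rw [hF, Finset.card_image_of_injective _ Sum.inl_injective]
    -- Every node is a bag vertex or lies above one, and at or above a fixed vertex there are at
    -- most `T` nodes, their ranks being distinct and between `1` and `T`.
    have hsub : S ⊆ (insert u X').biUnion (fun x => S.filter (fun a => a = x ∨ A a x)) := by
      intro a ha
      obtain ⟨x, hx, hax⟩ := hleaf a ha
      exact Finset.mem_biUnion.2 ⟨x, hx, Finset.mem_filter.2 ⟨ha, hax⟩⟩
    refine (Finset.card_le_card hsub).trans (Finset.card_biUnion_le_card_mul _ _ _ fun x hx => ?_)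
    have hle : S.filter (fun a => a = x ∨ A a x) ⊆ insert x (S.filter (fun a => A a x)) := by
      intro a ha
      rw [Finset.mem_filter] at ha
      rw [Finset.mem_insert, Finset.mem_filter]
      exact ha.2.imp id (fun h => ⟨ha.1, h⟩)
    refine ((Finset.card_le_card hle).trans (Finset.card_insert_le _ _)).trans ?_
    have := hA.card_ancestors_le (k := T) (x := x) (S.filter (fun a => A a x))
      (fun a ha => ⟨(Finset.mem_filter.1 ha).2, hT' a⟩)
    have h1 := hrk x
    have h2 := hT' x
    omega
  let P : PartialDecomposition V :=
    { forest := F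
      X := insert u X'
      h := h
      X_subset := fun x hx => (hmem x).2 (hXS x hx)
      h_pos := fun x _ => by rw [hh]; exact (Nat.succ_pos _).trans_le (le_max_left _ _)
      h_lt := h_lt }
  refine ⟨P, g, ⟨rfl, hcard, hroot, ?_, ?_, ⟨P', hP', fun z => Sum.inl (j z),
    ⟨?_, ?_, ?_, ?_⟩, ?_, ?_, ?_⟩, ?_⟩, ?_, ?_, ?_, ?_, ?_, ?_⟩
  · intro z hz hc
    obtain ⟨a, ha, rfl⟩ := hex z hz
    obtain ⟨x, hx, rfl | hax⟩ := hleaf a ha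
    · exact ⟨a, hx, rfl⟩
    · exact absurd hc (RootedForest.children_nonempty_of_isAncestor
        ((hanc' a ha x (hXS x hx)).2 hax))
  · intro x hx y hy hxy
    show F.IsAncestor _ _ ∨ F.IsAncestor _ _
    rw [hanc' x (hXS x hx) y (hXS y hy), hanc' y (hXS y hy) x (hXS x hx)]
    exact hadj x y hxy
  · intro z hz
    exact (hmem _).2 (hj_mem z hz)
  · intro a ha b hb hab
    exact hF'.injOn ha hb (Sum.inl_injective hab)
  · intro x hx
    exact congrArg _ (hX'j x hx).2
  · intro x hx y hy hyx
    exact (hanc' _ (hj_mem y hy) _ (hj_mem x hx)).2 ((hF'.anc_iff y hy x hx).1 hyx)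
  · ext z
    constructor
    · rintro ⟨a, ha, rfl⟩
      refine ⟨(hmem _).2 (hj_mem a ha), fun h => hu ?_⟩
      rw [← Sum.inl_injective h]; exact hF'.mapsTo a ha
    · rintro ⟨hz, hzu⟩
      obtain ⟨a, ha, rfl⟩ := hex z hz
      rcases Finset.mem_insert.1 ha with rfl | ha
      · exact absurd rfl hzu
      · obtain ⟨b, hb, rfl⟩ := Finset.mem_image.1 ha
        exact ⟨b, hb, rfl⟩
  · show h (Sum.inl u) = _
    rw [hh, base_u]
    exact max_eq_left (Nat.zero_le _)
  · intro z hz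
    show h (Sum.inl (j z)) = _
    rw [hh, base_j z hz]
  · show F.roots.sup h ≤ T
    rw [hroot, Finset.sup_singleton]
    exact (h_le _).trans hT
  · intro a ha
    obtain ⟨a, haS, rfl⟩ := hex a ha
    rcases Finset.mem_insert.1 haS with rfl | haS
    · exact Set.mem_insert _ _
    · obtain ⟨b, hb, rfl⟩ := Finset.mem_image.1 haS
      exact Set.mem_insert_of_mem _ (hF'.mapsTo b hb)
  · intro a ha b hb hab
    obtain ⟨a, -, rfl⟩ := hex a ha
    obtain ⟨b, -, rfl⟩ := hex b hb
    exact congrArg _ hab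
  · intro x _; rfl
  · intro a ha b hb
    obtain ⟨a, haS, rfl⟩ := hex a ha
    obtain ⟨b, hbS, rfl⟩ := hex b hb
    exact hanc' a haS b hbS
  · intro a _
    exact h_le a
  · intro a ha
    obtain ⟨a, haS, rfl⟩ := hex a ha
    obtain ⟨x, hx, hax⟩ := hleaf a haS
    refine ⟨x, hx, hax.imp (congrArg _) fun hax => (hanc' a haS x (hXS x hx)).2 hax⟩

end Follows

end PartialDecomposition

/-! ### Every execution answers correctly -/

/-- `B` bounds the sizes of tables in the algorithm with parameter `t`. -/
def TableBound (t B : ℕ) : Prop :=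
  (2 ^ t + 1) * (t + 1) ≤ B ∧ t + 1 ≤ B ∧
    ∀ (V : Type) (X : Finset (Option V)), X.card ≤ 2 ^ t + 1 → ∀ A : Table V,
      A.Pairwise (fun P Q => ¬ P.Equivalent Q) →
      (∀ P ∈ A, P.X = X ∧ P.forest.nodes.card ≤ (2 ^ t + 1) * (t + 1) ∧
        ∀ x ∈ P.forest.nodes, P.h x ≤ t + 1) → A.length ≤ B

theorem IntroCandidate.size {V : Type*} [DecidableEq V] {T : ℕ} {H : SimpleGraph (Option V)}
    {R' : Table V} {X' : Finset (Option V)} {u : Option V} {P : PartialDecomposition V}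
    (h : IntroCandidate T H R' X' u P) {p : ℕ} (hp : (insert u X').card ≤ p) :
    P.X = insert u X' ∧ P.forest.nodes.card ≤ p * T ∧ ∀ x ∈ P.forest.nodes, P.h x ≤ T :=
  ⟨h.1, h.2.1.trans (Nat.mul_le_mul_right _ (h.1 ▸ hp)), fun _ hx =>
    (P.h_le_height hx).trans h.2.2.2.2.2.2⟩

theorem PartialDecomposition.IsRestriction.size {V : Type*} {P Q : PartialDecomposition V}
    {X' : Finset (Option V)} (h : P.IsRestriction X' Q) {m T : ℕ}
    (hP : P.forest.nodes.card ≤ m ∧ ∀ x ∈ P.forest.nodes, P.h x ≤ T) :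
    Q.X = X' ∧ Q.forest.nodes.card ≤ m ∧ ∀ x ∈ Q.forest.nodes, Q.h x ≤ T := by
  refine ⟨h.1, (Finset.card_le_card h.nodes_subset).trans hP.1, fun x hx => ?_⟩
  rw [h.2.2.2 x hx]
  exact hP.2 x (h.nodes_subset hx)

namespace AlgState

variable {V : Type*}

/-- The vertices discovered so far together with the universal vertex. -/
def seen (s : AlgState V) : Set (Option V) := insert none (some '' s.visited)

theorem some_mem_seen {s : AlgState V} {v : V} : some v ∈ s.seen ↔ v ∈ s.visited := by
  simp [seen]

theorem seen_insert (m m' : Memory V) (u : V) (v : Set V) :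
    seen ⟨m, insert u v⟩ = insert (some u) (seen ⟨m', v⟩) := by
  simp only [seen, Set.image_insert_eq]
  exact Set.insert_comm _ _ _

variable [LinearOrder V]

/-- The invariant of the dynamic program. -/
structure TableInv (t : ℕ) (G : SimpleGraph V) (s : AlgState V) : Prop where
  size : ∀ P ∈ s.memory.current, P.X = s.bag ∧
    P.forest.nodes.card ≤ (2 ^ t + 1) * (t + 1) ∧ ∀ x ∈ P.forest.nodes, P.h x ≤ t + 1
  pairwise : s.memory.current.Pairwise (fun P Q => ¬ P.Equivalent Q)
  sound : ∀ P ∈ s.memory.current, ∃ A rk j, P.Realizes (rootedGraph G) s.seen A rk j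
  complete : ∀ A rk, RankedOrder A rk → (∀ x, 1 ≤ rk x) → rk none ≤ t + 1 →
    (∀ x, x ≠ none → A none x) → (∀ x y, (rootedGraph G).Adj x y → A x y ∨ A y x) →
    ∃ P ∈ s.memory.current, ∃ j, P.Follows A rk s.seen j

theorem TableInv.initial {t : ℕ} {G : SimpleGraph V} {s : AlgState V} (h : s.IsInitial) :
    TableInv t G s := by
  obtain ⟨hst, -, ⟨P, hA, hX, hn, hh⟩, hv⟩ := h
  have hseen : s.seen = {none} := by simp [seen, hv]
  have hbag : s.bag = {none} := by simp [bag, hst]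
  refine ⟨?_, ?_, ?_, ?_⟩
  · intro Q hQ
    rw [hA, List.mem_singleton] at hQ
    subst hQ
    refine ⟨hX.trans hbag.symm, ?_, ?_⟩
    · rw [hn, Finset.card_singleton]
      exact Nat.mul_pos (Nat.succ_pos _) (Nat.succ_pos _)
    · intro x hx
      rw [hn, Finset.mem_singleton] at hx
      rw [hx, hh]; exact Nat.le_add_left _ _
  · rw [hA]; simp
  · intro Q hQ
    rw [hA, List.mem_singleton] at hQ
    subst hQ
    rw [hseen]
    exact ⟨_, _, _, .of_leaf hX hn hh⟩
  · intro A rk hr h1 _ _ _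
    rw [hseen]
    exact ⟨P, by simp [hA], _, .of_leaf hr (h1 _) hX hn hh⟩

/-- The search invariant enters only to say that the introduced vertex is new, that its seen
neighbours are in the bag, and that the stack has no repetitions. -/
theorem TableInv.step {t : ℕ} {G : SimpleGraph V} {s s' : AlgState V} {L : ℕ} {W : Set V}
    (h : TableInv t G s) (hs : SearchInv L G s W) (hstep : Step t G s s') : TableInv t G s' := by
  have hbs : ∀ v, some v ∈ s.bag → v ∈ s.visited := fun v hv =>
    hs.visited_of_mem v (some_mem_bag.1 hv)
  cases hstep with
  | discover u A hu hdepth hA =>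
    have hbag : bag ⟨⟨u :: s.memory.stack, s.memory.current, A⟩, insert u s.visited⟩ =
        insert (some u) s.bag := bag_cons _ _ _ _ _ _ _ _
    have hseen : seen ⟨⟨u :: s.memory.stack, s.memory.current, A⟩, insert u s.visited⟩ =
        insert (some u) s.seen := seen_insert _ _ _ _
    have hus : some u ∉ s.seen := fun h => hu.1.1 (some_mem_seen.1 h)
    have hcard : (insert (some u) s.bag).card ≤ 2 ^ t + 1 := by
      refine (Finset.card_insert_le _ _).trans ?_
      have := s.card_bag_le
      omega
    -- If `y` had been left already, its neighbour `u` would have been discovered.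
    have hadj : ∀ y ∈ s.seen, (rootedGraph G).Adj (some u) y → y ∈ s.bag := by
      rintro (_ | y) hy hadj
      · exact none_mem_bag s
      · have hyv := some_mem_seen.1 hy
        rw [some_mem_bag]
        by_contra hys
        obtain ⟨-, h | h | ⟨a, b, ha, hb, hab⟩⟩ := hadj
        · cases h
        · cases h
        · rw [Option.some.injEq] at ha hb
          subst ha; subst hb
          exact hu.1.1 (hs.closed y hyv hys u hab.symm)
    refine ⟨?_, hA.1, ?_, ?_⟩
    · intro P hP
      rw [hbag]
      exact (hA.2.1 P hP).size hcard
    · intro P hP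
      rw [hseen]
      exact PartialDecomposition.Realizes.intro
        (fun P' hP' => ⟨(h.size P' hP').1, h.sound P' hP'⟩) hus (none_mem_bag s) hadj
        (hA.2.1 P hP)
    · intro B rk hr h1 h2 h3 h4
      rw [hseen]
      obtain ⟨P', hP', j, hj⟩ := h.complete B rk hr h1 h2 h3 h4
      obtain ⟨Q, j', hQ, hj'⟩ := hj.exists_intro hr h1 h2 h3 h4 hus (none_mem_bag s) hP'
        (h.size P' hP').1
      obtain ⟨P, hP, hPQ⟩ := hA.2.2 Q hQ
      exact ⟨P, hP, hj'.of_equivalent hPQ⟩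
  | leave u l A hnone hstack hA =>
    have hnd := hs.nodup
    rw [hstack, List.nodup_cons] at hnd
    have hbag : bag ⟨⟨l, s.memory.current, A⟩, s.visited⟩ = s.bag.erase (some u) := by
      have hb : s.bag = insert (some u) (bag ⟨⟨l, s.memory.current, A⟩, s.visited⟩) := by
        rw [← bag_cons l u s.memory.previous s.memory.current _ _ s.visited]
        exact bag_congr hstack
      rw [hb, Finset.erase_insert]
      exact fun h => hnd.1 (some_mem_bag.1 h)
    have hsub : ∀ P ∈ s.memory.current, s.bag.erase (some u) ⊆ P.X := fun P hP => by
      rw [(h.size P hP).1]; exact Finset.erase_subset _ _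
    refine ⟨?_, hA.1, ?_, ?_⟩
    · intro Q hQ
      obtain ⟨P, hP, hPQ⟩ := hA.2.1 Q hQ
      rw [hbag]
      exact hPQ.size (h.size P hP).2
    · intro Q hQ
      obtain ⟨P, hP, hPQ⟩ := hA.2.1 Q hQ
      obtain ⟨B, rk, j, hr⟩ := h.sound P hP
      exact ⟨B, rk, j, hr.restrict (hsub P hP) hPQ⟩
    · intro B rk hr h1 h2 h3 h4
      obtain ⟨P, hP, j, hj⟩ := h.complete B rk hr h1 h2 h3 h4
      have hres := P.restrict_isRestriction _ (hsub P hP)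
      obtain ⟨Q, hQ, hQP⟩ := hA.2.2 _ ⟨P, hP, hres⟩
      exact ⟨Q, hQ, (hj.restrict (hsub P hP) hres).of_equivalent hQP⟩

end AlgState

namespace Execution

open AlgState

theorem tableInv {V : Type*} [LinearOrder V] {t : ℕ} {G : SimpleGraph V} (ρ : Execution t G) :
    ∀ i ≤ ρ.length, TableInv t G (ρ.state i) := by
  intro i
  induction i with
  | zero => exact fun _ => .initial ρ.initial
  | succ i ih =>
    intro hi
    obtain ⟨W, hW⟩ := ρ.exists_searchInv i (by omega)
    exact (ih (by omega)).step hW (ρ.step i hi)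

/-- A ranked order for a graph, extended by the universal vertex. -/
theorem _root_.exists_rankedOrder_option {V : Type*} {G : SimpleGraph V} {t : ℕ}
    {A : V → V → Prop} {rk : V → ℕ} (hr : RankedOrder A rk) (hrk : ∀ x, 1 ≤ rk x ∧ rk x ≤ t)
    (hadj : ∀ x y, G.Adj x y → A x y ∨ A y x) :
    ∃ (B : Option V → Option V → Prop) (rk' : Option V → ℕ), RankedOrder B rk' ∧
      (∀ x, 1 ≤ rk' x) ∧ rk' none ≤ t + 1 ∧ (∀ x, x ≠ none → B none x) ∧
      ∀ x y, (rootedGraph G).Adj x y → B x y ∨ B y x := by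
  -- For `y = none` the inner condition is vacuous, so the universal vertex is above every other
  -- vertex. It gets rank `t + 1`.
  refine ⟨fun y x => ∃ v, x = some v ∧ ∀ u, y = some u → A u v,
    fun x => x.elim (t + 1) rk, ⟨?_, ?_, ?_⟩, ?_, le_rfl, ?_, ?_⟩
  · rintro _ _ z ⟨y, rfl, hz⟩ ⟨x, rfl, h⟩
    exact ⟨x, rfl, fun u hu => hr.trans (hz u hu) (h y rfl)⟩
  · rintro _ (_ | y) (_ | z) ⟨x, rfl, hy⟩ ⟨x', hx', hz⟩
    · exact Or.inl rfl
    · exact Or.inr (Or.inl ⟨z, rfl, by simp⟩)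
    · exact Or.inr (Or.inr ⟨y, rfl, by simp⟩)
    · rw [Option.some.injEq] at hx'
      subst hx'
      rcases hr.total (hy y rfl) (hz z rfl) with h | h | h
      · exact Or.inl (congrArg _ h)
      · exact Or.inr (Or.inl ⟨z, rfl, by rintro u hu; cases hu; exact h⟩)
      · exact Or.inr (Or.inr ⟨y, rfl, by rintro u hu; cases hu; exact h⟩)
  · rintro _ (_ | y) ⟨x, rfl, hy⟩
    · exact Nat.lt_succ_of_le (hrk x).2
    · exact hr.rank (hy y rfl)
  · rintro (_ | x)
    · exact Nat.le_add_left _ _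
    · exact (hrk x).1
  · rintro (_ | x) hx
    · exact absurd rfl hx
    · exact ⟨x, rfl, by simp⟩
  · rintro (_ | x) (_ | y) ⟨hne, h⟩
    · exact absurd rfl hne
    · exact Or.inl ⟨y, rfl, by simp⟩
    · exact Or.inr ⟨x, rfl, by simp⟩
    · obtain h | h | ⟨a, b, ha, hb, hab⟩ := h
      · cases h
      · cases h
      · cases ha; cases hb
        rcases hadj x y hab with h | h
        · exact Or.inl ⟨y, rfl, by rintro u hu; cases hu; exact h⟩
        · exact Or.inr ⟨x, rfl, by rintro u hu; cases hu; exact h⟩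

/-- If the search becomes too deep, the stack and the next vertex form a path too long for treedepth
`t`. Otherwise all vertices have been seen at the end: an entry of the last table realizes a ranked
order of the whole graph, and conversely such an order is followed by an entry. -/
theorem answer_iff {V : Type} [LinearOrder V] [Finite V] {t : ℕ} {G : SimpleGraph V}
    (ρ : Execution t G) : ρ.answer = true ↔ treedepth G ≤ t := by
  have hI := ρ.tableInv ρ.length le_rfl
  obtain ⟨W, hW⟩ := ρ.exists_searchInv ρ.length le_rfl
  have hret := ρ.returns
  have hvis := ρ.visited_of_complete
  generalize ρ.state ρ.length = s at hI hW hret hvis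
  generalize ρ.answer = b at hret
  rw [treedepth_le_iff]
  cases hret with
  | tooDeep hne hdepth =>
    refine iff_of_false (by simp) ?_
    rintro ⟨A, rk, hr, hrk, hadj⟩
    obtain ⟨u, hu, hn⟩ := hne
    have hchain : (u :: s.memory.stack).IsChain G.Adj :=
      hW.isChain.cons (fun y hy => (hn y hy).symm)
    have := hr.length_lt t (u :: s.memory.stack)
      (List.nodup_cons.2 ⟨fun h => hu (hW.visited_of_mem u h), hW.nodup⟩)
      (hchain.imp (fun a b hab => hadj a b hab)) (fun z _ => hrk z)
    rw [List.length_cons] at this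
    omega
  | done hs =>
    have hbang : (!s.memory.current.isEmpty) = true ↔ s.memory.current ≠ [] := by
      rcases s.memory.current with _ | _ <;> simp
    have hstk := hs.2
    rw [hbang]
    constructor
    · intro hne
      obtain ⟨P, hP⟩ := List.exists_mem_of_ne_nil _ hne
      obtain ⟨A, rk, j, hr⟩ := hI.sound P hP
      have hmem : ∀ v : V, some v ∈ s.seen := fun v => some_mem_seen.2 (hvis hs v)
      have hnone : none ∈ P.X := by rw [(hI.size P hP).1]; exact none_mem_bag s
      -- The universal vertex is in the bag, so its rank is bounded by a height in the table. All
      -- other ranks are strictly smaller, hence at most `t`.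
      have hr0 : rk none ≤ t + 1 := by
        have h1 := hr.rank_le _ (P.X_subset none hnone)
        rw [hr.apply_inl none hnone] at h1
        exact h1.trans ((hI.size P hP).2.2 _ (P.X_subset none hnone))
      refine ⟨fun y x => A (some y) (some x), fun x => rk (some x), ⟨?_, ?_, ?_⟩, ?_, ?_⟩
      · exact fun h1 h2 => hr.order.trans h1 h2
      · exact fun h1 h2 => (hr.order.total h1 h2).imp (fun h => Option.some.inj h) id
      · exact fun h => hr.order.rank h
      · intro x
        have := hr.order.rank (hr.top (some x) (hmem x) (by simp))
        exact ⟨hr.pos _ (hmem x), by show rk (some x) ≤ t; omega⟩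
      · intro x y hxy
        refine hr.adj _ (hmem x) _ (hmem y) ⟨fun h => hxy.ne (Option.some.inj h), ?_⟩
        exact Or.inr (Or.inr ⟨x, y, rfl, rfl, hxy⟩)
    · rintro ⟨A, rk, hr, hrk, hadj⟩
      obtain ⟨B, rk', h1, h2, h3, h4, h5⟩ := exists_rankedOrder_option hr hrk hadj
      obtain ⟨P, hP, -⟩ := hI.complete B rk' h1 h2 h3 h4 h5
      exact List.ne_nil_of_mem hP

/-- The bound on the size of the tables. -/
theorem _root_.exists_table_bound (t : ℕ) : ∃ B, TableBound t B := by
  obtain ⟨C, hC⟩ := PartialDecomposition.exists_length_bound (2 ^ t + 1)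
    ((2 ^ t + 1) * (t + 1)) (t + 1)
  refine ⟨max ((2 ^ t + 1) * (t + 1)) (max (t + 1) C), le_max_left _ _,
    (le_max_left _ _).trans (le_max_right _ _), fun V X hX A hA h => ?_⟩
  exact (hC V X hX A hA h).trans ((le_max_right _ _).trans (le_max_right _ _))

/-- The previous table is empty or was the current table one step earlier, so bounding the current
tables suffices. -/
theorem tableSizeAtMost {V : Type} [LinearOrder V] {t B : ℕ} {G : SimpleGraph V}
    (ρ : Execution t G) (hB : TableBound t B) (i : ℕ) (hi : i ≤ ρ.length) :
    (ρ.state i).memory.stack.length ≤ 2 ^ t ∧ TableSizeAtMost B (ρ.state i).memory.previous ∧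
      TableSizeAtMost B (ρ.state i).memory.current := by
  have hcur : ∀ i ≤ ρ.length, TableSizeAtMost B (ρ.state i).memory.current := by
    intro i hi
    have hI := ρ.tableInv i hi
    obtain ⟨W, hW⟩ := ρ.exists_searchInv i hi
    refine ⟨hB.2.2 V _ ((card_bag_le _).trans (Nat.add_le_add_right hW.length_le 1)) _
      hI.pairwise hI.size, fun P hP => ⟨(hI.size P hP).2.1.trans hB.1, fun x hx => ?_⟩⟩
    exact ((hI.size P hP).2.2 x hx).trans hB.2.1
  obtain ⟨W, hW⟩ := ρ.exists_searchInv i hi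
  refine ⟨hW.length_le, ?_, hcur i hi⟩
  rcases i with _ | i
  · rw [ρ.initial.2.1]
    exact ⟨Nat.zero_le _, by simp⟩
  · have hprev : (ρ.state (i + 1)).memory.previous = (ρ.state i).memory.current := by
      have hstep := ρ.step i hi
      generalize ρ.state i = s at hstep
      generalize ρ.state (i + 1) = s' at hstep
      cases hstep <;> rfl
    rw [hprev]
    exact hcur i (by omega)

end Execution

/-! ### Traces of deterministic systems -/

/-- From the configuration `c` the system halts with answer `b`; the configurations on the way
satisfy `ok`, and their displays under `dec` run through the list `l`, each being shown for at least
one step. -/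
inductive Produces {σ μ : Type*} (step : σ → Bool ⊕ σ) (dec : σ → μ) (ok : σ → Prop) :
    σ → List μ → Bool → Prop
  | halt (c : σ) (b : Bool) (h : step c = .inl b) (hok : ok c) : Produces step dec ok c [dec c] b
  | stay (c c' : σ) (l : List μ) (b : Bool) (h : step c = .inr c') (hok : ok c)
      (hp : Produces step dec ok c' (dec c :: l) b) : Produces step dec ok c (dec c :: l) b
  | move (c c' : σ) (l : List μ) (b : Bool) (h : step c = .inr c') (hok : ok c)
      (hp : Produces step dec ok c' l b) : Produces step dec ok c (dec c :: l) b

namespace Produces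

variable {σ μ : Type*} {step : σ → Bool ⊕ σ} {dec : σ → μ} {ok : σ → Prop}

theorem exists_cons {c : σ} {l : List μ} {b : Bool} (h : Produces step dec ok c l b) :
    ∃ l', l = dec c :: l' := by
  cases h <;> exact ⟨_, rfl⟩

theorem ok_start {c : σ} {l : List μ} {b : Bool} (h : Produces step dec ok c l b) : ok c := by
  cases h <;> assumption

theorem stay' {c c' : σ} {d : μ} {l : List μ} {b : Bool} (h : step c = .inr c') (hok : ok c)
    (hd : dec c = d) (hp : Produces step dec ok c' (d :: l) b) :
    Produces step dec ok c (d :: l) b := by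
  subst hd
  exact .stay c c' l b h hok hp

end Produces

/-! ### From traces to computations of Turing machines -/

namespace OfflineTM

variable (M : OfflineTM)

/-- One step of `M`, as a deterministic system. -/
def sysStep (w : List Bool) (c : M.Config) : Bool ⊕ M.Config :=
  match M.action w c with
  | .inl b => .inl b
  | .inr _ => .inr (M.next w c)

variable {M}

theorem next_eq_of_action_inl {w : List Bool} {c : M.Config} {b : Bool}
    (h : M.action w c = .inl b) : M.next w c = c := by
  unfold next
  rw [h]

/-- The index advances exactly at the `move` steps. Halting configurations are fixed by `next`, so
the condition `ok` persists at all later times, as a space bound requires. -/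
theorem produces_spec {μ : Type*} {w : List Bool} {dec : M.Config → μ} {ok : M.Config → Prop}
    {c : M.Config} {l : List μ} {b : Bool} (h : Produces (M.sysStep w) dec ok c l b) :
    ∃ (T : ℕ) (idx : ℕ → ℕ), idx 0 = 0 ∧
      (∀ j < T, idx (j + 1) = idx j ∨ idx (j + 1) = idx j + 1) ∧ idx T + 1 = l.length ∧
      (∀ j ≤ T, l[idx j]? = some (dec ((M.next w)^[j] c))) ∧
      M.action w ((M.next w)^[T] c) = .inl b ∧ ∀ j, ok ((M.next w)^[j] c) := by
  induction h with
  | halt c b h hok =>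
    have hact : M.action w c = .inl b := by
      unfold sysStep at h
      cases ha : M.action w c with
      | inl b' => rw [ha] at h; exact congrArg _ (Sum.inl_injective h)
      | inr x => rw [ha] at h; cases h
    have hfix : ∀ j, (M.next w)^[j] c = c := fun j =>
      Function.iterate_fixed (next_eq_of_action_inl hact) j
    refine ⟨0, fun _ => 0, rfl, by simp, rfl, fun j _ => by simp [hfix], hact, fun j => ?_⟩
    rw [hfix]; exact hok
  | stay c c' l b h hok hp ih =>
    obtain ⟨T, idx, h0, h1, h2, h3, h4, h5⟩ := ih
    have hc' : M.next w c = c' := by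
      unfold sysStep at h
      cases ha : M.action w c with
      | inl b' => rw [ha] at h; cases h
      | inr x => rw [ha] at h; exact Sum.inr_injective h
    subst hc'
    refine ⟨T + 1, fun j => if j = 0 then 0 else idx (j - 1), rfl, fun j hj => ?_, ?_,
      fun j hj => ?_, ?_, fun j => ?_⟩
    · rcases j with _ | j
      · left; simp [h0]
      · simpa using h1 j (by omega)
    · simpa using h2
    · rcases j with _ | j
      · simp
      · simpa [Function.iterate_succ] using h3 j (by omega)
    · simpa [Function.iterate_succ] using h4
    · rcases j with _ | j
      · exact hok
      · simpa [Function.iterate_succ] using h5 j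
  | move c c' l b h hok hp ih =>
    obtain ⟨T, idx, h0, h1, h2, h3, h4, h5⟩ := ih
    have hc' : M.next w c = c' := by
      unfold sysStep at h
      cases ha : M.action w c with
      | inl b' => rw [ha] at h; cases h
      | inr x => rw [ha] at h; exact Sum.inr_injective h
    subst hc'
    refine ⟨T + 1, fun j => if j = 0 then 0 else idx (j - 1) + 1, rfl, fun j hj => ?_, ?_,
      fun j hj => ?_, ?_, fun j => ?_⟩
    · rcases j with _ | j
      · right; simp [h0]
      · have := h1 j (by omega)
        simp only [Nat.add_eq_zero_iff, one_ne_zero, and_false, if_false, Nat.add_sub_cancel]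
        omega
    · simpa using h2
    · rcases j with _ | j
      · simp
      · simpa [Function.iterate_succ] using h3 j (by omega)
    · simpa [Function.iterate_succ] using h4
    · rcases j with _ | j
      · exact hok
      · simpa [Function.iterate_succ] using h5 j

end OfflineTM

/-! ### Register machines -/

/-- A machine with finitely many registers for numbers. In each step it sees its state, the input
symbol and the order of the register contents; it moves the input head and replaces every register
by the content of some register, possibly plus one. -/
structure RegMachine (Reg : Type) where
  State : Type
  start : State
  transition : State → InputSymbol → (Reg → Reg → Bool) →
    Bool ⊕ (State × HeadMove × (Reg → Reg × Bool))

namespace RegMachine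

/-- A configuration of a register machine. -/
structure Config {Reg : Type} (R : RegMachine Reg) where
  state : R.State
  pos : ℕ
  reg : Reg → ℕ

variable {Reg : Type} (R : RegMachine Reg)

/-- The effect of an assignment on the registers. -/
def assign (r : Reg → ℕ) (upd : Reg → Reg × Bool) (i : Reg) : ℕ := r (upd i).1 + (upd i).2.toNat

/-- The order of the register contents. -/
def order (r : Reg → ℕ) (i j : Reg) : Bool := decide (r i < r j)

/-- One step of a register machine. -/
def sysStep (w : List Bool) (c : R.Config) : Bool ⊕ R.Config :=
  match R.transition c.state (OfflineTM.readInput w c.pos) (order c.reg) with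
  | .inl b => .inl b
  | .inr (q, d, upd) =>
    .inr ⟨q, min (OfflineTM.moveHead d c.pos) (w.length + 1), assign c.reg upd⟩

/-- The symbols of the work tape: blank, a state (in cell `0`), or one bit for every register. -/
abbrev TapeSymbol := Option (R.State ⊕ (Reg → Bool))

/-- The states of the Turing machine: the start, the states at cell `0` between two steps of the
register machine, and those of the sweeps to the right and back. -/
inductive TMState where
  | boot
  | home (q : R.State) (lt : Reg → Reg → Bool)
  | sweep (q : R.State) (upd : Reg → Reg × Bool) (carry : Reg → Bool) (lt : Reg → Reg → Bool)
  | back (q : R.State) (lt : Reg → Reg → Bool)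

theorem finite_tmState [Finite Reg] [Finite R.State] : Finite R.TMState := by
  let f : R.TMState → Option (R.State × (Reg → Reg → Bool)) ⊕
      ((R.State × (Reg → Reg × Bool) × (Reg → Bool) × (Reg → Reg → Bool)) ⊕
        (R.State × (Reg → Reg → Bool))) := fun s =>
    match s with
    | .boot => .inl none
    | .home q lt => .inl (some (q, lt))
    | .sweep q upd carry lt => .inr (.inl (q, upd, carry, lt))
    | .back q lt => .inr (.inr (q, lt))
  refine Finite.of_injective f ?_
  intro a b h
  cases a <;> cases b <;> simp_all [f]

/-- The new bits of the registers in a cell. -/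
def newBits (upd : Reg → Reg × Bool) (carry v : Reg → Bool) (i : Reg) : Bool :=
  xor (v (upd i).1) (carry i)

/-- The new carries. -/
def newCarry (upd : Reg → Reg × Bool) (carry v : Reg → Bool) (i : Reg) : Bool :=
  v (upd i).1 && carry i

/-- The comparison of the registers after one more bit. -/
def newOrder (lt : Reg → Reg → Bool) (v : Reg → Bool) (i j : Reg) : Bool :=
  if v i = v j then lt i j else v j

open Classical in
/-- The transition function of the Turing machine simulating `R`. -/
noncomputable def tmTransition (s : R.TMState) (x : InputSymbol) (a : R.TapeSymbol) :
    Bool ⊕ (R.TMState × HeadMove × (R.TapeSymbol × HeadMove)) :=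
  match s with
  | .boot => .inr (.home R.start (fun _ _ => false), .stay, some (.inl R.start), .stay)
  | .home q lt =>
    match R.transition q x lt with
    | .inl b => .inl b
    | .inr (q', d, upd) =>
      .inr (.sweep q' upd (fun i => (upd i).2) (fun _ _ => false), d, some (.inl q'), .right)
  | .sweep q upd carry lt =>
    match a with
    | some (.inr v) =>
      .inr (.sweep q upd (newCarry upd carry v) (newOrder lt (newBits upd carry v)), .stay,
        some (.inr (newBits upd carry v)), .right)
    | _ =>
      if ∃ i, carry i = true then
        .inr (.sweep q upd (newCarry upd carry fun _ => false)
          (newOrder lt (newBits upd carry fun _ => false)), .stay,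
          some (.inr (newBits upd carry fun _ => false)), .right)
      else .inr (.back q lt, .stay, a, .left)
  | .back q lt =>
    match a with
    | some (.inl _) => .inr (.home q lt, .stay, a, .stay)
    | _ => .inr (.back q lt, .stay, a, .left)

/-- The Turing machine simulating `R`, with one work tape. -/
noncomputable def toTM [Finite Reg] [Finite R.State] : OfflineTM where
  tapes := 1
  State := R.TMState
  Symbol := R.TapeSymbol
  finite_state := R.finite_tmState
  finite_symbol := inferInstance
  start := .boot
  blank := none
  transition s x a :=
    (R.tmTransition s x (a 0)).map id fun y => (y.1, y.2.1, fun _ => y.2.2)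

/-- The bit of register `i` in a cell. -/
def symbolBit (a : R.TapeSymbol) (i : Reg) : Bool :=
  match a with
  | some (.inr v) => v i
  | _ => false

open Classical in
/-- The number written on the track of register `i`. -/
noncomputable def track (τ : ℕ → R.TapeSymbol) (i : Reg) : ℕ :=
  if h : ∃ v : ℕ, ∀ j, R.symbolBit (τ (j + 1)) i = v.testBit j then h.choose else 0

/-- The state written in cell `0`. -/
def shownState (a : R.TapeSymbol) : R.State :=
  match a with
  | some (.inl q) => q
  | _ => R.start

/-- What the work tape displays, if `D` is what the states and registers of `R` display. -/
noncomputable def tapeDec {μ : Type*} (D : R.State → (Reg → ℕ) → μ) (τ : ℕ → R.TapeSymbol) : μ :=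
  D (R.shownState (τ 0)) (R.track τ)

/-! ### Tracks and binary arithmetic from the lowest bit upwards -/

variable {R}

theorem track_eq {τ : ℕ → R.TapeSymbol} {i : Reg} {v : ℕ}
    (h : ∀ j, R.symbolBit (τ (j + 1)) i = v.testBit j) : R.track τ i = v := by
  have hex : ∃ v : ℕ, ∀ j, R.symbolBit (τ (j + 1)) i = v.testBit j := ⟨v, h⟩
  unfold track
  rw [dif_pos hex]
  exact Nat.eq_of_testBit_eq fun j => (hex.choose_spec j).symm.trans (h j)

/-- Cells `1, …, ℓ` of the tape hold the low bits of `r` up to position `k` and of `r₀` from there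
on. -/
structure TapeInv (q : R.State) (r r₀ : Reg → ℕ) (k ℓ : ℕ) (τ : ℕ → R.TapeSymbol) : Prop where
  zero : τ 0 = some (.inl q)
  low : ∀ j < k, τ (j + 1) = some (.inr fun i => (r i).testBit j)
  high : ∀ j, k ≤ j → j < ℓ → τ (j + 1) = some (.inr fun i => (r₀ i).testBit j)
  blank : ∀ j, ℓ ≤ j → τ (j + 1) = none
  lt : ∀ i, r₀ i < 2 ^ ℓ

/-- In the middle of a sweep the track of a changing register mixes new and old bits. The display
remains steady because it reads only the registers in `keep q`, for which the new and the old
contents agree. -/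
theorem TapeInv.dec_eq {μ : Type*} {D : R.State → (Reg → ℕ) → μ} {keep : R.State → Set Reg}
    (hD : ∀ q r r', (∀ i ∈ keep q, r i = r' i) → D q r = D q r')
    {q : R.State} {r r₀ : Reg → ℕ} {k ℓ : ℕ} {τ : ℕ → R.TapeSymbol}
    (h : TapeInv q r r₀ k ℓ τ) (hr : ∀ i ∈ keep q, r i = r₀ i) :
    R.tapeDec D τ = D q r := by
  have hq : R.shownState (τ 0) = q := by rw [h.zero]; rfl
  unfold tapeDec
  rw [hq]
  refine hD q _ _ fun i hi => track_eq fun j => ?_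
  rcases Nat.lt_or_ge j k with hjk | hjk
  · rw [h.low j hjk]; rfl
  rcases Nat.lt_or_ge j ℓ with hjl | hjl
  · rw [h.high j hjk hjl, hr i hi]; rfl
  · rw [h.blank j hjl, hr i hi]
    have : r₀ i < 2 ^ j := (h.lt i).trans_le (Nat.pow_le_pow_right (by norm_num) hjl)
    exact (Nat.testBit_lt_two_pow this).symm

/-- Binary addition of a carry: the hypothesis says that above position `k` only the carry `c`
remains to be added, and the conclusion gives the next bit and the next carry. -/
theorem testBit_of_div {a a' k : ℕ} {c : Bool} (h : a' / 2 ^ k = a / 2 ^ k + c.toNat) :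
    a'.testBit k = xor (a.testBit k) c ∧
      a' / 2 ^ (k + 1) = a / 2 ^ (k + 1) + (a.testBit k && c).toNat := by
  simp only [Nat.testBit_eq_decide_div_mod_eq, pow_succ, ← Nat.div_div_eq_div_mul]
  rw [h]
  generalize a / 2 ^ k = A
  rcases Nat.mod_two_eq_zero_or_one A with h' | h' <;> cases c <;>
    simp [h'] <;> omega

theorem mod_two_pow_succ (a k : ℕ) :
    a % 2 ^ (k + 1) = a % 2 ^ k + 2 ^ k * (a.testBit k).toNat := by
  rw [pow_succ, Nat.mod_mul, Nat.testBit_eq_decide_div_mod_eq]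
  rcases Nat.mod_two_eq_zero_or_one (a / 2 ^ k) with h | h <;> simp [h]

/-- When numbers are compared from the lowest bit upwards, the newest bit is the most significant
and overrides the earlier comparison unless the two bits agree. -/
theorem mod_pow_succ_lt {a b k : ℕ} :
    decide (a % 2 ^ (k + 1) < b % 2 ^ (k + 1)) =
      if a.testBit k = b.testBit k then decide (a % 2 ^ k < b % 2 ^ k) else b.testBit k := by
  have h1 := mod_two_pow_succ a k
  have h2 := mod_two_pow_succ b k
  have h3 := Nat.mod_lt a (Nat.two_pow_pos k)
  have h4 := Nat.mod_lt b (Nat.two_pow_pos k)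
  rw [h1, h2]
  cases a.testBit k <;> cases b.testBit k <;> simp <;> omega

variable (R)

/-! ### Simulation of a register machine by a Turing machine -/

section Simulation

variable [Finite Reg] [Finite R.State]

/-- A configuration of the simulating machine. -/
def tmConfig (s : R.TMState) (p : ℕ) (τ : ℕ → R.TapeSymbol) (h : ℕ) : R.toTM.Config :=
  ⟨s, p, fun _ => τ, fun _ => h⟩

variable {R}

theorem sysStep_inr {w : List Bool} {s s' : R.TMState} {p : ℕ} {τ : ℕ → R.TapeSymbol} {h : ℕ}
    {d d' : HeadMove} {a : R.TapeSymbol}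
    (ht : R.tmTransition s (OfflineTM.readInput w p) (τ h) = .inr (s', d, a, d')) :
    R.toTM.sysStep w (R.tmConfig s p τ h) =
      .inr (R.tmConfig s' (min (OfflineTM.moveHead d p) (w.length + 1))
        (Function.update τ h a) (OfflineTM.moveHead d' h)) := by
  have hact : R.toTM.action w (R.tmConfig s p τ h) = .inr (s', d, fun _ => (a, d')) := by
    show (R.tmTransition s (OfflineTM.readInput w p) (τ h)).map id
      (fun y => (y.1, y.2.1, fun _ => y.2.2)) = _
    rw [ht]; rfl
  unfold OfflineTM.sysStep OfflineTM.next
  rw [hact]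
  rfl

theorem sysStep_inl {w : List Bool} {s : R.TMState} {p : ℕ} {τ : ℕ → R.TapeSymbol} {h : ℕ}
    {b : Bool} (ht : R.tmTransition s (OfflineTM.readInput w p) (τ h) = .inl b) :
    R.toTM.sysStep w (R.tmConfig s p τ h) = .inl b := by
  have hact : R.toTM.action w (R.tmConfig s p τ h) = .inl b := by
    show (R.tmTransition s (OfflineTM.readInput w p) (τ h)).map id
      (fun y => (y.1, y.2.1, fun _ => y.2.2)) = _
    rw [ht]; rfl
  unfold OfflineTM.sysStep
  rw [hact]

/-- What the work tape of a configuration displays. -/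
noncomputable def tmDec {μ : Type*} (R : RegMachine Reg) [Finite R.State]
    (D : R.State → (Reg → ℕ) → μ) (d : R.toTM.Config) : μ :=
  R.tapeDec D (d.work (0 : Fin 1))

/-- The head of the work tape is to the left of cell `s`. -/
def tmOk (R : RegMachine Reg) [Finite R.State] (s : ℕ) (d : R.toTM.Config) : Prop :=
  d.head (0 : Fin 1) < s

section Sweep

variable {μ : Type*} {D : R.State → (Reg → ℕ) → μ} {keep : R.State → Set Reg} {w : List Bool}
  {s bound : ℕ}

/-- The configuration of the simulating machine that corresponds to `c`. -/
def IsHome (bound : ℕ) (c : R.Config) (d : R.toTM.Config) : Prop :=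
  ∃ (τ : ℕ → R.TapeSymbol) (ℓ : ℕ), d = R.tmConfig (.home c.state (order c.reg)) c.pos τ 0 ∧
    TapeInv c.state c.reg c.reg ℓ ℓ τ ∧ 2 ^ ℓ ≤ 2 * bound + 1

theorem produces_back (hD : ∀ q r r', (∀ i ∈ keep q, r i = r' i) → D q r = D q r')
    (hs : ∀ ℓ, 2 ^ ℓ ≤ 2 * bound + 1 → ℓ + 2 ≤ s) {c : R.Config} {l : List μ} {b : Bool}
    (hpos : c.pos ≤ w.length + 1)
    {τ : ℕ → R.TapeSymbol} {ℓ : ℕ} (hτ : TapeInv c.state c.reg c.reg ℓ ℓ τ)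
    (hℓ : 2 ^ ℓ ≤ 2 * bound + 1)
    (hp : ∀ d, IsHome bound c d → Produces (R.toTM.sysStep w) (R.tmDec D) (R.tmOk s) d (D c.state c.reg :: l) b) (k : ℕ) (hk : k ≤ ℓ) :
    Produces (R.toTM.sysStep w) (R.tmDec D) (R.tmOk s) (R.tmConfig (.back c.state (order c.reg)) c.pos τ k)
      (D c.state c.reg :: l) b := by
  have hsℓ := hs ℓ hℓ
  have hdec : R.tapeDec D τ = D c.state c.reg := hτ.dec_eq hD (fun _ _ => rfl)
  have hmin : min c.pos (w.length + 1) = c.pos := min_eq_left hpos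
  induction k with
  | zero =>
    refine Produces.stay' (c' := R.tmConfig (.home c.state (order c.reg)) c.pos τ 0) ?_ ?_ hdec
      (hp _ ⟨τ, ℓ, rfl, hτ, hℓ⟩)
    · have ht : R.tmTransition (.back c.state (order c.reg)) (OfflineTM.readInput w c.pos) (τ 0) =
          .inr (.home c.state (order c.reg), .stay, τ 0, .stay) := by
        rw [hτ.zero]; rfl
      rw [sysStep_inr ht, Function.update_eq_self]
      simp only [OfflineTM.moveHead, hmin]
    · show 0 < s; omega
  | succ k ih =>
    refine Produces.stay' (c' := R.tmConfig (.back c.state (order c.reg)) c.pos τ k) ?_ ?_ hdec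
      (ih (by omega))
    · have ht : R.tmTransition (.back c.state (order c.reg)) (OfflineTM.readInput w c.pos)
          (τ (k + 1)) = .inr (.back c.state (order c.reg), .stay, τ (k + 1), .left) := by
        rw [hτ.low k (by omega)]; rfl
      rw [sysStep_inr ht, Function.update_eq_self]
      simp only [OfflineTM.moveHead, hmin, Nat.add_sub_cancel]
    · show k + 1 < s; omega

/-- One pass to the right performs the assignment and the comparison of the new contents
simultaneously. Before cell `k + 1` the bits below `k` are new, those above are old, `carry` is what
remains to be added and `lt` compares the parts already written. Afterwards the head goes back to
cell `0`. -/
theorem produces_sweep (hD : ∀ q r r', (∀ i ∈ keep q, r i = r' i) → D q r = D q r')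
    (hs : ∀ ℓ, 2 ^ ℓ ≤ 2 * bound + 1 → ℓ + 2 ≤ s) {c : R.Config} {l : List μ} {b : Bool}
    (hpos : c.pos ≤ w.length + 1) (hbound : ∀ i, c.reg i ≤ bound)
    {r₀ : Reg → ℕ} {upd : Reg → Reg × Bool} (hc : c.reg = assign r₀ upd)
    (hkeep : ∀ i ∈ keep c.state, upd i = (i, false))
    (hp : ∀ d, IsHome bound c d → Produces (R.toTM.sysStep w) (R.tmDec D) (R.tmOk s) d (D c.state c.reg :: l) b)
    {ℓ : ℕ} (hℓ : 2 ^ ℓ ≤ 2 * bound + 1) :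
    ∀ (e k : ℕ) (τ : ℕ → R.TapeSymbol) (carry : Reg → Bool) (lt : Reg → Reg → Bool), k + e = ℓ →
    TapeInv c.state c.reg r₀ k ℓ τ →
    (∀ i, c.reg i / 2 ^ k = r₀ (upd i).1 / 2 ^ k + (carry i).toNat) →
    (∀ i j, lt i j = decide (c.reg i % 2 ^ k < c.reg j % 2 ^ k)) →
    Produces (R.toTM.sysStep w) (R.tmDec D) (R.tmOk s) (R.tmConfig (.sweep c.state upd carry lt) c.pos τ (k + 1))
      (D c.state c.reg :: l) b := by
  have hsℓ := hs ℓ hℓ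
  have hmin : min c.pos (w.length + 1) = c.pos := min_eq_left hpos
  have hkr : ∀ i ∈ keep c.state, c.reg i = r₀ i := fun i hi => by
    rw [hc]; simp [assign, hkeep i hi]
  -- the end of the sweep
  have fin : ∀ (ℓ' : ℕ) (τ : ℕ → R.TapeSymbol) (carry : Reg → Bool) (lt : Reg → Reg → Bool),
      ℓ ≤ ℓ' → 2 ^ ℓ' ≤ 2 * bound + 1 → (∀ i, carry i = false) → TapeInv c.state c.reg r₀ ℓ' ℓ' τ →
      (∀ i, r₀ i < 2 ^ ℓ) →
      (∀ i, c.reg i / 2 ^ ℓ' = r₀ (upd i).1 / 2 ^ ℓ' + (carry i).toNat) →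
      (∀ i j, lt i j = decide (c.reg i % 2 ^ ℓ' < c.reg j % 2 ^ ℓ')) →
      Produces (R.toTM.sysStep w) (R.tmDec D) (R.tmOk s) (R.tmConfig (.sweep c.state upd carry lt) c.pos τ (ℓ' + 1))
        (D c.state c.reg :: l) b := by
    intro ℓ' τ carry lt hle hℓ' hcarry hτ hlt₀ hdiv hlt
    have hsℓ' := hs ℓ' hℓ'
    have hr : ∀ i, c.reg i < 2 ^ ℓ' := by
      intro i
      have h1 : r₀ (upd i).1 / 2 ^ ℓ' = 0 := Nat.div_eq_of_lt (hτ.lt _)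
      have h2 := hdiv i
      rw [h1, hcarry i] at h2
      have h2 : c.reg i / 2 ^ ℓ' = 0 := h2
      by_contra hge
      exact absurd (Nat.div_pos (not_lt.1 hge) (Nat.two_pow_pos ℓ')) (by omega)
    have hlt' : lt = order c.reg := by
      funext i j
      rw [hlt, Nat.mod_eq_of_lt (hr i), Nat.mod_eq_of_lt (hr j)]; rfl
    have hτ' : TapeInv c.state c.reg c.reg ℓ' ℓ' τ :=
      ⟨hτ.zero, hτ.low, fun j h1 h2 => absurd h1 (by omega), hτ.blank, hr⟩
    refine Produces.stay' (c' := R.tmConfig (.back c.state (order c.reg)) c.pos τ ℓ') ?_ ?_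
      (hτ.dec_eq hD hkr) (produces_back hD hs hpos hτ' hℓ' hp ℓ' le_rfl)
    · have ht : R.tmTransition (.sweep c.state upd carry lt) (OfflineTM.readInput w c.pos)
          (τ (ℓ' + 1)) = .inr (.back c.state (order c.reg), .stay, τ (ℓ' + 1), .left) := by
        rw [hτ.blank ℓ' le_rfl, hlt']
        exact if_neg (by simp [hcarry])
      rw [sysStep_inr ht, Function.update_eq_self]
      simp only [OfflineTM.moveHead, hmin, Nat.add_sub_cancel]
    · show ℓ' + 1 < s; omega
  -- one cell of the sweep
  have cell : ∀ (k : ℕ) (carry : Reg → Bool) (lt : Reg → Reg → Bool) (v : Reg → Bool),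
      (∀ i, v i = (r₀ i).testBit k) →
      (∀ i, c.reg i / 2 ^ k = r₀ (upd i).1 / 2 ^ k + (carry i).toNat) →
      (∀ i j, lt i j = decide (c.reg i % 2 ^ k < c.reg j % 2 ^ k)) →
      (newBits upd carry v = fun i => (c.reg i).testBit k) ∧
      (∀ i, c.reg i / 2 ^ (k + 1) =
        r₀ (upd i).1 / 2 ^ (k + 1) + (newCarry upd carry v i).toNat) ∧
      (∀ i j, newOrder lt (newBits upd carry v) i j =
        decide (c.reg i % 2 ^ (k + 1) < c.reg j % 2 ^ (k + 1))) := by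
    intro k carry lt v hv hdiv hlt
    have hb : newBits upd carry v = fun i => (c.reg i).testBit k := by
      funext i
      rw [(testBit_of_div (hdiv i)).1, ← hv]; rfl
    refine ⟨hb, fun i => ?_, fun i j => ?_⟩
    · rw [(testBit_of_div (hdiv i)).2, ← hv]; rfl
    · rw [hb, mod_pow_succ_lt]
      simp only [newOrder, hlt]
  have upd_inv : ∀ (k ℓ' : ℕ) (τ : ℕ → R.TapeSymbol), TapeInv c.state c.reg r₀ k ℓ τ →
      ℓ' = max ℓ (k + 1) → k ≤ ℓ →
      TapeInv c.state c.reg r₀ (k + 1) ℓ' (Function.update τ (k + 1)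
        (some (.inr fun i => (c.reg i).testBit k))) := by
    intro k ℓ' τ hτ hℓ' hk
    refine ⟨?_, fun j hj => ?_, fun j h1 h2 => ?_, fun j hj => ?_, fun i => ?_⟩
    · rw [Function.update_of_ne (by omega)]; exact hτ.zero
    · by_cases hjk : j = k
      · subst hjk; rw [Function.update_self]
      · rw [Function.update_of_ne (by omega)]; exact hτ.low j (by omega)
    · rw [Function.update_of_ne (by omega)]; exact hτ.high j (by omega) (by omega)
    · rw [Function.update_of_ne (by omega)]; exact hτ.blank j (by omega)
    · exact (hτ.lt i).trans_le (Nat.pow_le_pow_right (by norm_num) (by omega))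
  intro e
  induction e with
  | zero =>
    intro k τ carry lt hk hτ hdiv hlt
    rw [Nat.add_zero] at hk
    subst hk
    by_cases hcarry : ∃ i, carry i = true
    · obtain ⟨hb, hdiv', hlt'⟩ := cell k carry lt (fun _ => false)
        (fun i => (Nat.testBit_lt_two_pow (hτ.lt i)).symm) hdiv hlt
      -- A carry beyond the last cell means that some new content is at least `2 ^ k`, hence `2 ^ k
      -- ≤ bound`. So the written part grows only as far as the contents require. The summand `1` in
      -- the bound serves the empty tape with `bound = 0`.
      have hℓ' : 2 ^ (k + 1) ≤ 2 * bound + 1 := by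
        obtain ⟨i, hi⟩ := hcarry
        have h1 := hdiv i
        rw [hi] at h1
        have h2 : 1 ≤ c.reg i / 2 ^ k := by rw [h1]; exact Nat.le_add_left _ _
        have h3 := (Nat.le_div_iff_mul_le (Nat.two_pow_pos k)).1 h2
        have h4 := hbound i
        rw [pow_succ]; omega
      refine Produces.stay' (c' := R.tmConfig (.sweep c.state upd
        (newCarry upd carry fun _ => false) (newOrder lt (newBits upd carry fun _ => false)))
        c.pos (Function.update τ (k + 1) (some (.inr fun i => (c.reg i).testBit k))) (k + 1 + 1))
        ?_ ?_ (hτ.dec_eq hD hkr)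
        (fin (k + 1) _ _ _ (Nat.le_succ k) hℓ' (fun i => by simp [newCarry])
          (upd_inv k _ τ hτ (by omega) le_rfl) hτ.lt hdiv' hlt')
      · have ht : R.tmTransition (.sweep c.state upd carry lt) (OfflineTM.readInput w c.pos)
            (τ (k + 1)) = .inr (.sweep c.state upd (newCarry upd carry fun _ => false)
              (newOrder lt (newBits upd carry fun _ => false)), .stay,
              some (.inr fun i => (c.reg i).testBit k), .right) := by
          rw [hτ.blank k le_rfl, ← hb]
          exact if_pos hcarry
        rw [sysStep_inr ht]
        simp only [OfflineTM.moveHead, hmin]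
      · show k + 1 < s; omega
    · push Not at hcarry
      exact fin k τ carry lt le_rfl hℓ (fun i => by simpa using hcarry i) hτ hτ.lt hdiv hlt
  | succ e ih =>
    intro k τ carry lt hk hτ hdiv hlt
    obtain ⟨hb, hdiv', hlt'⟩ := cell k carry lt (fun i => (r₀ i).testBit k)
      (fun i => rfl) hdiv hlt
    refine Produces.stay' (c' := R.tmConfig (.sweep c.state upd
      (newCarry upd carry fun i => (r₀ i).testBit k)
      (newOrder lt (newBits upd carry fun i => (r₀ i).testBit k)))
      c.pos (Function.update τ (k + 1) (some (.inr fun i => (c.reg i).testBit k))) (k + 1 + 1))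
      ?_ ?_ (hτ.dec_eq hD hkr)
      (ih (k + 1) _ _ _ (by omega) (upd_inv k _ τ hτ (by omega) (by omega)) hdiv' hlt')
    · have ht : R.tmTransition (.sweep c.state upd carry lt) (OfflineTM.readInput w c.pos)
          (τ (k + 1)) = .inr (.sweep c.state upd (newCarry upd carry fun i => (r₀ i).testBit k)
            (newOrder lt (newBits upd carry fun i => (r₀ i).testBit k)), .stay,
            some (.inr fun i => (c.reg i).testBit k), .right) := by
        rw [hτ.high k le_rfl (by omega), ← hb]
        rfl
      rw [sysStep_inr ht]
      simp only [OfflineTM.moveHead, hmin]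
    · show k + 1 < s; omega

/-- The Turing machine follows the register machine, displaying the same data. -/
theorem produces_home (hD : ∀ q r r', (∀ i ∈ keep q, r i = r' i) → D q r = D q r')
    (hs : ∀ ℓ, 2 ^ ℓ ≤ 2 * bound + 1 → ℓ + 2 ≤ s)
    (hkeep : ∀ q x lt q' d upd, R.transition q x lt = .inr (q', d, upd) →
      ∀ i ∈ keep q', upd i = (i, false))
    {c : R.Config} {l : List μ} {b : Bool}
    (h : Produces (R.sysStep w) (fun c => D c.state c.reg) (fun c => ∀ i, c.reg i ≤ bound) c l b) :
    ∀ d, IsHome bound c d → Produces (R.toTM.sysStep w) (R.tmDec D) (R.tmOk s) d l b := by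
  have hdec : ∀ {c : R.Config} {d : R.toTM.Config}, IsHome bound c d →
      R.tmDec D d = D c.state c.reg := by
    rintro c d ⟨τ, ℓ, rfl, hτ, hℓ⟩
    exact hτ.dec_eq hD (fun _ _ => rfl)
  have hok : ∀ {c : R.Config} {d : R.toTM.Config}, IsHome bound c d → R.tmOk s d := by
    rintro c d ⟨τ, ℓ, rfl, hτ, hℓ⟩
    have := hs ℓ hℓ
    show 0 < s; omega
  have hstep : ∀ {c c' : R.Config} {l : List μ} {b : Bool}, R.sysStep w c = .inr c' →
      (∀ i, c'.reg i ≤ bound) →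
      (∀ d, IsHome bound c' d → Produces (R.toTM.sysStep w) (R.tmDec D) (R.tmOk s) d (D c'.state c'.reg :: l) b) →
      ∀ d, IsHome bound c d → ∃ d', R.toTM.sysStep w d = .inr d' ∧
        Produces (R.toTM.sysStep w) (R.tmDec D) (R.tmOk s) d' (D c'.state c'.reg :: l) b := by
    rintro c c' l b hstep hb hp d ⟨τ, ℓ, rfl, hτ, hℓ⟩
    unfold sysStep at hstep
    cases ha : R.transition c.state (OfflineTM.readInput w c.pos) (order c.reg) with
    | inl b => rw [ha] at hstep; cases hstep
    | inr x =>
      obtain ⟨q', dir, upd⟩ := x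
      rw [ha] at hstep
      have hc' := (Sum.inr_injective hstep).symm
      have ht : R.tmTransition (.home c.state (order c.reg)) (OfflineTM.readInput w c.pos) (τ 0) =
          .inr (.sweep q' upd (fun i => (upd i).2) (fun _ _ => false), dir, some (.inl q'),
            .right) := by
        simp only [tmTransition, ha]
      refine ⟨_, sysStep_inr ht, ?_⟩
      -- The new state is written into cell `0` at once, so the display changes in this very step
      -- and not during the sweep.
      have hτ' : TapeInv q' c'.reg c.reg 0 ℓ (Function.update τ 0 (some (.inl q'))) := by
        refine ⟨Function.update_self _ _ _, fun j hj => absurd hj (by omega), fun j _ hj => ?_,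
          fun j hj => ?_, hτ.lt⟩
        · rw [Function.update_of_ne (by omega)]; exact hτ.low j hj
        · rw [Function.update_of_ne (by omega)]; exact hτ.blank j hj
      subst hc'
      exact produces_sweep (c := ⟨q', _, _⟩) hD hs (min_le_right _ _) hb rfl
        (hkeep _ _ _ _ _ _ ha) hp hℓ ℓ 0 _ _ _ (Nat.zero_add _) hτ'
        (fun i => by simp [assign]) (fun i j => by simp [Nat.mod_one])
  induction h with
  | halt c b h hb =>
    intro d hd
    have := Produces.halt (dec := R.tmDec D) (ok := R.tmOk s) (step := R.toTM.sysStep w) d b ?_ (hok hd)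
    · simpa only [hdec hd] using this
    · obtain ⟨τ, ℓ, rfl, hτ, hℓ⟩ := hd
      refine sysStep_inl ?_
      unfold sysStep at h
      cases ha : R.transition c.state (OfflineTM.readInput w c.pos) (order c.reg) with
      | inl b' =>
        rw [ha] at h
        simp only [tmTransition, ha]
        exact congrArg _ (Sum.inl_injective h)
      | inr x => rw [ha] at h; cases h
  | stay c c' l b h hb hp ih =>
    intro d hd
    obtain ⟨l', hl'⟩ := hp.exists_cons
    have hb' : ∀ i, c'.reg i ≤ bound := hp.ok_start
    obtain ⟨d', hd', hp'⟩ := hstep h hb' (l := l') (b := b) (by rw [← hl']; exact ih) d hd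
    rw [← hl'] at hp'
    exact Produces.stay' hd' (hok hd) (hdec hd) hp'
  | move c c' l b h hb hp ih =>
    intro d hd
    obtain ⟨l', hl'⟩ := hp.exists_cons
    have hb' : ∀ i, c'.reg i ≤ bound := hp.ok_start
    obtain ⟨d', hd', hp'⟩ := hstep h hb' (l := l') (b := b) (by rw [← hl']; exact ih) d hd
    rw [← hl'] at hp'
    have := Produces.move (dec := R.tmDec D) (ok := R.tmOk s) (step := R.toTM.sysStep w) d d' _ b hd' (hok hd) hp'
    simpa only [hdec hd] using this

/-- The run of the Turing machine from its initial configuration. -/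
theorem produces_initial (hD : ∀ q r r', (∀ i ∈ keep q, r i = r' i) → D q r = D q r')
    (hs : ∀ ℓ, 2 ^ ℓ ≤ 2 * bound + 1 → ℓ + 2 ≤ s)
    (hkeep : ∀ q x lt q' d upd, R.transition q x lt = .inr (q', d, upd) →
      ∀ i ∈ keep q', upd i = (i, false))
    {l : List μ} {b : Bool}
    (h : Produces (R.sysStep w) (fun c => D c.state c.reg) (fun c => ∀ i, c.reg i ≤ bound)
      ⟨R.start, 0, fun _ => 0⟩ l b) :
    Produces (R.toTM.sysStep w) (R.tmDec D) (R.tmOk s)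
      (R.toTM.config w 0) l b := by
  have h1 : (1 : ℕ) ≤ 2 * bound + 1 := by omega
  have hs0 := hs 0 h1
  obtain ⟨l', rfl⟩ := h.exists_cons
  have hrun := produces_home hD hs hkeep h
    (R.tmConfig (.home R.start (order fun _ => 0)) 0
      (Function.update (fun _ => none) 0 (some (.inl R.start))) 0)
    ⟨_, 0, rfl, ⟨Function.update_self _ _ _, fun j hj => absurd hj (by omega),
      fun j _ hj => absurd hj (by omega), fun j _ => Function.update_of_ne (by omega) _ _,
      fun _ => by simp⟩, h1⟩
  refine Produces.stay' ?_ ?_ ?_ hrun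
  · have ht : R.tmTransition .boot (OfflineTM.readInput w 0) ((fun _ => none) 0) =
        .inr (.home R.start (order fun _ => 0), .stay, some (.inl R.start), .stay) := by
      simp only [tmTransition]
      congr 3
    exact (sysStep_inr (p := 0) (τ := fun _ => none) (h := 0) ht).trans (by
      simp only [OfflineTM.moveHead, Nat.zero_min])
  · show 0 < s; omega
  -- The blank tape already displays the initial data: an unwritten cell `0` counts as the start
  -- state, and empty tracks are read as `0`.
  · show R.tapeDec D (fun _ => none) = _
    have : R.track (fun _ => none) = fun _ => 0 := by
      funext i
      exact track_eq fun j => by simp [symbolBit]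
    unfold tapeDec
    rw [this]; rfl

end Sweep

end Simulation

end RegMachine

/-! ### Pattern machines -/

/-- A machine with finitely many registers for numbers. The register `size` holds a number `m`; the
input word is read as the rows of a matrix with `m` columns, numbered from `1`. In each step the
machine sees its state, the order of the register contents, the matrix entries at the positions
given by pairs of registers, and whether the word has more than `m` rows. The register `one` holds
the number `1`. -/
structure PatternMachine (Reg : Type) where
  State : Type
  start : State
  size : Reg
  one : Reg
  transition : State → (Reg → Reg → Bool) → (Reg → Reg → Bool) → Bool →
    Bool ⊕ (State × (Reg → Reg × Bool))

namespace PatternMachine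

open RegMachine (assign order)

/-- A configuration of a pattern machine. -/
structure Config {Reg : Type} (P : PatternMachine Reg) where
  state : P.State
  reg : Reg → ℕ

variable {Reg : Type}

open Classical in
/-- The entries of the matrix, as far as they are among the first `k` bits of the word. -/
noncomputable def entries (w : List Bool) (m : ℕ) (r : Reg → ℕ) (k : ℕ) (i j : Reg) : Bool :=
  decide (∃ p < k, w[p]? = some true ∧ r i = p / m + 1 ∧ r j = p % m + 1)

open Classical in
/-- Whether one of the first `k` bits of the word is below row `m`. -/
noncomputable def overflow (m k : ℕ) : Bool := decide (∃ p < k, m < p / m + 1)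

variable (P : PatternMachine Reg)

/-- One step of a pattern machine. -/
noncomputable def sysStep (w : List Bool) (c : P.Config) : Bool ⊕ P.Config :=
  (P.transition c.state (order c.reg) (entries w (c.reg P.size) c.reg w.length)
    (overflow (c.reg P.size) w.length)).map id fun y => ⟨y.1, assign c.reg y.2⟩

/-- The states of the register machine simulating `P`. -/
inductive ScanState where
  | boot
  | scan (q : P.State) (A : Reg → Reg → Bool) (ov : Bool)
  | rewind (q : P.State) (A : Reg → Reg → Bool) (ov : Bool)

theorem finite_scanState [Finite Reg] [Finite P.State] : Finite P.ScanState := by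
  let f : P.ScanState → Option (P.State × (Reg → Reg → Bool) × Bool) ⊕
      (P.State × (Reg → Reg → Bool) × Bool) := fun s =>
    match s with
    | .boot => .inl none
    | .scan q A o => .inl (some (q, A, o))
    | .rewind q A o => .inr (q, A, o)
  refine Finite.of_injective f ?_
  intro a b h
  cases a <;> cases b <;> simp_all [f]

/-- Equality of two registers, told from their order. -/
def same {R : Type} (lt : R → R → Bool) (i j : R) : Bool := !lt i j && !lt j i

theorem same_order {R : Type} (r : R → ℕ) (i j : R) : same (order r) i j = decide (r i = r j) := by
  unfold same order
  rcases lt_trichotomy (r i) (r j) with h | h | h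
  · simp [h, h.ne]
  · simp [h]
  · simp [h, h.ne']

/-- The assignment that changes nothing in the registers of `P` and sets the row and the column. -/
def scanUpd (P : PatternMachine Reg) (lt : Reg ⊕ Bool → Reg ⊕ Bool → Bool) :
    Reg ⊕ Bool → (Reg ⊕ Bool) × Bool
  | .inl i => (.inl i, false)
  | .inr false => (.inr false, same lt (.inr true) (.inl P.size))
  | .inr true => if same lt (.inr true) (.inl P.size) then (.inl P.one, false) else (.inr true, true)

open Classical in
/-- The simulating register machine. Its additional registers hold the row and the column of the
position of the input head. -/
noncomputable def toRegMachine : RegMachine (Reg ⊕ Bool) where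
  State := P.ScanState
  start := .boot
  transition s x lt :=
    match s with
    | .boot => .inr (.scan P.start (fun _ _ => false) false, .stay, fun i =>
        match i with
        | .inl i => (.inl i, decide (i = P.one))
        | .inr b => (.inr b, true))
    | .scan q A ov =>
      match x with
      | .leftEnd => .inr (.scan q A ov, .right, fun i => (i, false))
      | .bit b => .inr (.scan q
          (fun i j => A i j || (b && same lt (.inl i) (.inr false) && same lt (.inl j) (.inr true)))
          (ov || lt (.inl P.size) (.inr false)), .right, P.scanUpd lt)
      | .rightEnd => .inr (.rewind q A ov, .left, fun i => (i, false))
    | .rewind q A ov =>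
      match x with
      | .leftEnd => (P.transition q (fun i j => lt (.inl i) (.inl j)) A ov).map id fun y =>
          (.scan y.1 (fun _ _ => false) false, .stay, fun i =>
            match i with
            | .inl i => (.inl (y.2 i).1, (y.2 i).2)
            | .inr _ => (.inl P.one, false))
      | _ => .inr (.rewind q A ov, .left, fun i => (i, false))

/-- The state of `P` that is simulated. -/
def ScanState.toState {P : PatternMachine Reg} : P.ScanState → P.State
  | .boot => P.start
  | .scan q _ _ => q
  | .rewind q _ _ => q

/-- The registers of the simulating machine. -/
def withScan (r : Reg → ℕ) (row col : ℕ) : Reg ⊕ Bool → ℕ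
  | .inl i => r i
  | .inr false => row
  | .inr true => col

variable {P}

/-- Apart from the updates made by `P` itself, only the first step changes a register of `P`, when
it turns the register `one` from `0` into `1`. Therefore no display may depend on it. -/
theorem transition_keep {keep : P.State → Set Reg} (hone : ∀ q, P.one ∉ keep q)
    (hkeep : ∀ q lt A ov q' upd, P.transition q lt A ov = .inr (q', upd) →
      ∀ i ∈ keep q', upd i = (i, false)) (s : P.ScanState) (x : InputSymbol)
    (lt : Reg ⊕ Bool → Reg ⊕ Bool → Bool) (s' : P.ScanState) (d : HeadMove)
    (upd : Reg ⊕ Bool → (Reg ⊕ Bool) × Bool)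
    (h : P.toRegMachine.transition s x lt = .inr (s', d, upd)) :
    ∀ i ∈ Sum.inl '' keep s'.toState, upd i = (i, false) := by
  rintro _ ⟨i, hi, rfl⟩
  cases s with
  | boot =>
    simp only [toRegMachine, Sum.inr.injEq, Prod.mk.injEq] at h
    obtain ⟨rfl, -, rfl⟩ := h
    have : i ≠ P.one := by rintro rfl; exact hone _ hi
    simp [this]
  | scan q A ov =>
    cases x <;> simp only [toRegMachine, Sum.inr.injEq, Prod.mk.injEq] at h <;>
      obtain ⟨rfl, -, rfl⟩ := h <;> rfl
  | rewind q A ov =>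
    cases x with
    | leftEnd =>
      simp only [toRegMachine] at h
      cases ht : P.transition q (fun i j => lt (.inl i) (.inl j)) A ov with
      | inl b => rw [ht] at h; cases h
      | inr y =>
        rw [ht] at h
        simp only [Sum.map_inr, Sum.inr.injEq, Prod.mk.injEq] at h
        obtain ⟨rfl, -, rfl⟩ := h
        have := hkeep q _ A ov y.1 y.2 ht i hi
        simp [this]
    | bit b =>
      simp only [toRegMachine, Sum.inr.injEq, Prod.mk.injEq] at h
      obtain ⟨rfl, -, rfl⟩ := h; rfl
    | rightEnd =>
      simp only [toRegMachine, Sum.inr.injEq, Prod.mk.injEq] at h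
      obtain ⟨rfl, -, rfl⟩ := h; rfl

/-- Row and column of the next input position, computed by a comparison and an increment. With the
conventions for division by `0` this also holds for `m = 0`, the value from which the count of the
vertices starts. -/
theorem succ_div_mod (p m : ℕ) :
    (if p % m + 1 = m then p / m + 1 + 1 else p / m + 1) = (p + 1) / m + 1 ∧
    (if p % m + 1 = m then 1 else p % m + 1 + 1) = (p + 1) % m + 1 := by
  have h1 := Nat.div_add_mod p m
  rcases Nat.eq_zero_or_pos m with rfl | hm
  · simp
  have h2 := Nat.mod_lt p hm
  split_ifs with h
  · have h3 : p + 1 = m * (p / m + 1) := by rw [mul_add, mul_one]; omega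
    rw [h3]
    exact ⟨by rw [Nat.mul_div_cancel_left _ hm], by simp⟩
  · have h3 : p + 1 = (p % m + 1) + m * (p / m) := by omega
    have h4 : p % m + 1 < m := by omega
    generalize p % m + 1 = a at *
    generalize p / m = b at *
    rw [h3]
    refine ⟨?_, ?_⟩
    · rw [Nat.add_mul_div_left _ _ hm, Nat.div_eq_of_lt h4, zero_add]
    · rw [Nat.add_mul_mod_self_left, Nat.mod_eq_of_lt h4]

theorem entries_succ (w : List Bool) (m : ℕ) (r : Reg → ℕ) {p : ℕ} {b : Bool} (hb : w[p]? = some b)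
    (i j : Reg) : entries w m r (p + 1) i j =
      (entries w m r p i j || (b && decide (r i = p / m + 1) && decide (r j = p % m + 1))) := by
  unfold entries
  rw [Bool.eq_iff_iff]
  simp only [Bool.or_eq_true, Bool.and_eq_true, decide_eq_true_eq]
  constructor
  · rintro ⟨k, hk, h⟩
    rcases Nat.lt_succ_iff_lt_or_eq.1 hk with hk | rfl
    · exact Or.inl ⟨k, hk, h⟩
    · rw [hb, Option.some.injEq] at h
      exact Or.inr ⟨⟨h.1, h.2.1⟩, h.2.2⟩
  · rintro (⟨k, hk, h⟩ | ⟨⟨rfl, h1⟩, h2⟩)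
    · exact ⟨k, hk.trans (Nat.lt_succ_self p), h⟩
    · exact ⟨p, Nat.lt_succ_self p, hb, h1, h2⟩

theorem overflow_succ (m p : ℕ) :
    overflow m (p + 1) = (overflow m p || decide (m < p / m + 1)) := by
  unfold overflow
  rw [Bool.eq_iff_iff]
  simp only [Bool.or_eq_true, decide_eq_true_eq]
  constructor
  · rintro ⟨k, hk, h⟩
    rcases Nat.lt_succ_iff_lt_or_eq.1 hk with hk | rfl
    · exact Or.inl ⟨k, hk, h⟩
    · exact Or.inr h
  · rintro (⟨k, hk, h⟩ | h)
    · exact ⟨k, hk.trans (Nat.lt_succ_self p), h⟩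
    · exact ⟨p, Nat.lt_succ_self p, h⟩

/-! ### Simulation of a pattern machine by a register machine -/

section Simulation

variable {μ : Type*} {D : P.State → (Reg → ℕ) → μ} {w : List Bool} {bound : ℕ}

/-- The display of the simulating machine. -/
def scanDec (D : P.State → (Reg → ℕ) → μ) (s : P.ScanState) (r : Reg ⊕ Bool → ℕ) : μ :=
  D s.toState fun i => r (.inl i)

theorem readInput_succ_of_lt {p : ℕ} {b : Bool} (h : w[p]? = some b) :
    OfflineTM.readInput w (p + 1) = .bit b := by
  simp [OfflineTM.readInput, h]

theorem readInput_succ_length : OfflineTM.readInput w (w.length + 1) = .rightEnd := by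
  simp [OfflineTM.readInput]

theorem readInput_zero : OfflineTM.readInput w 0 = .leftEnd := rfl

theorem withScan_le {r : Reg → ℕ} {a b : ℕ} (hr : ∀ i, r i ≤ bound) (ha : a ≤ bound)
    (hb : b ≤ bound) : ∀ i, withScan r a b i ≤ bound := by
  rintro (i | _ | _)
  · exact hr i
  · exact ha
  · exact hb

theorem produces_rewind {q : P.State} {r : Reg → ℕ} {a b : ℕ} {A : Reg → Reg → Bool} {ov : Bool}
    {l : List μ} {ans : Bool} (hok : ∀ i, withScan r a b i ≤ bound) (k : ℕ)
    (hk : k ≤ w.length)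
    (hp : Produces (P.toRegMachine.sysStep w) (fun c => scanDec D c.state c.reg)
      (fun c => ∀ i, c.reg i ≤ bound) ⟨.rewind q A ov, 0, withScan r a b⟩ (D q r :: l) ans) :
    Produces (P.toRegMachine.sysStep w) (fun c => scanDec D c.state c.reg)
      (fun c => ∀ i, c.reg i ≤ bound) ⟨.rewind q A ov, k, withScan r a b⟩ (D q r :: l) ans := by
  induction k with
  | zero => exact hp
  | succ k ih =>
    refine Produces.stay' (c' := ⟨.rewind q A ov, k, withScan r a b⟩) ?_ hok rfl (ih (by omega))
    have hkl : k < w.length := by omega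
    have hin : OfflineTM.readInput w (k + 1) = .bit w[k] :=
      readInput_succ_of_lt (by simp [hkl])
    unfold RegMachine.sysStep
    simp only [hin, toRegMachine, OfflineTM.moveHead]
    congr 2
    simp; omega

/-- The finite control gathers the entries at all pairs of registers during one pass, while two
extra registers follow the row and column of the head. Both are at most one more than the length of
the word. -/
theorem produces_scan {q : P.State} {r : Reg → ℕ} (hone : r P.one = 1)
    {l : List μ} {ans : Bool} (hr : ∀ i, r i ≤ bound) (hw : w.length + 1 ≤ bound)
    (hp : ∀ a b, a ≤ bound → b ≤ bound →
      Produces (P.toRegMachine.sysStep w) (fun c => scanDec D c.state c.reg)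
      (fun c => ∀ i, c.reg i ≤ bound) ⟨.rewind q (entries w (r P.size) r w.length)
        (overflow (r P.size) w.length), 0, withScan r a b⟩ (D q r :: l) ans) :
    ∀ (e p : ℕ), p + e = w.length →
    Produces (P.toRegMachine.sysStep w) (fun c => scanDec D c.state c.reg)
      (fun c => ∀ i, c.reg i ≤ bound)
      ⟨.scan q (entries w (r P.size) r p) (overflow (r P.size) p), p + 1,
        withScan r (p / r P.size + 1) (p % r P.size + 1)⟩ (D q r :: l) ans := by
  have hb : ∀ p ≤ w.length, ∀ i, withScan r (p / r P.size + 1) (p % r P.size + 1) i ≤ bound := by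
    intro p hp
    have h1 := Nat.div_le_self p (r P.size)
    have h2 := Nat.mod_le p (r P.size)
    exact withScan_le hr (by omega) (by omega)
  intro e
  induction e with
  | zero =>
    intro p hpe
    rw [Nat.add_zero] at hpe
    subst hpe
    have hbb := hb _ le_rfl
    refine Produces.stay' (c' := ⟨.rewind q (entries w (r P.size) r w.length)
      (overflow (r P.size) w.length), w.length,
      withScan r (w.length / r P.size + 1) (w.length % r P.size + 1)⟩) ?_ hbb rfl
      (produces_rewind hbb _ le_rfl (hp _ _ (hbb (.inr false)) (hbb (.inr true))))
    unfold RegMachine.sysStep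
    simp only [readInput_succ_length, toRegMachine, OfflineTM.moveHead]
    congr 2
    simp
  | succ e ih =>
    intro p hpe
    have hpl : p < w.length := by omega
    have hget : w[p]? = some w[p] := by simp [hpl]
    have hin := readInput_succ_of_lt hget
    refine Produces.stay' ?_ (hb p hpl.le) rfl (ih (p + 1) (by omega))
    have hord : same (order (withScan r (p / r P.size + 1) (p % r P.size + 1))) (.inr true)
        (.inl P.size) = decide (p % r P.size + 1 = r P.size) := by
      rw [same_order]; rfl
    unfold RegMachine.sysStep
    simp only [hin, toRegMachine, OfflineTM.moveHead]
    congr 2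
    · congr 1
      · funext i j
        rw [entries_succ w _ r hget, same_order, same_order]; rfl
      · rw [overflow_succ]; rfl
    · exact min_eq_left (by omega)
    · funext i
      obtain ⟨h1, h2⟩ := succ_div_mod p (r P.size)
      rcases i with i | _ | _
      · rfl
      · rw [← h1]
        simp only [assign, scanUpd, hord, withScan]
        split_ifs with h <;> simp [h]
      · rw [← h2]
        simp only [assign, scanUpd, hord]
        split_ifs with h <;> simp_all [withScan]

theorem exists_transition {c c' : P.Config} (h : P.sysStep w c = .inr c') :
    ∃ upd, P.transition c.state (order c.reg) (entries w (c.reg P.size) c.reg w.length)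
      (overflow (c.reg P.size) w.length) = .inr (c'.state, upd) ∧ c'.reg = assign c.reg upd := by
  unfold sysStep at h
  cases ht : P.transition c.state (order c.reg) (entries w (c.reg P.size) c.reg w.length)
      (overflow (c.reg P.size) w.length) with
  | inl b => rw [ht] at h; cases h
  | inr y =>
    rw [ht] at h
    have := Sum.inr_injective h
    rw [← this]
    exact ⟨y.2, rfl, rfl⟩

/-- The register machine follows the pattern machine, displaying the same data. -/
theorem produces_toRegMachine (hupd : ∀ q lt A ov q' upd,
      P.transition q lt A ov = .inr (q', upd) → upd P.one = (P.one, false))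
    (hw : w.length + 1 ≤ bound) {c : P.Config} {l : List μ} {ans : Bool}
    (h : Produces (P.sysStep w) (fun c => D c.state c.reg) (fun c => ∀ i, c.reg i ≤ bound) c l ans)
    (hone : c.reg P.one = 1) :
    Produces (P.toRegMachine.sysStep w) (fun c => scanDec D c.state c.reg)
      (fun c => ∀ i, c.reg i ≤ bound)
      ⟨.scan c.state (fun _ _ => false) false, 0, withScan c.reg 1 1⟩ l ans := by
  -- the scan before a step
  have hscan : ∀ {c : P.Config} {l : List μ} {ans : Bool}, c.reg P.one = 1 → (∀ i, c.reg i ≤ bound) →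
      (∀ a b, a ≤ bound → b ≤ bound →
        Produces (P.toRegMachine.sysStep w) (fun c => scanDec D c.state c.reg)
        (fun c => ∀ i, c.reg i ≤ bound) ⟨.rewind c.state
          (entries w (c.reg P.size) c.reg w.length) (overflow (c.reg P.size) w.length), 0,
          withScan c.reg a b⟩ (D c.state c.reg :: l) ans) →
      Produces (P.toRegMachine.sysStep w) (fun c => scanDec D c.state c.reg)
        (fun c => ∀ i, c.reg i ≤ bound)
        ⟨.scan c.state (fun _ _ => false) false, 0, withScan c.reg 1 1⟩
        (D c.state c.reg :: l) ans := by
    intro c l ans hone hr hp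
    have h0 := produces_scan hone hr hw hp w.length 0 (Nat.zero_add _)
    have he : entries w (c.reg P.size) c.reg 0 = fun _ _ => false := by
      funext i j; simp [entries]
    have ho : overflow (c.reg P.size) 0 = false := by simp [overflow]
    rw [he, ho, Nat.zero_div, Nat.zero_mod] at h0
    refine Produces.stay' ?_ (withScan_le hr (by omega) (by omega)) rfl h0
    unfold RegMachine.sysStep
    simp only [readInput_zero, toRegMachine, OfflineTM.moveHead]
    congr 2
  have hnext : ∀ {c c' : P.Config}, P.sysStep w c = .inr c' → c.reg P.one = 1 →
      c'.reg P.one = 1 ∧ ∀ a b, P.toRegMachine.sysStep w ⟨.rewind c.state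
          (entries w (c.reg P.size) c.reg w.length) (overflow (c.reg P.size) w.length), 0,
          withScan c.reg a b⟩ =
        .inr ⟨.scan c'.state (fun _ _ => false) false, 0, withScan c'.reg 1 1⟩ := by
    intro c c' hstep hone
    obtain ⟨upd, ht, hreg⟩ := exists_transition hstep
    refine ⟨?_, fun a b => ?_⟩
    · rw [hreg]
      simp [assign, hupd _ _ _ _ _ _ ht, hone]
    · unfold RegMachine.sysStep
      simp only [readInput_zero, toRegMachine]
      have horder : (fun i j => order (withScan c.reg a b) (.inl i) (.inl j)) = order c.reg := rfl
      rw [horder, ht]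
      simp only [Sum.map_inr, OfflineTM.moveHead, Nat.zero_min]
      congr 2
      funext i
      rcases i with i | _ | _
      · rw [hreg]; rfl
      · simp [assign, withScan, hone]
      · simp [assign, withScan, hone]
  induction h with
  | halt c ans h hr =>
    refine hscan hone hr fun a b ha hb => ?_
    refine Produces.halt (dec := fun c : P.toRegMachine.Config => scanDec D c.state c.reg) _ _ ?_
      (withScan_le hr ha hb)
    unfold RegMachine.sysStep
    simp only [readInput_zero, toRegMachine]
    have horder : (fun i j => order (withScan c.reg a b) (.inl i) (.inl j)) = order c.reg := rfl
    rw [horder]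
    unfold sysStep at h
    cases ht : P.transition c.state (order c.reg) (entries w (c.reg P.size) c.reg w.length)
      (overflow (c.reg P.size) w.length) with
    | inl b => rw [ht] at h; simpa using h
    | inr y => rw [ht] at h; cases h
  | stay c c' l ans h hr hp ih =>
    obtain ⟨hone', hstep⟩ := hnext h hone
    refine hscan hone hr fun a b ha hb => ?_
    exact Produces.stay' (hstep a b) (withScan_le hr ha hb) rfl (ih hone')
  | move c c' l ans h hr hp ih =>
    obtain ⟨hone', hstep⟩ := hnext h hone
    refine hscan hone hr fun a b ha hb => ?_
    exact Produces.move (dec := fun c : P.toRegMachine.Config => scanDec D c.state c.reg)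
      _ _ _ _ (hstep a b) (withScan_le hr ha hb) (ih hone')

/-- The run of the register machine from its initial configuration. -/
theorem produces_boot (hupd : ∀ q lt A ov q' upd,
      P.transition q lt A ov = .inr (q', upd) → upd P.one = (P.one, false))
    (hw : w.length + 1 ≤ bound) {l : List μ} {ans : Bool} {r : Reg → ℕ}
    (hr : ∀ i, i ≠ P.one → r i = 0) (hone : r P.one = 1)
    (hstart : D P.start r = D P.start fun _ => 0)
    (h : Produces (P.sysStep w) (fun c => D c.state c.reg) (fun c => ∀ i, c.reg i ≤ bound)
      ⟨P.start, r⟩ l ans) :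
    Produces (P.toRegMachine.sysStep w) (fun c => scanDec D c.state c.reg)
      (fun c => ∀ i, c.reg i ≤ bound) ⟨P.toRegMachine.start, 0, fun _ => 0⟩ l ans := by
  obtain ⟨l', rfl⟩ := h.exists_cons
  refine Produces.stay' ?_ (fun _ => Nat.zero_le _) hstart.symm
    (produces_toRegMachine hupd hw h hone)
  unfold RegMachine.sysStep
  simp only [toRegMachine, OfflineTM.moveHead]
  congr 2
  funext i
  rcases i with i | _ | _
  · by_cases hi : i = P.one
    · subst hi; simp [assign, withScan, hone]
    · simp [assign, withScan, hi, hr i hi]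
  · rfl
  · rfl

end Simulation

end PatternMachine

/-! ### Transport of the table operations along isomorphisms -/

namespace PartialDecomposition

variable {V₁ V₂ : Type*}

theorem IsIso.refl {V : Type*} (P : PartialDecomposition V) : IsIso id id P P :=
  ⟨by simp, Set.bijOn_id _, fun _ _ _ _ => Iff.rfl, fun _ _ => rfl, fun _ _ => rfl⟩

theorem IsIso.congr {σ σ' : Option V₁ → Option V₂} {τ τ' : Node V₁ → Node V₂}
    {P : PartialDecomposition V₁} {Q : PartialDecomposition V₂} (h : IsIso σ τ P Q)
    (hσ : ∀ x ∈ P.X, σ x = σ' x) (hτ : ∀ a ∈ P.forest.nodes, τ a = τ' a) : IsIso σ' τ' P Q where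
  X_eq := by rw [h.X_eq]; exact Set.image_congr hσ
  bijOn := h.bijOn.congr hτ
  parent_iff a ha b hb := by rw [h.parent_iff a ha b hb, hτ a ha, hτ b hb]
  apply_inl x hx := by rw [← hτ _ (P.X_subset x hx), h.apply_inl x hx, hσ x hx]
  h_apply a ha := by rw [← hτ a ha, h.h_apply a ha]

/-- The map `σ` is injective on the bag and can be inverted there, so an equivalence of copies pulls
back. The maps on nodes may be different; only the common `σ` matters. -/
theorem IsIso.equivalent_of {σ : Option V₁ → Option V₂} {τ τ' : Node V₁ → Node V₂}
    {P Q : PartialDecomposition V₁} {P' Q' : PartialDecomposition V₂} (hP : IsIso σ τ P P')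
    (hQ : IsIso σ τ' Q Q') (hX : P.X = Q.X) (h : P'.Equivalent Q') : P.Equivalent Q := by
  have hinj : Set.InjOn σ Q.X := hQ.injOn_X
  have hinv : ∀ x ∈ Q.X, Function.invFunOn σ Q.X (σ x) = x := fun x hx =>
    hinj.leftInvOn_invFunOn hx
  obtain ⟨ρ, hρ⟩ := equivalent_iff.1 h
  obtain ⟨τ'', hQ'⟩ := hQ.symm hinv
  refine equivalent_iff.2 ⟨_, ((hP.trans hρ).trans hQ').congr (σ' := id) (fun x hx => ?_)
    (fun _ _ => rfl)⟩
  exact hinv x (hX ▸ hx)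

theorem IsIso.equivalent_map {σ : Option V₁ → Option V₂} {τ τ' : Node V₁ → Node V₂}
    {P Q : PartialDecomposition V₁} {P' Q' : PartialDecomposition V₂} (hP : IsIso σ τ P P')
    (hQ : IsIso σ τ' Q Q') (h : P.Equivalent Q) : P'.Equivalent Q' := by
  have hinv : ∀ x ∈ P.X, Function.invFunOn σ P.X (σ x) = x := fun x hx =>
    hP.injOn_X.leftInvOn_invFunOn hx
  obtain ⟨ρ, hρ⟩ := equivalent_iff.1 h
  obtain ⟨τ'', hP'⟩ := hP.symm hinv
  refine equivalent_iff.2 ⟨_, ((hP'.trans hρ).trans hQ).congr (σ' := id) (fun y hy => ?_)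
    (fun _ _ => rfl)⟩
  obtain ⟨x, hx, rfl⟩ := hP.mem_X_iff.1 hy
  simp [hinv x hx]

theorem IsRestriction.transport [DecidableEq V₂] {σ : Option V₁ → Option V₂}
    {τ : Node V₁ → Node V₂} {P Q : PartialDecomposition V₁} {P' Q' : PartialDecomposition V₂}
    {X : Finset (Option V₁)}
    (hP : IsIso σ τ P P') (hQ : IsIso σ τ Q Q') (hX : X ⊆ P.X) (h : P.IsRestriction X Q) :
    P'.IsRestriction (X.image σ) Q' := by
  have hinl : ∀ x ∈ X, τ (Sum.inl x) = Sum.inl (σ x) := fun x hx => hP.apply_inl x (hX hx)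
  have hmem : ∀ x ∈ X, Sum.inl x ∈ P.forest.nodes := fun x hx => P.X_subset x (hX hx)
  refine ⟨?_, fun z => ?_, fun z hz => ?_, fun z hz => ?_⟩
  · refine Finset.coe_injective ?_
    rw [hQ.X_eq, h.1, Finset.coe_image]
  · constructor
    · intro hz
      obtain ⟨a, ha, rfl⟩ := hQ.surj hz
      obtain ⟨haP, x, hx, hax⟩ := (h.2.1 a).1 ha
      refine ⟨hP.mem haP, σ x, Finset.mem_image_of_mem _ hx, ?_⟩
      rw [← hinl x hx]
      exact hax.imp (congrArg _) (hP.isAncestor_iff haP (hmem x hx)).1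
    · rintro ⟨hz, y, hy, hzy⟩
      obtain ⟨a, ha, rfl⟩ := hP.surj hz
      obtain ⟨x, hx, rfl⟩ := Finset.mem_image.1 hy
      rw [← hinl x hx] at hzy
      refine hQ.mem ((h.2.1 a).2 ⟨ha, x, hx, ?_⟩)
      exact hzy.imp (hP.inj ha (hmem x hx)) (hP.isAncestor_iff ha (hmem x hx)).2
  · obtain ⟨a, ha, rfl⟩ := hQ.surj hz
    have haP := h.nodes_subset ha
    cases hp : P.forest.parent a with
    | none =>
      rw [(hP.parent_none haP).2 hp, (hQ.parent_none ha).2 ((h.2.2.1 a ha).trans hp)]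
    | some b =>
      have hb := (P.forest.parent_mem _ _ hp).2
      have hq : Q.forest.parent a = some b := (h.2.2.1 a ha).trans hp
      rw [(hP.parent_iff a haP b hb).1 hp,
        (hQ.parent_iff a ha b (Q.forest.parent_mem _ _ hq).2).1 hq]
  · obtain ⟨a, ha, rfl⟩ := hQ.surj hz
    rw [hQ.h_apply a ha, hP.h_apply a (h.nodes_subset ha), h.2.2.2 a ha]

/-- An isomorphic copy in which only the vertices of the bag are used as names, apart from small
numbers. -/
theorem exists_clean (P : PartialDecomposition V₂) (σ : Option V₂ → Option V₁)
    (hσ : Set.InjOn σ P.X) {m : ℕ} (hm : P.forest.nodes.card ≤ m) :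
    ∃ (Q : PartialDecomposition V₁) (τ : Node V₂ → Node V₁), IsIso σ τ P Q ∧
      (∀ x, Sum.inl x ∈ Q.forest.nodes → x ∈ Q.X) ∧ (∀ k, Sum.inr k ∈ Q.forest.nodes → k ≤ m) ∧
      ∀ z ∉ Q.forest.nodes, Q.h z = 0 := by
  classical
  obtain ⟨ε, hε⟩ := P.forest.nodes.exists_injOn_fin hm
  -- Bag vertices are renamed by `σ`, and all other nodes are numbered.
  let τ : Node V₂ → Node V₁ := fun z =>
    if h : ∃ x ∈ P.X, z = Sum.inl x then Sum.inl (σ h.choose) else Sum.inr (ε z)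
  have hτ1 : ∀ x ∈ P.X, τ (Sum.inl x) = Sum.inl (σ x) := by
    intro x hx
    have h : ∃ y ∈ P.X, (Sum.inl x : Node V₂) = Sum.inl y := ⟨x, hx, rfl⟩
    simp only [τ, dif_pos h]
    rw [← Sum.inl_injective h.choose_spec.2]
  have hτ2 : ∀ z, (¬ ∃ x ∈ P.X, z = Sum.inl x) → τ z = Sum.inr ((ε z : Fin (m + 1)) : ℕ) :=
    fun z h => dif_neg h
  have hinj : Set.InjOn τ P.forest.nodes := by
    intro a ha b hb hab
    by_cases h1 : ∃ x ∈ P.X, a = Sum.inl x <;> by_cases h2 : ∃ x ∈ P.X, b = Sum.inl x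
    · obtain ⟨x, hx, rfl⟩ := h1
      obtain ⟨y, hy, rfl⟩ := h2
      rw [hτ1 x hx, hτ1 y hy] at hab
      rw [hσ hx hy (Sum.inl_injective hab)]
    · obtain ⟨x, hx, rfl⟩ := h1
      rw [hτ1 x hx, hτ2 b h2] at hab; cases hab
    · obtain ⟨y, hy, rfl⟩ := h2
      rw [hτ2 a h1, hτ1 y hy] at hab; cases hab
    · rw [hτ2 a h1, hτ2 b h2] at hab
      exact hε ha hb (Fin.ext (Sum.inr_injective hab))
  obtain ⟨Q, hiso, hX, hn, hh⟩ := P.exists_isIso_of_injOn σ τ hinj hτ1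
  refine ⟨Q, τ, hiso, fun x hx => ?_, fun k hk => ?_, hh⟩
  · obtain ⟨a, ha, hax⟩ := hiso.surj hx
    by_cases h : ∃ y ∈ P.X, a = Sum.inl y
    · obtain ⟨y, hy, rfl⟩ := h
      rw [hτ1 y hy] at hax
      rw [← Sum.inl_injective hax]
      exact hiso.mem_X_iff.2 ⟨y, hy, rfl⟩
    · rw [hτ2 a h] at hax; cases hax
  · obtain ⟨a, ha, hak⟩ := hiso.surj hk
    by_cases h : ∃ y ∈ P.X, a = Sum.inl y
    · obtain ⟨y, hy, rfl⟩ := h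
      rw [hτ1 y hy] at hak; cases hak
    · rw [hτ2 a h] at hak
      rw [← Sum.inr_injective hak]
      exact Nat.lt_succ_iff.1 (ε a).2

end PartialDecomposition

open PartialDecomposition

/-- All clauses are isomorphism invariant, with `f` conjugated by the isomorphisms. Only edges of
`H₂` impose a condition on the copy, so one direction for adjacency is enough; and the entries of
`R₁` may have their copies in `R₂` under different maps of nodes. -/
theorem IntroCandidate.transport {V₁ V₂ : Type*} [DecidableEq V₁] [DecidableEq V₂] {T : ℕ}
    {H₁ : SimpleGraph (Option V₁)} {H₂ : SimpleGraph (Option V₂)} {R₁ : Table V₁} {R₂ : Table V₂}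
    {X : Finset (Option V₁)} {u : Option V₁} {P₁ : PartialDecomposition V₁}
    {P₂ : PartialDecomposition V₂} {σ : Option V₁ → Option V₂} {τ : Node V₁ → Node V₂}
    (h : IntroCandidate T H₁ R₁ X u P₁) (hiso : IsIso σ τ P₁ P₂) (hnone : none ∈ X)
    (hσ : σ none = none)
    (hadj : ∀ x ∈ insert u X, ∀ y ∈ insert u X, H₂.Adj (σ x) (σ y) → H₁.Adj x y)
    (hR : ∀ P ∈ R₁, P.X = X ∧ ∃ Q ∈ R₂, ∃ τ, IsIso σ τ P Q) :
    IntroCandidate T H₂ R₂ (X.image σ) (σ u) P₂ := by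
  obtain ⟨hX, hcard, hroots, hleaf, hedge, ⟨P', hP', f, ⟨hfm, hfi, hfX, hfa⟩, hfim, hhu, hhf⟩,
    hheight⟩ := h
  have hsub : ∀ x ∈ X, x ∈ P₁.X := fun x hx => hX ▸ Finset.mem_insert_of_mem hx
  have huX : u ∈ P₁.X := hX ▸ Finset.mem_insert_self _ _
  have hun := P₁.X_subset u huX
  have huτ : τ (Sum.inl u) = Sum.inl (σ u) := hiso.apply_inl u huX
  obtain ⟨hPX, Q', hQ', τ', hiso'⟩ := hR P' hP'
  have hg : ∀ a ∈ P'.forest.nodes, Function.invFunOn τ' P'.forest.nodes (τ' a) = a := fun a ha =>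
    hiso'.bijOn.injOn.leftInvOn_invFunOn ha
  refine ⟨?_, ?_, ?_, ?_, ?_, ⟨Q', hQ', fun z => τ (f (Function.invFunOn τ' P'.forest.nodes z)),
    ⟨?_, ?_, ?_, ?_⟩, ?_, ?_, ?_⟩, ?_⟩
  · refine Finset.coe_injective ?_
    rw [hiso.X_eq, hX, ← Finset.image_insert, Finset.coe_image]
  · rw [hiso.card_nodes, hiso.card_X]; exact hcard
  · ext z
    rw [hiso.mem_roots_iff, hroots]
    simp only [Finset.mem_singleton, exists_eq_left]
    rw [hiso.apply_inl none (hsub none hnone), hσ]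
    exact eq_comm
  · intro z hz hc
    obtain ⟨a, ha, rfl⟩ := hiso.surj hz
    have hca : P₁.forest.children a = ∅ := by
      refine Finset.eq_empty_of_forall_notMem fun d hd => ?_
      have := (hiso.mem_children_iff ha).2 ⟨d, hd, rfl⟩
      rw [hc] at this; exact Finset.notMem_empty _ this
    obtain ⟨x, hx, rfl⟩ := hleaf a ha hca
    exact ⟨σ x, hiso.mem_X_iff.2 ⟨x, hx, rfl⟩, hiso.apply_inl x hx⟩
  · intro x hx y hy hxy
    obtain ⟨x, hx', rfl⟩ := hiso.mem_X_iff.1 hx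
    obtain ⟨y, hy', rfl⟩ := hiso.mem_X_iff.1 hy
    rw [← hiso.apply_inl x hx', ← hiso.apply_inl y hy',
      ← hiso.isAncestor_iff (P₁.X_subset x hx') (P₁.X_subset y hy'),
      ← hiso.isAncestor_iff (P₁.X_subset y hy') (P₁.X_subset x hx')]
    exact hedge x hx' y hy' (hadj x (hX ▸ hx') y (hX ▸ hy') hxy)
  · intro z hz
    obtain ⟨a, ha, rfl⟩ := hiso'.surj hz
    simp only [hg a ha]
    exact hiso.mem (hfm ha)
  · intro z hz y hy hzy
    obtain ⟨a, ha, rfl⟩ := hiso'.surj hz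
    obtain ⟨b, hb, rfl⟩ := hiso'.surj hy
    simp only [hg a ha, hg b hb] at hzy
    rw [hfi ha hb (hiso.inj (hfm ha) (hfm hb) hzy)]
  · intro y hy
    obtain ⟨x, hx, rfl⟩ := Finset.mem_image.1 hy
    have hxP : x ∈ P'.X := hPX ▸ hx
    show τ (f (Function.invFunOn τ' P'.forest.nodes (Sum.inl (σ x)))) = _
    rw [← hiso'.apply_inl x hxP, hg _ (P'.X_subset x hxP), hfX x hx,
      hiso.apply_inl x (hsub x hx), hiso'.apply_inl x hxP]
  · intro x hx y hy hyx
    obtain ⟨a, ha, rfl⟩ := hiso'.surj hx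
    obtain ⟨b, hb, rfl⟩ := hiso'.surj hy
    simp only [hg a ha, hg b hb]
    rw [← hiso.isAncestor_iff (hfm hb) (hfm ha)]
    exact hfa a ha b hb ((hiso'.isAncestor_iff hb ha).2 hyx)
  · ext z
    constructor
    · rintro ⟨y, hy, rfl⟩
      obtain ⟨a, ha, rfl⟩ := hiso'.surj hy
      simp only [hg a ha]
      refine ⟨hiso.mem (hfm ha), fun hz => ?_⟩
      rw [Set.mem_singleton_iff, ← huτ] at hz
      have h1 : f a ∈ f '' (P'.forest.nodes : Set (Node V₁)) := ⟨a, ha, rfl⟩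
      rw [hfim] at h1
      exact h1.2 (hiso.inj (hfm ha) hun hz)
    · rintro ⟨hz, hzu⟩
      obtain ⟨b, hb, rfl⟩ := hiso.surj hz
      have h1 : b ∈ f '' (P'.forest.nodes : Set (Node V₁)) := by
        rw [hfim]
        refine ⟨hb, fun hbu => hzu ?_⟩
        rw [Set.mem_singleton_iff] at hbu ⊢
        rw [hbu, huτ]
      obtain ⟨a, ha, rfl⟩ := h1
      exact ⟨τ' a, hiso'.mem ha, by simp only [hg a ha]⟩
  · rw [← huτ, hiso.h_apply _ hun, hiso.children_sup hun, hhu]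
  · intro z hz
    obtain ⟨a, ha, rfl⟩ := hiso'.surj hz
    simp only [hg a ha]
    rw [hiso.h_apply _ (hfm ha), hiso.children_sup (hfm ha), hhf a ha, hiso'.h_apply a ha]
  · rw [hiso.height_eq]; exact hheight

/-- Tables with entries isomorphic to those of a table of `forget` are tables of `forget`. -/
theorem IsForget.transport {V₁ V₂ : Type*} [DecidableEq V₁] [DecidableEq V₂]
    {R A : Table V₁} {X : Finset (Option V₁)} {u : Option V₁} (h : IsForget R X u A)
    {σ : Option V₁ → Option V₂} {τ : Node V₁ → Node V₂}
    (g : PartialDecomposition V₁ → PartialDecomposition V₂)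
    (hR : ∀ P ∈ R, P.X = X ∧ ∀ Q : PartialDecomposition V₁,
      Q.forest.nodes ⊆ P.forest.nodes → IsIso σ τ Q (g Q))
    (hσ : Set.InjOn σ (insert u X : Finset (Option V₁))) :
    IsForget (R.map g) (X.image σ) (σ u) (A.map g) := by
  have hA : ∀ Q ∈ A, IsIso σ τ Q (g Q) ∧ Q.X = X.erase u := by
    intro Q hQ
    obtain ⟨P, hP, hPQ⟩ := h.2.1 Q hQ
    exact ⟨(hR P hP).2 Q hPQ.nodes_subset, hPQ.1⟩
  -- Erasing commutes with the image only because `σ` separates `u` from the rest of the bag.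
  have herase : (X.image σ).erase (σ u) = (X.erase u).image σ := by
    ext y
    rw [Finset.mem_erase, Finset.mem_image, Finset.mem_image]
    constructor
    · rintro ⟨hne, x, hx, rfl⟩
      exact ⟨x, Finset.mem_erase.2 ⟨fun h => hne (h ▸ rfl), hx⟩, rfl⟩
    · rintro ⟨x, hx, rfl⟩
      rw [Finset.mem_erase] at hx
      refine ⟨fun h => hx.1 (hσ ?_ ?_ h), x, hx.2, rfl⟩
      · exact Finset.mem_coe.2 (Finset.mem_insert_of_mem hx.2)
      · exact Finset.mem_coe.2 (Finset.mem_insert_self _ _)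
  have hsub : ∀ P ∈ R, X.erase u ⊆ P.X := fun P hP => by
    rw [(hR P hP).1]; exact Finset.erase_subset _ _
  refine ⟨?_, ?_, ?_⟩
  · rw [List.pairwise_map]
    refine h.1.imp_of_mem fun {P Q} hP hQ hne heq => hne ?_
    exact (hA P hP).1.equivalent_of (hA Q hQ).1 ((hA P hP).2.trans (hA Q hQ).2.symm) heq
  · intro Q' hQ'
    obtain ⟨Q, hQ, rfl⟩ := List.mem_map.1 hQ'
    obtain ⟨P, hP, hPQ⟩ := h.2.1 Q hQ
    refine ⟨g P, List.mem_map_of_mem hP, ?_⟩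
    rw [herase]
    exact IsRestriction.transport ((hR P hP).2 P (Finset.Subset.refl _)) (hA Q hQ).1
      (hsub P hP) hPQ
  · rintro Q' ⟨P', hP', hPQ'⟩
    obtain ⟨P, hP, rfl⟩ := List.mem_map.1 hP'
    have hres := P.restrict_isRestriction _ (hsub P hP)
    obtain ⟨Q, hQ, hQe⟩ := h.2.2 _ ⟨P, hP, hres⟩
    -- This restriction of `P` need not be an entry of either table. It is the reason why the
    -- hypothesis on `g` covers all decompositions with nodes among those of an entry.
    have hisoR := (hR P hP).2 _ hres.nodes_subset
    refine ⟨g Q, List.mem_map_of_mem hQ, ((hA Q hQ).1.equivalent_map hisoR hQe).trans ?_⟩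
    rw [herase] at hPQ'
    exact (IsRestriction.transport ((hR P hP).2 P (Finset.Subset.refl _)) hisoR
      (hsub P hP) hres).equivalent hPQ'

/-- Tables with entries isomorphic to those of a table of `intro` are tables of `intro`. -/
theorem IsIntro.transport {V₁ V₂ : Type*} [DecidableEq V₁] [DecidableEq V₂] {T : ℕ}
    {H₁ : SimpleGraph (Option V₁)} {H₂ : SimpleGraph (Option V₂)}
    {R A : Table V₁} {X : Finset (Option V₁)} {u : Option V₁} (h : IsIntro T H₁ R X u A)
    {σ : Option V₁ → Option V₂} {τ : Node V₁ → Node V₂}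
    (g : PartialDecomposition V₁ → PartialDecomposition V₂)
    (hR : ∀ P ∈ R, P.X = X ∧ IsIso σ τ P (g P)) (hA : ∀ P ∈ A, IsIso σ τ P (g P))
    (hσ : Set.InjOn σ (insert u X : Finset (Option V₁))) (hnone : none ∈ X) (hσn : σ none = none)
    (hadj : ∀ x ∈ insert u X, ∀ y ∈ insert u X, H₂.Adj (σ x) (σ y) ↔ H₁.Adj x y) :
    IsIntro T H₂ (R.map g) (X.image σ) (σ u) (A.map g) := by
  have hinv : ∀ x ∈ insert u X,
      Function.invFunOn σ (insert u X : Finset (Option V₁)) (σ x) = x := fun x hx =>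
    hσ.leftInvOn_invFunOn (Finset.mem_coe.2 hx)
  set σ' := Function.invFunOn σ (insert u X : Finset (Option V₁)) with hσ'
  refine ⟨?_, ?_, ?_⟩
  · rw [List.pairwise_map]
    refine h.1.imp_of_mem fun {P Q} hP hQ hne heq => hne ?_
    exact (hA P hP).equivalent_of (hA Q hQ) ((h.2.1 P hP).1.trans (h.2.1 Q hQ).1.symm) heq
  · intro Q' hQ'
    obtain ⟨Q, hQ, rfl⟩ := List.mem_map.1 hQ'
    refine (h.2.1 Q hQ).transport (hA Q hQ) hnone hσn (fun x hx y hy => (hadj x hx y hy).1)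
      fun P hP => ⟨(hR P hP).1, g P, List.mem_map_of_mem hP, τ, (hR P hP).2⟩
  · intro Q' hQ'
    have hQX : Q'.X = (insert u X).image σ := by rw [Finset.image_insert]; exact hQ'.1
    have hσ'inj : Set.InjOn σ' Q'.X := by
      intro y hy z hz hyz
      rw [Finset.mem_coe, hQX, Finset.mem_image] at hy hz
      obtain ⟨y, hy, rfl⟩ := hy
      obtain ⟨z, hz, rfl⟩ := hz
      rw [hinv y hy, hinv z hz] at hyz
      rw [hyz]
    -- A candidate over `V₂` is pulled back to `V₁`; its representative in `A` is then mapped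
    -- forward by `g`. Numbering the nodes outside the bag avoids having to invert `σ` there.
    obtain ⟨Q, τ', hiso, -⟩ := Q'.exists_clean σ' hσ'inj le_rfl
    have himg : (X.image σ).image σ' = X := by
      ext x
      simp only [Finset.mem_image, exists_exists_and_eq_and]
      constructor
      · rintro ⟨y, hy, rfl⟩
        rwa [hinv y (Finset.mem_insert_of_mem hy)]
      · exact fun hx => ⟨x, hx, hinv x (Finset.mem_insert_of_mem hx)⟩
    have hQ := IntroCandidate.transport (H₂ := H₁) (R₂ := R) hQ' hiso
      (Finset.mem_image.2 ⟨none, hnone, hσn⟩) (by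
        have := hinv none (Finset.mem_insert_of_mem hnone)
        rwa [hσn] at this)
      (fun x hx y hy => by
        rw [← Finset.image_insert, Finset.mem_image] at hx hy
        obtain ⟨x, hx, rfl⟩ := hx
        obtain ⟨y, hy, rfl⟩ := hy
        rw [hinv x hx, hinv y hy]
        exact (hadj x hx y hy).2)
      (fun P' hP' => by
        obtain ⟨P, hP, rfl⟩ := List.mem_map.1 hP'
        obtain ⟨hPX, hPi⟩ := hR P hP
        obtain ⟨τ'', hPi'⟩ := hPi.symm (σ' := σ')
          (fun x hx => hinv x (Finset.mem_insert_of_mem (hPX ▸ hx)))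
        exact ⟨Finset.coe_injective (by rw [hPi.X_eq, hPX, Finset.coe_image]), P, hP, τ'', hPi'⟩)
    rw [himg, hinv u (Finset.mem_insert_self _ _)] at hQ
    obtain ⟨P, hP, hPQ⟩ := h.2.2 Q hQ
    refine ⟨g P, List.mem_map_of_mem hP, ?_⟩
    obtain ⟨ρ, hρ⟩ := hiso.symm (σ' := σ) (fun y hy => by
      rw [hQX, Finset.mem_image] at hy
      obtain ⟨y, hy, rfl⟩ := hy
      rw [hinv y hy])
    exact (hA P hP).equivalent_map hρ hPQ

/-! ### Tables with entries of a normal form -/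

namespace PartialDecomposition

/-- The number of nodes, the numbers among them and the values of `h` are at most `B`, and `h`
vanishes outside the nodes. -/
structure Tidy {V : Type*} (B : ℕ) (P : PartialDecomposition V) : Prop where
  inr_le : ∀ k, Sum.inr k ∈ P.forest.nodes → k ≤ B
  card_le : P.forest.nodes.card ≤ B
  h_le : ∀ z, P.h z ≤ B
  h_eq_zero : ∀ z ∉ P.forest.nodes, P.h z = 0

/-- There are only finitely many tidy partial decompositions of a finite graph. -/
theorem finite_tidy (V : Type*) [Finite V] (B : ℕ) : {P : PartialDecomposition V | P.Tidy B}.Finite := by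
  classical
  let F := Option V ⊕ Fin (B + 1)
  let ι : F → Node V := Sum.map id Fin.val
  let Code := Set F × Set (F × F) × Set (Option V) × (F → Fin (B + 1))
  let code : PartialDecomposition V → Code := fun P =>
    ({z | ι z ∈ P.forest.nodes}, {q | P.forest.parent (ι q.1) = some (ι q.2)}, {x | x ∈ P.X},
      fun z => Fin.ofNat (B + 1) (P.h (ι z)))
  refine Set.Finite.of_injOn (f := code) (t := Set.univ) (fun _ _ => Set.mem_univ _) ?_
    Set.finite_univ
  intro P hP Q hQ hPQ
  -- Tidiness bounds the numbers used as names, so all nodes are in the range of `ι` and the code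
  -- determines the forest.
  have hι : ∀ {R : PartialDecomposition V}, R.Tidy B → ∀ {z}, z ∈ R.forest.nodes → ∃ y, ι y = z := by
    rintro R hR (x | k) hz
    · exact ⟨.inl x, rfl⟩
    · exact ⟨.inr ⟨k, Nat.lt_succ_of_le (hR.inr_le k hz)⟩, rfl⟩
  have h1 : {z | ι z ∈ P.forest.nodes} = {z | ι z ∈ Q.forest.nodes} := congrArg Prod.fst hPQ
  have h2 : {q : F × F | P.forest.parent (ι q.1) = some (ι q.2)} =
    {q | Q.forest.parent (ι q.1) = some (ι q.2)} := congrArg (fun q => q.2.1) hPQ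
  have h3 : {x | x ∈ P.X} = {x | x ∈ Q.X} := congrArg (fun q => q.2.2.1) hPQ
  have h4 : (fun z => Fin.ofNat (B + 1) (P.h (ι z))) = fun z => Fin.ofNat (B + 1) (Q.h (ι z)) :=
    congrArg (fun q => q.2.2.2) hPQ
  have hn : P.forest.nodes = Q.forest.nodes := by
    ext z
    constructor
    · intro hz
      obtain ⟨y, rfl⟩ := hι hP hz
      exact (Set.ext_iff.1 h1 y).1 hz
    · intro hz
      obtain ⟨y, rfl⟩ := hι hQ hz
      exact (Set.ext_iff.1 h1 y).2 hz
  have hp : P.forest.parent = Q.forest.parent := by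
    funext a
    ext b
    constructor
    · intro hab
      obtain ⟨ha, hb⟩ := P.forest.parent_mem a b hab
      obtain ⟨a, rfl⟩ := hι hP ha
      obtain ⟨b, rfl⟩ := hι hP hb
      exact (Set.ext_iff.1 h2 (a, b)).1 hab
    · intro hab
      obtain ⟨ha, hb⟩ := Q.forest.parent_mem a b hab
      obtain ⟨a, rfl⟩ := hι hQ ha
      obtain ⟨b, rfl⟩ := hι hQ hb
      exact (Set.ext_iff.1 h2 (a, b)).2 hab
  have hX : P.X = Q.X := by
    ext x
    exact Set.ext_iff.1 h3 x
  have hh : P.h = Q.h := by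
    funext z
    by_cases hz : z ∈ P.forest.nodes
    · obtain ⟨y, rfl⟩ := hι hP hz
      have := congrArg Fin.val (congrFun h4 y)
      simp only [Fin.ofNat] at this
      rwa [Nat.mod_eq_of_lt (Nat.lt_succ_of_le (hP.h_le _)),
        Nat.mod_eq_of_lt (Nat.lt_succ_of_le (hQ.h_le _))] at this
    · rw [hP.h_eq_zero z hz, hQ.h_eq_zero z (hn ▸ hz)]
  obtain ⟨⟨n1, p1, _, _⟩, X1, h1, _, _, _⟩ := P
  obtain ⟨⟨n2, p2, _, _⟩, X2, h2, _, _, _⟩ := Q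
  simp only at hn hp hX hh
  subst hn hp hX hh
  rfl

/-- The partial decomposition consisting of the universal vertex. -/
def leaf (V : Type*) : PartialDecomposition V where
  forest :=
    { nodes := {Sum.inl none}
      parent := fun _ => none
      parent_mem := by simp
      acyclic := fun x h => by
        cases h with
        | single h => cases h
        | tail _ h => cases h }
  X := {none}
  h := fun z => match z with
    | Sum.inl none => 1
    | _ => 0
  X_subset := by simp
  h_pos := by simp
  h_lt x y h := by
    cases h with
    | single h => cases h
    | tail _ h => cases h

instance (V : Type*) : Inhabited (PartialDecomposition V) := ⟨leaf V⟩

theorem leaf_tidy (V : Type*) {B : ℕ} (hB : 1 ≤ B) : (leaf V).Tidy B where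
  inr_le k hk := by cases Finset.mem_singleton.1 hk
  card_le := hB
  h_le z := by
    rcases z with (_ | _) | _
    · exact hB
    · exact Nat.zero_le _
    · exact Nat.zero_le _
  h_eq_zero z hz := by
    rcases z with (_ | _) | _
    · exact absurd (Finset.mem_singleton_self _) hz
    · rfl
    · rfl

/-- Restrictions of tidy entries are tidy when their heights are extended by `0`, and they bring no
new names into use. -/
theorem isForget_exists_tidy {V : Type} [DecidableEq V] {R : Table V} {X : Finset (Option V)}
    {u : Option V} {p M T B : ℕ} (hp : (X.erase u).card ≤ p)
    (hR : ∀ P ∈ R, P.X = X ∧ P.forest.nodes.card ≤ M ∧ ∀ x ∈ P.forest.nodes, P.h x ≤ T)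
    (hRt : ∀ P ∈ R, P.Tidy B)
    (hB : ∀ (V : Type) (X : Finset (Option V)), X.card ≤ p → ∀ A : Table V,
      A.Pairwise (fun P Q => ¬ P.Equivalent Q) →
      (∀ P ∈ A, P.X = X ∧ P.forest.nodes.card ≤ M ∧
        ∀ x ∈ P.forest.nodes, P.h x ≤ T) → A.length ≤ B) :
    ∃ A, IsForget R X u A ∧ A.length ≤ B ∧ ∀ Q ∈ A, Q.Tidy B ∧
      (∃ P ∈ R, Q.forest.nodes ⊆ P.forest.nodes) ∧
      Q.X = X.erase u ∧ Q.forest.nodes.card ≤ M ∧ ∀ x ∈ Q.forest.nodes, Q.h x ≤ T := by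
  set S : Set (PartialDecomposition V) := {Q | ∃ P ∈ R, P.IsRestriction (X.erase u) Q}
  have hS : ∀ Q ∈ S, Q.X = X.erase u ∧ Q.forest.nodes.card ≤ M ∧
      ∀ x ∈ Q.forest.nodes, Q.h x ≤ T := by
    rintro Q ⟨P, hP, hPQ⟩
    exact hPQ.size (hR P hP).2
  have hrep : ∀ Q ∈ S, ∃ P ∈ S ∩ {P | P.Tidy B}, P.Equivalent Q := by
    rintro Q ⟨P, hP, hPQ⟩
    have hX : X.erase u ⊆ P.X := by rw [(hR P hP).1]; exact Finset.erase_subset _ _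
    have hres := P.restrict_isRestriction _ hX
    have ht := hRt P hP
    refine ⟨_, ⟨⟨P, hP, hres⟩, ?_, ?_, ?_, ?_⟩, hres.equivalent hPQ⟩
    · exact fun k hk => ht.inr_le k (hres.nodes_subset hk)
    · exact (Finset.card_le_card hres.nodes_subset).trans ht.card_le
    · intro z
      by_cases hz : z ∈ (P.restrict _ hX).forest.nodes
      · rw [hres.2.2.2 z hz]; exact ht.h_le z
      · rw [restrict_h_of_notMem _ _ _ hz]; exact Nat.zero_le _
    · exact fun z hz => restrict_h_of_notMem _ _ _ hz
  obtain ⟨A, hA, hAS⟩ := exists_isTableOf S (S ∩ {P | P.Tidy B}) Set.inter_subset_left hrep B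
    fun A hA hAS => hB V _ hp A hA fun P hP => hS P (hAS P hP).1
  refine ⟨A, hA, hB V _ hp A hA.1 fun P hP => hS P (hAS P hP).1, fun Q hQ => ⟨(hAS Q hQ).2, ?_,
    hS Q (hAS Q hQ).1⟩⟩
  obtain ⟨P, hP, hPQ⟩ := (hAS Q hQ).1
  exact ⟨P, hP, hPQ.nodes_subset⟩

/-- A clean copy of a candidate is again a candidate. Hence representatives can be chosen in which
only bag vertices are mentioned by name, and the supply of names is not exhausted by forgotten
vertices. -/
theorem isIntro_exists_tidy {V : Type} [DecidableEq V] {H : SimpleGraph (Option V)} {R : Table V}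
    {X : Finset (Option V)} {u : Option V} {p T B : ℕ} (hp : (insert u X).card ≤ p)
    (hnone : none ∈ X) (hR : ∀ P ∈ R, P.X = X) (hpT : p * T ≤ B) (hT : T ≤ B)
    (hB : ∀ (V : Type) (X : Finset (Option V)), X.card ≤ p → ∀ A : Table V,
      A.Pairwise (fun P Q => ¬ P.Equivalent Q) →
      (∀ P ∈ A, P.X = X ∧ P.forest.nodes.card ≤ p * T ∧
        ∀ x ∈ P.forest.nodes, P.h x ≤ T) → A.length ≤ B) :
    ∃ A, IsIntro T H R X u A ∧ A.length ≤ B ∧ ∀ Q ∈ A, Q.Tidy B ∧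
      (∀ x, Sum.inl x ∈ Q.forest.nodes → x ∈ Q.X) ∧
      Q.X = insert u X ∧ Q.forest.nodes.card ≤ p * T ∧ ∀ x ∈ Q.forest.nodes, Q.h x ≤ T := by
  set S : Set (PartialDecomposition V) := {P | IntroCandidate T H R X u P}
  set S' : Set (PartialDecomposition V) :=
    {P | P.Tidy B ∧ ∀ x, Sum.inl x ∈ P.forest.nodes → x ∈ P.X}
  have hS : ∀ Q ∈ S, Q.X = insert u X ∧ Q.forest.nodes.card ≤ p * T ∧
      ∀ x ∈ Q.forest.nodes, Q.h x ≤ T := fun Q hQ => IntroCandidate.size hQ hp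
  have hrep : ∀ Q ∈ S, ∃ P ∈ S ∩ S', P.Equivalent Q := by
    intro Q hQ
    obtain ⟨P, τ, hiso, h1, h2, h3⟩ := Q.exists_clean id (Set.injOn_id _) (hS Q hQ).2.1
    have hPS : P ∈ S := by
      have := IntroCandidate.transport (R₂ := R) (H₂ := H) hQ hiso hnone rfl
        (fun _ _ _ _ h => h) fun P hP => ⟨hR P hP, P, hP, id, .refl P⟩
      rwa [Finset.image_id] at this
    refine ⟨P, ⟨hPS, ⟨fun k hk => (h2 k hk).trans hpT, (hS P hPS).2.1.trans hpT,
      fun z => ?_, h3⟩, h1⟩, (equivalent_iff.2 ⟨τ, hiso⟩).symm⟩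
    by_cases hz : z ∈ P.forest.nodes
    · exact ((hS P hPS).2.2 z hz).trans hT
    · rw [h3 z hz]; exact Nat.zero_le _
  obtain ⟨A, hA, hAS⟩ := exists_isTableOf S (S ∩ S') Set.inter_subset_left hrep B
    fun A hA hAS => hB V _ hp A hA fun P hP => hS P (hAS P hP).1
  exact ⟨A, hA, hB V _ hp A hA.1 fun P hP => hS P (hAS P hP).1, fun Q hQ =>
    ⟨(hAS Q hQ).2.1, (hAS Q hQ).2.2, hS Q (hAS Q hQ).1⟩⟩

end PartialDecomposition

/-! ### Names for vertices -/

open PartialDecomposition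

/-- The vertex with the name `a`, if `r` assigns numbers from `1` to the names. -/
def nameVertex {K : ℕ} (n : ℕ) (r : Fin K → ℕ) : Option (Fin K) → Option (Fin n)
  | none => none
  | some a => if h : 1 ≤ r a ∧ r a - 1 < n then some ⟨r a - 1, h.2⟩ else none

/-- The names occurring in a partial decomposition. -/
def PartialDecomposition.names {K : ℕ} (P : PartialDecomposition (Fin K)) : Finset (Fin K) :=
  Finset.univ.filter fun a => Sum.inl (some a) ∈ P.forest.nodes

/-- The names occurring in a memory. -/
def Memory.Uses {K : ℕ} (m : Memory (Fin K)) (a : Fin K) : Prop :=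
  a ∈ m.stack ∨ ∃ P, (P ∈ m.previous ∨ P ∈ m.current) ∧ Sum.inl (some a) ∈ P.forest.nodes

/-- Different names from `S` are assigned to different vertices. -/
structure ValidNames {K : ℕ} (n : ℕ) (r : Fin K → ℕ) (S : Set (Fin K)) : Prop where
  pos : ∀ a ∈ S, 1 ≤ r a
  le : ∀ a ∈ S, r a ≤ n
  inj : Set.InjOn r S

section Decode

variable {K n : ℕ} {r : Fin K → ℕ} {S : Set (Fin K)}

theorem ValidNames.mono {S' : Set (Fin K)} (h : ValidNames n r S) (hS : S' ⊆ S) :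
    ValidNames n r S' :=
  ⟨fun a ha => h.pos a (hS ha), fun a ha => h.le a (hS ha), h.inj.mono hS⟩

theorem ValidNames.nameVertex_eq (h : ValidNames n r S) {a : Fin K} (ha : a ∈ S) :
    ∃ v : Fin n, nameVertex n r (some a) = some v ∧ r a = v + 1 := by
  have h1 := h.pos a ha
  have h2 := h.le a ha
  have h3 : 1 ≤ r a ∧ r a - 1 < n := ⟨h1, by omega⟩
  exact ⟨⟨r a - 1, h3.2⟩, dif_pos h3, by simp only; omega⟩

theorem nameVertex_some {a : Fin K} {v : Fin n} : nameVertex n r (some a) = some v ↔ r a = v + 1 := by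
  constructor
  · intro h
    unfold nameVertex at h
    simp only at h
    split_ifs at h with h'
    rw [← Option.some_injective _ h]
    simp only; omega
  · intro h
    have h3 : 1 ≤ r a ∧ r a - 1 < n := ⟨by omega, by have := v.2; omega⟩
    unfold nameVertex
    simp only [dif_pos h3]
    congr 1
    ext
    simp only; omega

theorem nameVertex_congr {r' : Fin K → ℕ} {x : Option (Fin K)}
    (h : ∀ a, x = some a → r a = r' a) : nameVertex n r x = nameVertex n r' x := by
  cases x with
  | none => rfl
  | some a => simp only [nameVertex, h a rfl]

theorem ValidNames.injOn (h : ValidNames n r S) {T : Set (Option (Fin K))}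
    (hT : ∀ a, some a ∈ T → a ∈ S) : Set.InjOn (nameVertex n r) T := by
  intro x hx y hy hxy
  rcases x with _ | a <;> rcases y with _ | b
  · rfl
  · obtain ⟨v, hv, -⟩ := h.nameVertex_eq (hT b hy)
    rw [hv] at hxy; cases hxy
  · obtain ⟨v, hv, -⟩ := h.nameVertex_eq (hT a hx)
    rw [hv] at hxy; cases hxy
  · obtain ⟨v, hv, ha⟩ := h.nameVertex_eq (hT a hx)
    obtain ⟨w, hw, hb⟩ := h.nameVertex_eq (hT b hy)
    rw [hv, hw, Option.some_inj] at hxy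
    subst hxy
    rw [h.inj (hT a hx) (hT b hy) (ha.trans hb.symm)]

/-- Replacing names by vertices in the nodes of partial decompositions. -/
def nameNode (n : ℕ) (r : Fin K → ℕ) : Node (Fin K) → Node (Fin n) := Sum.map (nameVertex n r) id

/-- The partial decomposition of a graph on `n` vertices described by one that uses names. -/
noncomputable def decodePD (n : ℕ) (r : Fin K → ℕ) (P : PartialDecomposition (Fin K)) :
    PartialDecomposition (Fin n) :=
  Classical.epsilon fun Q => IsIso (nameVertex n r) (nameNode n r) P Q

/-- The decoded object is an arbitrary choice, but the property it is chosen by involves only the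
names that occur. Equal predicates give equal choices, so registers of other names may change freely
without affecting the display. -/
theorem decodePD_congr {r' : Fin K → ℕ} {P : PartialDecomposition (Fin K)}
    (h : ∀ a, Sum.inl (some a) ∈ P.forest.nodes → r a = r' a) :
    decodePD n r P = decodePD n r' P := by
  have key : ∀ {r r' : Fin K → ℕ}, (∀ a, Sum.inl (some a) ∈ P.forest.nodes → r a = r' a) →
      ∀ Q, IsIso (nameVertex n r) (nameNode n r) P Q →
        IsIso (nameVertex n r') (nameNode n r') P Q := by
    intro r r' h Q hQ
    refine hQ.congr (fun x hx => nameVertex_congr ?_) fun z hz => ?_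
    · rintro a rfl
      exact h a (P.X_subset _ hx)
    · rcases z with x | k
      · exact congrArg Sum.inl (nameVertex_congr (by rintro a rfl; exact h a hz))
      · rfl
  have : (fun Q => IsIso (nameVertex n r) (nameNode n r) P Q) =
      fun Q => IsIso (nameVertex n r') (nameNode n r') P Q := by
    funext Q
    exact propext ⟨key h Q, key (fun a ha => (h a ha).symm) Q⟩
  unfold decodePD
  rw [this]

theorem decodePD_isIso (h : ValidNames n r S) {P : PartialDecomposition (Fin K)}
    (hP : ∀ a, Sum.inl (some a) ∈ P.forest.nodes → a ∈ S) :
    IsIso (nameVertex n r) (nameNode n r) P (decodePD n r P) := by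
  classical
  have hex : ∃ Q, IsIso (nameVertex n r) (nameNode n r) P Q := by
    obtain ⟨Q, hQ, -⟩ := P.exists_isIso_of_injOn (nameVertex n r) (nameNode n r) (by
      intro x hx y hy hxy
      rcases x with x | k <;> rcases y with y | j
      · have := h.injOn (T := {x | Sum.inl x ∈ P.forest.nodes}) hP hx hy (Sum.inl_injective hxy)
        rw [this]
      · cases hxy
      · cases hxy
      · exact congrArg Sum.inr (Sum.inr_injective hxy)) (fun x _ => rfl)
    exact ⟨Q, hQ⟩
  exact Classical.epsilon_spec hex

/-- The memory described by one that uses names. -/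
noncomputable def decodeMemory (n : ℕ) (r : Fin K → ℕ) (m : Memory (Fin K)) : Memory (Fin n) where
  stack := m.stack.filterMap fun a => nameVertex n r (some a)
  previous := m.previous.map (decodePD n r)
  current := m.current.map (decodePD n r)

theorem decodeMemory_congr {r' : Fin K → ℕ} {m : Memory (Fin K)}
    (h : ∀ a, m.Uses a → r a = r' a) : decodeMemory n r m = decodeMemory n r' m := by
  unfold decodeMemory
  congr 1
  · refine List.filterMap_congr fun a ha => nameVertex_congr ?_
    rintro b ⟨⟩
    exact h a (Or.inl ha)
  · exact List.map_congr_left fun P hP => decodePD_congr fun a ha => h a (Or.inr ⟨P, Or.inl hP, ha⟩)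
  · exact List.map_congr_left fun P hP => decodePD_congr fun a ha => h a (Or.inr ⟨P, Or.inr hP, ha⟩)

/-- The bag belonging to a memory. -/
def Memory.bag {V : Type*} [DecidableEq V] (m : Memory V) : Finset (Option V) :=
  AlgState.bag ⟨m, ∅⟩

theorem Memory.some_mem_bag {V : Type*} [DecidableEq V] {m : Memory V} {a : V} :
    some a ∈ m.bag ↔ a ∈ m.stack := by simp [Memory.bag, AlgState.bag]

theorem Memory.none_mem_bag {V : Type*} [DecidableEq V] (m : Memory V) :
    none ∈ m.bag := by simp [Memory.bag, AlgState.bag]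

theorem Memory.mem_bag {V : Type*} [DecidableEq V] {m : Memory V} {x : Option V} :
    x ∈ m.bag ↔ x = none ∨ ∃ a ∈ m.stack, x = some a := by
  simp [Memory.bag, AlgState.bag, eq_comm]

theorem mem_decode_stack {m : Memory (Fin K)} {v : Fin n} :
    v ∈ (decodeMemory n r m).stack ↔ ∃ a ∈ m.stack, r a = v + 1 := by
  simp only [decodeMemory, List.mem_filterMap, nameVertex_some]

theorem ValidNames.bag_decode {m : Memory (Fin K)} (h : ValidNames n r {a | m.Uses a}) :
    (decodeMemory n r m).bag = m.bag.image (nameVertex n r) := by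
  ext x
  rw [Memory.mem_bag, Finset.mem_image]
  constructor
  · rintro (rfl | ⟨v, hv, rfl⟩)
    · exact ⟨none, m.none_mem_bag, rfl⟩
    · obtain ⟨a, ha, hav⟩ := mem_decode_stack.1 hv
      exact ⟨some a, Memory.some_mem_bag.2 ha, nameVertex_some.2 hav⟩
  · rintro ⟨y, hy, rfl⟩
    rcases Memory.mem_bag.1 hy with rfl | ⟨a, ha, rfl⟩
    · exact Or.inl rfl
    · obtain ⟨v, hv, hav⟩ := h.nameVertex_eq (show a ∈ {a | m.Uses a} from Or.inl ha)
      exact Or.inr ⟨v, mem_decode_stack.2 ⟨a, ha, hav⟩, hv⟩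

theorem ValidNames.decode_stack_cons {a : Fin K} {l : List (Fin K)} {p p' c c' : Table (Fin K)}
    (h : ValidNames n r S) (ha : a ∈ S) : ∃ v : Fin n, r a = v + 1 ∧
      (decodeMemory n r ⟨a :: l, p, c⟩).stack = v :: (decodeMemory n r ⟨l, p', c'⟩).stack := by
  obtain ⟨v, hv, hav⟩ := h.nameVertex_eq ha
  exact ⟨v, hav, List.filterMap_cons_some (f := fun a => nameVertex n r (some a)) hv⟩

theorem ValidNames.decode_stack_length {l : List (Fin K)} {p c : Table (Fin K)}
    (h : ValidNames n r S) (hl : ∀ a ∈ l, a ∈ S) :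
    (decodeMemory n r ⟨l, p, c⟩).stack.length = l.length := by
  induction l with
  | nil => rfl
  | cons a l ih =>
    obtain ⟨v, -, hv⟩ := h.decode_stack_cons (p := p) (p' := p) (c := c) (c' := c) (l := l)
      (hl a List.mem_cons_self)
    rw [hv, List.length_cons, List.length_cons, ih fun b hb => hl b (List.mem_cons_of_mem _ hb)]

/-- The graph on names in which adjacency is read from a matrix. -/
def namesGraph (A : Fin K → Fin K → Bool) : SimpleGraph (Fin K) :=
  SimpleGraph.fromRel fun a b => A a b = true

/-- Valid names designate distinct vertices, so the bag with its edges can be recovered from the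
observed matrix entries alone. -/
theorem ValidNames.rootedGraph_adj (h : ValidNames n r S) {G : SimpleGraph (Fin n)}
    {A : Fin K → Fin K → Bool}
    (hA : ∀ a b, A a b = true ↔ ∃ u v, G.Adj u v ∧ r a = u.val + 1 ∧ r b = v.val + 1)
    {x y : Option (Fin K)} (hx : ∀ a, x = some a → a ∈ S) (hy : ∀ a, y = some a → a ∈ S) :
    (rootedGraph G).Adj (nameVertex n r x) (nameVertex n r y) ↔
      (rootedGraph (namesGraph A)).Adj x y := by
  have hinj : nameVertex n r x = nameVertex n r y ↔ x = y := by
    constructor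
    · refine h.injOn (T := {z | z = x ∨ z = y}) ?_ (Or.inl rfl) (Or.inr rfl)
      rintro a (ha | ha)
      · exact hx a ha.symm
      · exact hy a ha.symm
    · rintro rfl; rfl
  have hnone : ∀ z : Option (Fin K), (∀ a, z = some a → a ∈ S) →
      (nameVertex n r z = none ↔ z = none) := by
    intro z hz
    rcases z with _ | a
    · simp [nameVertex]
    · obtain ⟨v, hv, -⟩ := h.nameVertex_eq (hz a rfl)
      simp [hv]
  have hcore : (∃ u v, nameVertex n r x = some u ∧ nameVertex n r y = some v ∧ G.Adj u v) ↔
      ∃ u v, x = some u ∧ y = some v ∧ (namesGraph A).Adj u v := by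
    constructor
    · rintro ⟨u, v, hu, hv, huv⟩
      rcases x with _ | a
      · cases hu
      rcases y with _ | b
      · cases hv
      refine ⟨a, b, rfl, rfl, ?_⟩
      rw [namesGraph, SimpleGraph.fromRel_adj]
      refine ⟨?_, Or.inl ((hA a b).2 ⟨u, v, huv, nameVertex_some.1 hu, nameVertex_some.1 hv⟩)⟩
      rintro rfl
      rw [hu, Option.some_inj] at hv
      exact G.ne_of_adj huv hv
    · rintro ⟨a, b, rfl, rfl, hab⟩
      rw [namesGraph, SimpleGraph.fromRel_adj] at hab
      rcases hab.2 with hab | hab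
      · obtain ⟨u, v, huv, hu, hv⟩ := (hA a b).1 hab
        exact ⟨u, v, nameVertex_some.2 hu, nameVertex_some.2 hv, huv⟩
      · obtain ⟨u, v, huv, hu, hv⟩ := (hA b a).1 hab
        exact ⟨v, u, nameVertex_some.2 hv, nameVertex_some.2 hu, huv.symm⟩
  simp only [rootedGraph, ne_eq, hinj, hnone x hx, hnone y hy, hcore]

end Decode

/-! ### Steps of the algorithm, with names for vertices -/

open PartialDecomposition

namespace Memory

/-- The memory has bounded size, and the entries of the tables have normal form. -/
structure Fits {V : Type*} (L B : ℕ) (m : Memory V) : Prop where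
  stack_le : m.stack.length ≤ L
  previous_le : m.previous.length ≤ B
  current_le : m.current.length ≤ B
  previous_tidy : ∀ P ∈ m.previous, P.Tidy B
  current_tidy : ∀ P ∈ m.current, P.Tidy B

/-- This makes it possible to keep whole memories over names in the finite control. -/
theorem finite_fits (V : Type*) [Finite V] (L B : ℕ) : {m : Memory V | m.Fits L B}.Finite := by
  have htab : {A : Table V | A.length ≤ B ∧ ∀ P ∈ A, P.Tidy B}.Finite := by
    have : Finite {P : PartialDecomposition V | P.Tidy B} := finite_tidy V B
    refine ((List.finite_length_le {P : PartialDecomposition V | P.Tidy B} B).image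
      (List.map Subtype.val)).subset ?_
    rintro A ⟨hA, hAt⟩
    refine ⟨A.attachWith _ hAt, ?_, List.attachWith_map_subtype_val hAt⟩
    show (A.attachWith _ hAt).length ≤ B
    rwa [List.length_attachWith]
  refine Set.Finite.of_injOn (f := fun m : Memory V => (m.stack, m.previous, m.current))
    (fun m hm => ?_) ?_ ((List.finite_length_le V L).prod (htab.prod htab))
  · exact ⟨hm.stack_le, ⟨hm.previous_le, hm.previous_tidy⟩, hm.current_le, hm.current_tidy⟩
  · rintro ⟨a, b, c⟩ - ⟨a', b', c'⟩ - h
    simpa using h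

/-- The stack uses at most `L` names, and each of the at most `2 * B` table entries at most `B`. The
spare name serves for the candidate for the next vertex. -/
theorem Fits.exists_not_uses {K L B : ℕ} {m : Memory (Fin K)} (hm : m.Fits L B)
    (hK : L + 2 * B * B < K) : ∃ c, ¬ m.Uses c := by
  classical
  by_contra h
  push Not at h
  have hsub : (Finset.univ : Finset (Fin K)) ⊆
      m.stack.toFinset ∪ (m.previous ++ m.current).toFinset.biUnion PartialDecomposition.names := by
    intro a _
    rw [Finset.mem_union, List.mem_toFinset, Finset.mem_biUnion]
    refine (h a).imp_right ?_
    rintro ⟨P, hP, ha⟩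
    exact ⟨P, by simpa using hP, Finset.mem_filter.2 ⟨Finset.mem_univ _, ha⟩⟩
  have hcard : ∀ P ∈ (m.previous ++ m.current).toFinset, P.names.card ≤ B := by
    intro P hP
    have ht : P.Tidy B := by
      rw [List.mem_toFinset, List.mem_append] at hP
      exact hP.elim (hm.previous_tidy P) (hm.current_tidy P)
    refine le_trans (Finset.card_le_card_of_injOn (fun a => Sum.inl (some a)) ?_ ?_) ht.card_le
    · intro a ha
      exact (Finset.mem_filter.1 ha).2
    · intro a _ b _ hab
      exact Option.some_injective _ (Sum.inl_injective hab)
  have h1 := Finset.card_le_card hsub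
  rw [Finset.card_univ, Fintype.card_fin] at h1
  have h2 := (Finset.card_union_le m.stack.toFinset
    ((m.previous ++ m.current).toFinset.biUnion PartialDecomposition.names))
  have h3 := Finset.card_biUnion_le_card_mul _ _ _ hcard
  have h4 := m.stack.toFinset_card_le
  have h5 := (m.previous ++ m.current).toFinset_card_le
  rw [List.length_append] at h5
  have h6 := hm.stack_le
  have h7 := hm.previous_le
  have h8 := hm.current_le
  have h9 : (m.previous ++ m.current).toFinset.card * B ≤ 2 * B * B :=
    Nat.mul_le_mul_right _ (by omega)
  omega

/-- The entries of the current table have the current bag and bounded size. -/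
def Sized {V : Type*} [DecidableEq V] (t : ℕ) (m : Memory V) : Prop :=
  ∀ P ∈ m.current, P.X = m.bag ∧ P.forest.nodes.card ≤ (2 ^ t + 1) * (t + 1) ∧
    ∀ x ∈ P.forest.nodes, P.h x ≤ t + 1

/-- `m'` may follow `m` when a vertex with the name `c` is discovered. -/
structure Push {K : ℕ} (t : ℕ) (H : SimpleGraph (Fin K)) (m : Memory (Fin K)) (c : Fin K)
    (m' : Memory (Fin K)) : Prop where
  stack : m'.stack = c :: m.stack
  previous : m'.previous = m.current
  current : IsIntro (t + 1) (rootedGraph H) m.current m.bag (some c) m'.current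
  uses : ∀ a, m'.Uses a → a = c ∨ m.Uses a
  sized : m'.Sized t

/-- `m'` may follow `m` when the vertex with the name `a` is left. -/
structure Pop {K : ℕ} (t : ℕ) (m : Memory (Fin K)) (a : Fin K) (m' : Memory (Fin K)) :
    Prop where
  stack : m.stack = a :: m'.stack
  previous : m'.previous = m.current
  current : IsForget m.current m.bag (some a) m'.current
  uses : ∀ b, m'.Uses b → m.Uses b
  sized : m'.Sized t

theorem card_bag_le {V : Type*} [DecidableEq V] (m : Memory V) :
    m.bag.card ≤ m.stack.length + 1 := by
  refine (Finset.card_insert_le _ _).trans (Nat.add_le_add_right ?_ 1)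
  exact (List.toFinset_card_le _).trans (by simp)

theorem bag_cons {V : Type*} [DecidableEq V] {m m' : Memory V} {c : V}
    (h : m'.stack = c :: m.stack) : m'.bag = insert (some c) m.bag := by
  ext x
  rw [Finset.mem_insert, mem_bag, mem_bag, h]
  simp only [List.mem_cons, exists_eq_or_imp]
  tauto

section Exists

variable {K t B : ℕ} {m : Memory (Fin K)}

/-- The step can be taken on names within the same size bounds, so the memories remain in a finite
set. -/
theorem exists_push (hB : TableBound t B) (hm : m.Fits (2 ^ t) B) (hs : m.Sized t) (H : SimpleGraph (Fin K)) {c : Fin K}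
    (hlen : m.stack.length + 1 ≤ 2 ^ t) :
    ∃ m' : Memory (Fin K), m'.Fits (2 ^ t) B ∧ m.Push t H c m' := by
  have hcard : (insert (some c) m.bag).card ≤ 2 ^ t + 1 :=
    (Finset.card_insert_le _ _).trans (Nat.add_le_add_right (m.card_bag_le.trans hlen) 1)
  obtain ⟨A, hA, hlenA, hAt⟩ := isIntro_exists_tidy (H := rootedGraph H) (R := m.current) hcard
    m.none_mem_bag (fun P hP => (hs P hP).1) hB.1 hB.2.1 hB.2.2
  refine ⟨⟨c :: m.stack, m.current, A⟩, ⟨hlen, hm.current_le, hlenA, hm.current_tidy,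
    fun P hP => (hAt P hP).1⟩, rfl, rfl, hA, ?_, ?_⟩
  · rintro a (ha | ⟨P, hP | hP, ha⟩)
    · exact (List.mem_cons.1 ha).imp_right Or.inl
    · exact Or.inr (Or.inr ⟨P, Or.inr hP, ha⟩)
    · have := (hAt P hP).2.1 _ ha
      rw [(hAt P hP).2.2.1, Finset.mem_insert, some_mem_bag] at this
      exact this.imp (Option.some_injective _ ·) Or.inl
  · intro P hP
    rw [bag_cons (m := m) (c := c) rfl]
    exact (hAt P hP).2.2

theorem exists_pop (hB : TableBound t B) (hm : m.Fits (2 ^ t) B) (hs : m.Sized t) {a : Fin K} {l : List (Fin K)}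
    (hst : m.stack = a :: l) (ha : a ∉ l) :
    ∃ m' : Memory (Fin K), m'.Fits (2 ^ t) B ∧ m.Pop t a m' := by
  have hlen := hm.stack_le
  rw [hst, List.length_cons] at hlen
  have hbag : ∀ A A' : Table (Fin K), m.bag.erase (some a) = (⟨l, A, A'⟩ : Memory (Fin K)).bag := by
    intro A A'
    rw [bag_cons (m := ⟨l, A, A'⟩) hst, Finset.erase_insert]
    rwa [some_mem_bag]
  have hcard : (m.bag.erase (some a)).card ≤ 2 ^ t + 1 := by
    rw [hbag [] []]
    refine (card_bag_le _).trans ?_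
    show l.length + 1 ≤ _
    omega
  obtain ⟨A, hA, hlenA, hAt⟩ := isForget_exists_tidy hcard hs hm.current_tidy hB.2.2
  refine ⟨⟨l, m.current, A⟩, ⟨?_, hm.current_le, hlenA, hm.current_tidy,
    fun P hP => (hAt P hP).1⟩, hst, rfl, hA, ?_, ?_⟩
  · show l.length ≤ _
    omega
  · rintro b (hb | ⟨P, hP | hP, hb⟩)
    · exact Or.inl (hst ▸ List.mem_cons_of_mem _ hb)
    · exact Or.inr ⟨P, Or.inr hP, hb⟩
    · obtain ⟨P', hP', hsub⟩ := (hAt P hP).2.1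
      exact Or.inr ⟨P', Or.inr hP', hsub hb⟩
  · intro P hP
    rw [← hbag]
    exact (hAt P hP).2.2

end Exists

section Decode

variable {K n t : ℕ} {r : Fin K → ℕ} {m m' : Memory (Fin K)}

theorem uses_of_mem_bag {a : Fin K} (h : some a ∈ m.bag) : m.Uses a := Or.inl (some_mem_bag.1 h)

/-- The control computes with the graph on names read from the matrix. Decoding is an isomorphism on
everything in use, so the result is a table of `intro` for `G` itself. -/
theorem Push.isIntro {A : Fin K → Fin K → Bool} {c : Fin K} (h : m.Push t (namesGraph A) c m')
    (hs : m.Sized t) {G : SimpleGraph (Fin n)} (hr : ValidNames n r {a | a = c ∨ m.Uses a})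
    (hA : ∀ a b, A a b = true ↔ ∃ u v, G.Adj u v ∧ r a = u.val + 1 ∧ r b = v.val + 1) :
    IsIntro (t + 1) (rootedGraph G) (decodeMemory n r m).current (decodeMemory n r m).bag
      (nameVertex n r (some c)) (decodeMemory n r m').current := by
  have hmem : ∀ a, some a ∈ insert (some c) m.bag → a ∈ {a | a = c ∨ m.Uses a} := by
    intro a ha
    exact (Finset.mem_insert.1 ha).imp (Option.some_injective _ ·) uses_of_mem_bag
  rw [(hr.mono fun a ha => Or.inr ha).bag_decode]
  refine h.current.transport (decodePD n r) (τ := nameNode n r) (fun P hP => ⟨(hs P hP).1, ?_⟩) ?_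
    (hr.injOn hmem) m.none_mem_bag rfl ?_
  · exact decodePD_isIso hr fun a ha => Or.inr (Or.inr ⟨P, Or.inr hP, ha⟩)
  · exact fun P hP => decodePD_isIso hr fun a ha => h.uses a (Or.inr ⟨P, Or.inr hP, ha⟩)
  · intro x hx y hy
    refine hr.rootedGraph_adj hA ?_ ?_
    · rintro a rfl; exact hmem a hx
    · rintro a rfl; exact hmem a hy

theorem Pop.isForget {a : Fin K} (h : m.Pop t a m')
    (hs : m.Sized t) (hr : ValidNames n r {a | m.Uses a}) :
    IsForget (decodeMemory n r m).current (decodeMemory n r m).bag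
      (nameVertex n r (some a)) (decodeMemory n r m').current := by
  rw [hr.bag_decode]
  refine h.current.transport (decodePD n r) (τ := nameNode n r)
    (fun P hP => ⟨(hs P hP).1, fun Q hQ => ?_⟩) (hr.injOn fun b hb => ?_)
  · exact decodePD_isIso hr fun b hb => Or.inr ⟨P, Or.inr hP, hQ hb⟩
  · rcases Finset.mem_insert.1 hb with hb | hb
    · rw [Option.some_injective _ hb]
      exact Or.inl (h.stack ▸ List.mem_cons_self)
    · exact uses_of_mem_bag hb

end Decode

end Memory

/-! ### The program -/

/-- The registers of the program: constants, the number of vertices, the last child that was left,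
the vertices with names, and the vertices of a walk. -/
inductive SearchReg (K L : ℕ) where
  | zero
  | one
  | size
  | low
  | name (a : Fin K)
  | walk (i : Fin (L + 1))

theorem SearchReg.finite (K L : ℕ) : Finite (SearchReg K L) := by
  let f : SearchReg K L → Fin 4 ⊕ Fin K ⊕ Fin (L + 1) := fun x =>
    match x with
    | .zero => .inl 0
    | .one => .inl 1
    | .size => .inl 2
    | .low => .inl 3
    | .name a => .inr (.inl a)
    | .walk i => .inr (.inr i)
  refine Finite.of_injective f ?_
  intro a b h
  cases a <;> cases b <;> simp_all [f]

namespace SearchProgram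

open PatternMachine (same)

variable (t B : ℕ)

/-- The number of names. -/
abbrev numNames : ℕ := 2 ^ t + 2 * B * B + 1

/-- The memories that occur. -/
abbrev Display : Type := {m : Memory (Fin (numNames t B)) // m.Fits (2 ^ t) B}

abbrev Reg : Type := SearchReg (numNames t B) (2 ^ t)

variable {t B}

/-- A name that is not in use. -/
noncomputable def unused (m : Display t B) : Fin (numNames t B) :=
  (m.2.exists_not_uses (Nat.lt_succ_self _)).choose

theorem not_uses_unused (m : Display t B) : ¬ m.1.Uses (unused m) :=
  (m.2.exists_not_uses (Nat.lt_succ_self _)).choose_spec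

/-- The register is not in the stack. -/
def Off (lt : Reg t B → Reg t B → Bool) (m : Display t B) (x : Reg t B) : Prop :=
  ∀ a ∈ m.1.stack, same lt (.name a) x = false

/-- The register is adjacent to the top of the stack, if there is one. -/
def NearTop (adj : Reg t B → Reg t B → Bool) (m : Display t B) (x : Reg t B) : Prop :=
  ∀ a ∈ m.1.stack.head?, adj (.name a) x = true

/-- The unused name is that of a vertex which the search might discover. -/
def Candidate (lt adj : Reg t B → Reg t B → Bool) (m : Display t B) : Prop :=
  lt .zero (.name (unused m)) = true ∧ Off lt m (.name (unused m)) ∧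
    NearTop adj m (.name (unused m))

/-- The walk shows that the candidate was discovered before. -/
def Reaches (lt adj : Reg t B → Reg t B → Bool) (m : Display t B) : Prop :=
  same lt (.walk 0) (.name (unused m)) = true ∧
  (∀ i : Fin (2 ^ t), same lt (.walk i.castSucc) (.walk i.succ) = true ∨
    adj (.walk i.castSucc) (.walk i.succ) = true) ∧
  (∀ i, Off lt m (.walk i)) ∧ lt .zero (.walk (Fin.last _)) = true ∧
  lt .low (.walk (Fin.last _)) = false ∧ NearTop adj m (.walk (Fin.last _))

/-- The last walk has been tried. -/
def LastWalk (lt : Reg t B → Reg t B → Bool) : Prop :=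
  ∀ i : Fin (2 ^ t + 1), same lt (.walk i) .size = true

open Classical in
/-- The memory after a vertex was discovered. -/
noncomputable def push (adj : Reg t B → Reg t B → Bool) (m : Display t B) : Display t B :=
  if h : ∃ m' : Memory (Fin (numNames t B)), m'.Fits (2 ^ t) B ∧
      m.1.Push t (namesGraph fun a b => adj (.name a) (.name b)) (unused m) m'
  then ⟨h.choose, h.choose_spec.1⟩ else m

open Classical in
/-- The memory after the top of the stack was left. -/
noncomputable def pop (m : Display t B) (a : Fin (numNames t B)) : Display t B :=
  if h : ∃ m' : Memory (Fin (numNames t B)), m'.Fits (2 ^ t) B ∧ m.1.Pop t a m'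
  then ⟨h.choose, h.choose_spec.1⟩ else m

open Classical in
/-- The next walk. -/
noncomputable def nextWalk (lt : Reg t B → Reg t B → Bool) : Reg t B → Reg t B × Bool
  | .walk i =>
    if ∀ j < i, same lt (.walk j) .size = true then
      if same lt (.walk i) .size = true then (.zero, false) else (.walk i, true)
    else (.walk i, false)
  | x => (x, false)

open Classical in
/-- The assignment that starts the search in a new memory. -/
noncomputable def restart (m : Display t B) (src : Reg t B) : Reg t B → Reg t B × Bool
  | .low => (src, false)
  | .name a => if a = unused m then (.zero, false) else (.name a, false)
  | .walk _ => (.zero, false)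
  | x => (x, false)

open Classical in
/-- The assignment that passes to the next candidate. -/
noncomputable def nextCandidate (m : Display t B) : Reg t B → Reg t B × Bool
  | .name a => if a = unused m then (.name a, true) else (.name a, false)
  | .walk _ => (.zero, false)
  | x => (x, false)

/-- The initial memory. -/
def initialMemory (hB : 1 ≤ B) : Display t B :=
  ⟨⟨[], [], [PartialDecomposition.leaf _]⟩, Nat.zero_le _, Nat.zero_le _, hB, by simp, by
    simpa using PartialDecomposition.leaf_tidy _ hB⟩

open Classical in
/-- The program. It first determines the number of vertices. Then, in each memory, it tries all
candidates for the next vertex of the search and, for each of them, all walks that could show that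
the candidate was discovered before. -/
noncomputable def programStep (hB : 1 ≤ B) : Option (Display t B × Bool) →
    (Reg t B → Reg t B → Bool) → (Reg t B → Reg t B → Bool) → Bool →
    Bool ⊕ (Option (Display t B × Bool) × (Reg t B → Reg t B × Bool))
  | none, _, _, ov =>
    if ov = true then .inr (none, fun x => match x with
      | .size => (.size, true)
      | x => (x, false))
    else .inr (some (initialMemory hB, false), fun x => (x, false))
  | some (m, bad), lt, adj, _ =>
    if ¬ LastWalk lt then .inr (some (m, bad || decide (Reaches lt adj m)), nextWalk lt)
    else if Candidate lt adj m ∧ ¬ (bad = true ∨ Reaches lt adj m) then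
      if 2 ^ t < m.1.stack.length + 1 then .inl false
      else .inr (some (push adj m, false), restart (push adj m) .zero)
    else if same lt (.name (unused m)) .size = true then
      match m.1.stack with
      | [] => .inl (!m.1.current.isEmpty)
      | a :: _ => .inr (some (pop m a, false), restart (pop m a) (.name a))
    else .inr (some (m, false), nextCandidate m)

/-- The machine that executes the program. -/
noncomputable abbrev program (hB : 1 ≤ B) : PatternMachine (Reg t B) where
  State := Option (Display t B × Bool)
  start := none
  size := .size
  one := .one
  transition := programStep hB

/-- The memory shown in a state. -/
def shown (hB : 1 ≤ B) : Option (Display t B × Bool) → Display t B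
  | none => initialMemory hB
  | some (m, _) => m

/-- The registers on which the shown memory depends. -/
def keep (hB : 1 ≤ B) (q : Option (Display t B × Bool)) : Set (Reg t B) :=
  {x | ∃ a, (shown hB q).1.Uses a ∧ x = .name a}

theorem not_uses_initialMemory (hB : 1 ≤ B) (a : Fin (numNames t B)) :
    ¬ (initialMemory hB : Display t B).1.Uses a := by
  rintro (h | ⟨P, h | h, h'⟩)
  · cases h
  · cases h
  · rw [List.mem_singleton.1 h] at h'
    cases Finset.mem_singleton.1 h'

theorem finite_state (hB : 1 ≤ B) : Finite (program (t := t) hB).State := by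
  have : Finite (Display t B) := Memory.finite_fits (Fin (numNames t B)) (2 ^ t) B
  exact inferInstanceAs (Finite (Option (Display t B × Bool)))

theorem one_notMem_keep (hB : 1 ≤ B) (q : (program (t := t) hB).State) :
    (program (t := t) hB).one ∉ keep hB q := by
  rintro ⟨a, -, ha⟩
  cases ha

theorem restart_name {m : Display t B} {src : Reg t B} {a : Fin (numNames t B)} (ha : m.1.Uses a) :
    restart m src (.name a) = (.name a, false) := by
  have : a ≠ unused m := by rintro rfl; exact not_uses_unused m ha
  simp [restart, this]

/-- A transition alters a name register only when that name is unused in the memory shown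
afterwards. This is what the layers below require for a steady display. -/
theorem upd_spec (hB : 1 ≤ B) (q : (program (t := t) hB).State) (lt adj : Reg t B → Reg t B → Bool)
    (ov : Bool) (q' : (program (t := t) hB).State) (upd : Reg t B → Reg t B × Bool)
    (h : (program (t := t) hB).transition q lt adj ov = .inr (q', upd)) :
    upd .one = (.one, false) ∧ ∀ x ∈ keep hB q', upd x = (x, false) := by
  have hsplit : ∀ {p : Option (Display t B × Bool)} {f : Reg t B → Reg t B × Bool},
      (Sum.inr (p, f) : Bool ⊕ _) = .inr (q', upd) → f .one = (.one, false) →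
      (∀ a, (shown hB p).1.Uses a → f (.name a) = (.name a, false)) →
      upd .one = (.one, false) ∧ ∀ x ∈ keep hB q', upd x = (x, false) := by
    intro p f hpf h1 h2
    simp only [Sum.inr.injEq] at hpf
    obtain ⟨rfl, rfl⟩ := hpf
    refine ⟨h1, ?_⟩
    rintro _ ⟨a, ha, rfl⟩
    exact h2 a ha
  rcases q with _ | ⟨m, bad⟩
  · simp only [programStep] at h
    split_ifs at h with h1
    · exact hsplit h rfl fun a _ => rfl
    · exact hsplit h rfl fun a _ => rfl
  · simp only [programStep] at h
    split_ifs at h with h1 h2 h3 h4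
    · exact hsplit h rfl fun a ha => restart_name ha
    · cases hst : m.1.stack with
      | nil => rw [hst] at h; cases h
      | cons a l =>
        rw [hst] at h
        exact hsplit h rfl fun a ha => restart_name ha
    · refine hsplit h rfl fun a ha => ?_
      have : a ≠ unused m := by rintro rfl; exact not_uses_unused m ha
      simp [nextCandidate, this]
    · exact hsplit h rfl fun a _ => rfl

end SearchProgram

/-! ### The input -/

theorem encodeGraph_eq {n : ℕ} (G : SimpleGraph (Fin n)) [DecidableRel G.Adj] :
    encodeGraph G = List.ofFn fun p : Fin (n * n) => decide (G.Adj p.divNat p.modNat) := by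
  rw [List.ofFn_mul]
  unfold encodeGraph
  congr 2
  funext i
  congr 1
  funext j
  have hj := j.2
  have hn : 0 < n := (Nat.zero_le _).trans_lt hj
  have h1 : (⟨i * n + j, by calc
      i * n + j < (i + 1) * n := by rw [add_mul, one_mul]; omega
      _ ≤ n * n := Nat.mul_le_mul_right _ i.2⟩ : Fin (n * n)).divNat = i := by
    ext
    simp only [Fin.coe_divNat]
    rw [mul_comm, Nat.mul_add_div hn, Nat.div_eq_of_lt hj, add_zero]
  have h2 : (⟨i * n + j, by calc
      i * n + j < (i + 1) * n := by rw [add_mul, one_mul]; omega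
      _ ≤ n * n := Nat.mul_le_mul_right _ i.2⟩ : Fin (n * n)).modNat = j := by
    ext
    simp only [Fin.coe_modNat]
    rw [mul_comm, Nat.mul_add_mod, Nat.mod_eq_of_lt hj]
  rw [h1, h2]
  exact decide_eq_decide.2 Iff.rfl

theorem length_encodeGraph {n : ℕ} (G : SimpleGraph (Fin n)) :
    (encodeGraph G).length = n * n := by
  classical
  rw [encodeGraph_eq, List.length_ofFn]

namespace PatternMachine

theorem entries_encodeGraph {Reg : Type} {n : ℕ} (G : SimpleGraph (Fin n)) (r : Reg → ℕ)
    (i j : Reg) : entries (encodeGraph G) n r (encodeGraph G).length i j = true ↔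
      ∃ u v, G.Adj u v ∧ r i = u.val + 1 ∧ r j = v.val + 1 := by
  classical
  unfold entries
  rw [decide_eq_true_eq, length_encodeGraph, encodeGraph_eq]
  constructor
  · rintro ⟨p, hp, hw, hi, hj⟩
    rw [List.getElem?_ofFn, dif_pos hp, Option.some_inj, decide_eq_true_eq] at hw
    exact ⟨_, _, hw, hi, hj⟩
  · rintro ⟨u, v, huv, hi, hj⟩
    have hn : 0 < n := (Nat.zero_le _).trans_lt v.2
    have hp : u.val * n + v.val < n * n := by
      calc u.val * n + v.val < (u.val + 1) * n := by rw [add_mul, one_mul]; exact Nat.add_lt_add_left v.2 _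
        _ ≤ n * n := Nat.mul_le_mul_right _ u.2
    have h1 : (u.val * n + v.val) / n = u := by
      rw [mul_comm, Nat.mul_add_div hn, Nat.div_eq_of_lt v.2, add_zero]
    have h2 : (u.val * n + v.val) % n = v := by
      rw [mul_comm, Nat.mul_add_mod, Nat.mod_eq_of_lt v.2]
    refine ⟨_, hp, ?_, by rw [h1, hi], by rw [h2, hj]⟩
    rw [List.getElem?_ofFn, dif_pos hp, Option.some_inj, decide_eq_true_eq]
    have e1 : (⟨u.val * n + v.val, hp⟩ : Fin (n * n)).divNat = u := Fin.ext h1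
    have e2 : (⟨u.val * n + v.val, hp⟩ : Fin (n * n)).modNat = v := Fin.ext h2
    rw [e1, e2]
    exact huv

/-- Position `k * k` is the first of row `k + 1` when the rows have length `k`. Increasing `k` until
no row is left over therefore finds `n`. -/
theorem overflow_sq {n k : ℕ} : overflow k (n * n) = true ↔ k < n := by
  unfold overflow
  rw [decide_eq_true_eq]
  constructor
  · rintro ⟨p, hp, hk⟩
    by_contra hkn
    push Not at hkn
    have : p / k < k := by
      rw [Nat.div_lt_iff_lt_mul]
      · exact hp.trans_le (Nat.mul_le_mul hkn hkn)
      · rcases Nat.eq_zero_or_pos k with rfl | h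
        · obtain rfl : n = 0 := by omega
          omega
        · exact h
    omega
  · intro h
    refine ⟨k * k, Nat.mul_lt_mul'' h h, ?_⟩
    rcases Nat.eq_zero_or_pos k with rfl | h
    · simp
    · rw [Nat.mul_div_cancel _ h]; exact Nat.lt_succ_self _

end PatternMachine

/-! ### Counting through tuples -/

/-- The digits of `v` in base `b`. -/
def digit (b v i : ℕ) : ℕ := v / b ^ i % b

theorem digit_zero (b i : ℕ) : digit b 0 i = 0 := by simp [digit]

theorem digit_lt {b : ℕ} (hb : 0 < b) (v i : ℕ) : digit b v i < b := Nat.mod_lt _ hb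

/-- The rule of an odometer: a carry arrives at position `i` exactly if all lower digits are
maximal. -/
theorem succ_div_pow (n v : ℕ) : ∀ i, (v + 1) / (n + 1) ^ i =
    v / (n + 1) ^ i + if ∀ j < i, digit (n + 1) v j = n then 1 else 0 := by
  intro i
  induction i with
  | zero => simp
  | succ i ih =>
    rw [pow_succ, ← Nat.div_div_eq_div_mul, ← Nat.div_div_eq_div_mul, ih]
    have hsplit : (∀ j < i + 1, digit (n + 1) v j = n) ↔
        (∀ j < i, digit (n + 1) v j = n) ∧ v / (n + 1) ^ i % (n + 1) = n := by
      constructor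
      · exact fun h => ⟨fun j hj => h j (by omega), h i (by omega)⟩
      · intro h j hj
        rcases Nat.lt_succ_iff_lt_or_eq.1 hj with hj | rfl
        · exact h.1 j hj
        · exact h.2
    simp only [hsplit]
    by_cases h : ∀ j < i, digit (n + 1) v j = n
    · rw [if_pos h, if_congr (and_iff_right h) rfl rfl]
      rw [Nat.succ_div]
      congr 1
      have : n + 1 ∣ v / (n + 1) ^ i + 1 ↔ v / (n + 1) ^ i % (n + 1) = n := by
        rw [Nat.dvd_iff_mod_eq_zero, Nat.add_mod]
        have := Nat.mod_lt (v / (n + 1) ^ i) (Nat.succ_pos n)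
        generalize v / (n + 1) ^ i % (n + 1) = a at *
        constructor
        · intro h
          by_contra hne
          rcases Nat.eq_zero_or_pos n with rfl | hn
          · omega
          rw [Nat.mod_eq_of_lt (show 1 < n + 1 by omega), Nat.mod_eq_of_lt (by omega)] at h
          omega
        · rintro rfl
          simp
      simp only [this]
    · rw [if_neg h, if_neg fun h' => h h'.1, add_zero, add_zero]

theorem digit_succ (n v i : ℕ) : digit (n + 1) (v + 1) i =
    if ∀ j < i, digit (n + 1) v j = n then
      if digit (n + 1) v i = n then 0 else digit (n + 1) v i + 1
    else digit (n + 1) v i := by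
  unfold digit
  rw [succ_div_pow]
  by_cases h : ∀ j < i, digit (n + 1) v j = n
  · have h' := h
    unfold digit at h'
    rw [if_pos h, if_pos h']
    have := Nat.mod_lt (v / (n + 1) ^ i) (Nat.succ_pos n)
    rw [Nat.add_mod]
    generalize v / (n + 1) ^ i % (n + 1) = a at *
    split_ifs with ha
    · subst ha; simp
    · rcases Nat.eq_zero_or_pos n with rfl | hn
      · omega
      rw [Nat.mod_eq_of_lt (show 1 < n + 1 by omega), Nat.mod_eq_of_lt (by omega)]
  · have h' := h
    unfold digit at h'
    rw [if_neg h, if_neg h', add_zero]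

/-- Every tuple is a tuple of digits. -/
theorem exists_digit_eq (n m : ℕ) (f : Fin m → ℕ) (hf : ∀ i, f i ≤ n) :
    ∃ v < (n + 1) ^ m, ∀ i : Fin m, digit (n + 1) v i = f i := by
  refine ⟨finFunctionFinEquiv fun i => (⟨f i, Nat.lt_succ_of_le (hf i)⟩ : Fin (n + 1)),
    Fin.is_lt _, fun i => ?_⟩
  have := congrFun (finFunctionFinEquiv.symm_apply_apply
    fun i => (⟨f i, Nat.lt_succ_of_le (hf i)⟩ : Fin (n + 1))) i
  have := congrArg Fin.val this
  exact this

/-- Tells from the walk registers alone that all tuples have been tried. -/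
theorem digit_eq_max_iff (n m v : ℕ) (hv : v < (n + 1) ^ m) :
    (∀ i < m, digit (n + 1) v i = n) ↔ v + 1 = (n + 1) ^ m := by
  have h := succ_div_pow n v m
  rw [Nat.div_eq_of_lt hv, zero_add] at h
  have hpos : 0 < (n + 1) ^ m := by positivity
  constructor
  · intro hd
    rw [if_pos hd] at h
    have := (Nat.div_eq_iff hpos).1 h
    omega
  · intro hv'
    by_contra hd
    rw [if_neg hd, hv', Nat.div_self hpos] at h
    cases h

/-! ### The walks tried for a candidate -/

namespace SearchProgram

open PatternMachine (same same_order entries overflow entries_encodeGraph)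
open RegMachine (order assign)
open AlgState

variable {t B n : ℕ}

/-- The contents of the registers. -/
def regs (n w : ℕ) (ρ : Fin (numNames t B) → ℕ) (f : Fin (2 ^ t + 1) → ℕ) : Reg t B → ℕ
  | .zero => 0
  | .one => 1
  | .size => n
  | .low => w
  | .name a => ρ a
  | .walk i => f i

/-- The memory represented by a configuration. -/
noncomputable def memoryOf (n : ℕ) (hB : 1 ≤ B) (q : Option (Display t B × Bool)) (r : Reg t B → ℕ) :
    Memory (Fin n) := decodeMemory n (fun a => r (.name a)) (shown hB q).1

/-- The run of the program on the graph `G`. -/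
abbrev Run (hB : 1 ≤ B) (G : SimpleGraph (Fin n)) (c : (program (t := t) hB).Config)
    (l : List (Memory (Fin n))) (b : Bool) : Prop :=
  Produces ((program (t := t) hB).sysStep (encodeGraph G)) (fun c => memoryOf n hB c.state c.reg)
    (fun c => ∀ i, c.reg i ≤ n * n + 1) c l b

/-- The matrix entries seen by the program. -/
noncomputable abbrev seenAdj (G : SimpleGraph (Fin n)) (r : Reg t B → ℕ) : Reg t B → Reg t B → Bool :=
  entries (encodeGraph G) n r (encodeGraph G).length

/-! ### What the tests of the program say about the graph -/

section Observations

variable {G : SimpleGraph (Fin n)} {r : Reg t B → ℕ} {m : Display t B}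

theorem off_iff {x : Reg t B} {v : Fin n} (hx : r x = v + 1) : Off (order r) m x ↔
    v ∉ (decodeMemory n (fun a => r (.name a)) m.1).stack := by
  rw [mem_decode_stack]
  unfold Off
  simp only [same_order, decide_eq_false_iff_not, hx, not_exists, not_and]

theorem nearTop_iff (hr : ValidNames n (fun a => r (.name a)) {a | m.1.Uses a}) {x : Reg t B}
    {v : Fin n} (hx : r x = v + 1) : NearTop (seenAdj G r) m x ↔
    Near G (decodeMemory n (fun a => r (.name a)) m.1).stack v := by
  unfold NearTop Near
  obtain ⟨⟨st, p, c⟩, hm⟩ := m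
  cases st with
  | nil => simp [decodeMemory]
  | cons a l =>
    obtain ⟨u, hu, hst⟩ := hr.decode_stack_cons (a := a) (l := l) (p := p) (p' := p) (c := c) (c' := c)
      (Or.inl List.mem_cons_self)
    rw [hst]
    simp only [List.head?_cons, Option.mem_def, Option.some.injEq, forall_eq']
    rw [entries_encodeGraph, hu, hx]
    constructor
    · rintro ⟨u', v', h, hu', hv'⟩
      have h1 : u = u' := Fin.ext (by omega)
      have h2 : v = v' := Fin.ext (by omega)
      rwa [h1, h2]
    · exact fun h => ⟨u, v, h, rfl, rfl⟩

/-- The registers start at the candidate, and each step is an equality or a matrix entry, which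
forces the next content to be the number of a vertex. So all walk registers hold vertices. -/
theorem walks_of_reaches (hr : ValidNames n (fun a => r (.name a)) {a | m.1.Uses a})
    {u : Fin n} (hu : r (.name (unused m)) = u + 1)
    (h : Reaches (order r) (seenAdj G r) m) :
    ∃ y : Fin n, y.val + 1 ≤ r .low ∧
      Near G (decodeMemory n (fun a => r (.name a)) m.1).stack y ∧
      Walks G (2 ^ t) (decodeMemory n (fun a => r (.name a)) m.1).stack u y := by
  obtain ⟨hstart, hstep, hoff, -, hlow, hnear⟩ := h
  simp only [same_order, decide_eq_true_eq, entries_encodeGraph] at hstart hstep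
  have hex : ∀ i : Fin (2 ^ t + 1), ∃ v : Fin n, r (.walk i) = v + 1 := by
    intro i
    induction i using Fin.induction with
    | zero => exact ⟨u, hstart.trans hu⟩
    | succ i ih =>
      rcases hstep i with h | ⟨_, v, _, _, h⟩
      · rwa [← h]
      · exact ⟨v, h⟩
  choose p hp using hex
  have hlt : ∀ i, min i (2 ^ t) < 2 ^ t + 1 := fun i => by omega
  refine ⟨p (Fin.last _), ?_, (nearTop_iff hr (hp _)).1 hnear, fun i => p ⟨min i (2 ^ t), hlt i⟩,
    ?_, ?_, fun i hi => ?_, fun i _ => ?_⟩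
  · rw [← hp]
    simpa [order] using hlow
  · have := hp 0
    have h1 : (⟨min 0 (2 ^ t), hlt 0⟩ : Fin (2 ^ t + 1)) = 0 := Fin.ext (by simp)
    simp only [h1]
    exact Fin.ext (by omega)
  · exact congrArg p (Fin.ext (min_self _))
  · have h1 : (⟨min i (2 ^ t), hlt i⟩ : Fin (2 ^ t + 1)) = Fin.castSucc ⟨i, hi⟩ :=
      Fin.ext (by simp; omega)
    have h2 : (⟨min (i + 1) (2 ^ t), hlt (i + 1)⟩ : Fin (2 ^ t + 1)) = Fin.succ ⟨i, hi⟩ :=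
      Fin.ext (by simp; omega)
    simp only [h1, h2]
    rcases hstep ⟨i, hi⟩ with h | ⟨a, b, hab, ha, hb⟩
    · left
      rw [hp, hp] at h
      exact Fin.ext (by omega)
    · right
      rw [hp] at ha hb
      rw [show p (Fin.castSucc ⟨i, hi⟩) = a from Fin.ext (by omega),
        show p (Fin.succ ⟨i, hi⟩) = b from Fin.ext (by omega)]
      exact hab
  · exact (off_iff (hp _)).1 (hoff _)

/-- Vertex `v` is stored as `v + 1`, and a walk of `2 ^ t` steps, possibly stationary, fills the
registers exactly. -/
theorem reaches_of_walks (hr : ValidNames n (fun a => r (.name a)) {a | m.1.Uses a})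
    (h0 : r .zero = 0) {p : ℕ → Fin n} (hp : ∀ i : Fin (2 ^ t + 1), r (.walk i) = p i + 1)
    (hu : r (.name (unused m)) = p 0 + 1) (hlow : (p (2 ^ t)).val + 1 ≤ r .low)
    (hnear : Near G (decodeMemory n (fun a => r (.name a)) m.1).stack (p (2 ^ t)))
    (hstep : ∀ i < 2 ^ t, p i = p (i + 1) ∨ G.Adj (p i) (p (i + 1)))
    (hoff : ∀ i ≤ 2 ^ t, p i ∉ (decodeMemory n (fun a => r (.name a)) m.1).stack) :
    Reaches (order r) (seenAdj G r) m := by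
  refine ⟨?_, fun i => ?_, fun i => ?_, ?_, ?_, ?_⟩
  · rw [same_order, hp, hu, decide_eq_true_eq]; rfl
  · rw [same_order, entries_encodeGraph, decide_eq_true_eq, hp, hp]
    refine (hstep i i.2).imp (fun h => ?_) fun h => ?_
    · simp only [Fin.val_castSucc, Fin.val_succ, h]
    · exact ⟨_, _, h, by simp, by simp⟩
  · exact (off_iff (hp i)).2 (hoff i (Nat.lt_succ_iff.1 i.2))
  · simp [order, h0, hp]
  · simpa [order, hp] using hlow
  · exact (nearTop_iff hr (hp _)).2 (by simpa using hnear)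

end Observations

/-! ### The loop over all walks -/

section Loop

variable {G : SimpleGraph (Fin n)} {m : Display t B} {ρ : Fin (numNames t B) → ℕ} {w : ℕ}

/-- The registers when walk number `v` is tried. -/
def walkRegs (n w : ℕ) (ρ : Fin (numNames t B) → ℕ) (v : ℕ) : Reg t B → ℕ :=
  regs n w ρ fun i => digit (n + 1) v i

/-- Walk number `v` shows that the candidate was discovered before. -/
def ReachedBy (G : SimpleGraph (Fin n)) (m : Display t B) (w : ℕ) (ρ : Fin (numNames t B) → ℕ)
    (v : ℕ) : Prop :=
  Reaches (order (walkRegs n w ρ v)) (seenAdj G (walkRegs n w ρ v)) m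

/-- Every filling of the walk registers by numbers up to `n` is a tuple of digits in base `n + 1`,
so counting through the tuples misses no walk. -/
theorem exists_reachedBy_iff (hr : ValidNames n ρ {a | m.1.Uses a}) {u : Fin n}
    (hu : ρ (unused m) = u + 1) :
    (∃ v < (n + 1) ^ (2 ^ t + 1), ReachedBy G m w ρ v) ↔
      ∃ y : Fin n, y.val + 1 ≤ w ∧ Near G (decodeMemory n ρ m.1).stack y ∧
        Walks G (2 ^ t) (decodeMemory n ρ m.1).stack u y := by
  constructor
  · rintro ⟨v, -, hv⟩
    exact walks_of_reaches (r := walkRegs n w ρ v) hr hu hv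
  · rintro ⟨y, hyw, hy, p, hp0, hpL, hp, hoff⟩
    obtain ⟨v, hv, hd⟩ := exists_digit_eq n (2 ^ t + 1) (fun i => p i + 1) fun i => (p i).2
    refine ⟨v, hv, reaches_of_walks (r := walkRegs n w ρ v) (p := p) hr rfl hd ?_ ?_ ?_ hp hoff⟩
    · rw [hp0]; exact hu
    · rw [hpL]; exact hyw
    · rw [hpL]; exact hy

/-- The candidate is to be discovered next. -/
def Accepts (G : SimpleGraph (Fin n)) (m : Display t B) (w : ℕ) (ρ : Fin (numNames t B) → ℕ) :
    Prop :=
  Candidate (order (walkRegs n w ρ ((n + 1) ^ (2 ^ t + 1) - 1)))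
      (seenAdj G (walkRegs n w ρ ((n + 1) ^ (2 ^ t + 1) - 1))) m ∧
    ¬ ∃ v < (n + 1) ^ (2 ^ t + 1), ReachedBy G m w ρ v

/-- This is `SearchInv.mem_choices_iff`, with `W` given by the register `low`: the program decides
without the set of discovered vertices whether the search may discover the candidate. The content
`0` names no vertex and is rejected. -/
theorem accepts_iff (hr : ValidNames n ρ {a | m.1.Uses a}) (hρ : ρ (unused m) ≤ n)
    {s : AlgState (Fin n)} (hs : s.memory = decodeMemory n ρ m.1)
    (hI : SearchInv (2 ^ t) G s {v | v.val + 1 ≤ w}) :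
    Accepts G m w ρ ↔ ∃ u : Fin n, ρ (unused m) = u + 1 ∧ u ∈ s.choices G := by
  have key : ∀ u : Fin n, ρ (unused m) = u + 1 → (Accepts G m w ρ ↔ u ∈ s.choices G) := by
    intro u hu
    set r := walkRegs n w ρ ((n + 1) ^ (2 ^ t + 1) - 1) with hrdef
    have hu' : r (.name (unused m)) = u + 1 := hu
    have h0 : order r .zero (.name (unused m)) = true := by
      simp only [order, hu', decide_eq_true_eq]
      exact Nat.succ_pos _
    unfold Accepts Candidate
    rw [hI.mem_choices_iff, exists_reachedBy_iff hr hu, ← hrdef, off_iff hu',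
      nearTop_iff (r := r) hr hu', hs]
    simp only [h0, true_and, and_assoc]
    rfl
  constructor
  · intro h
    have h0 := h.1.1
    simp only [order, decide_eq_true_eq] at h0
    have h0 : 0 < ρ (unused m) := h0
    have hu : ρ (unused m) = (⟨ρ (unused m) - 1, by omega⟩ : Fin n).val + 1 := by
      simp only; omega
    exact ⟨_, hu, (key _ hu).1 h⟩
  · rintro ⟨u, hu, h⟩
    exact (key u hu).2 h

theorem walkRegs_le (hw : w ≤ n) (hρ : ∀ a, ρ a ≤ n) (v : ℕ) :
    ∀ i : Reg t B, walkRegs n w ρ v i ≤ n * n + 1 := by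
  have hn : n ≤ n * n + 1 := (Nat.le_mul_self n).trans (Nat.le_succ _)
  intro i
  cases i with
  | zero => exact Nat.zero_le _
  | one => exact Nat.succ_le_succ (Nat.zero_le _)
  | size => exact hn
  | low => exact hw.trans hn
  | name a => exact (hρ a).trans hn
  | walk i => exact (Nat.lt_succ_iff.1 (digit_lt (Nat.succ_pos n) v i)).trans hn

theorem lastWalk_iff {v : ℕ} (hv : v < (n + 1) ^ (2 ^ t + 1)) :
    LastWalk (order (walkRegs n w ρ v) : Reg t B → Reg t B → Bool) ↔
      v + 1 = (n + 1) ^ (2 ^ t + 1) := by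
  rw [← digit_eq_max_iff n _ v hv]
  unfold LastWalk
  simp only [same_order, decide_eq_true_eq]
  exact ⟨fun h i hi => h ⟨i, hi⟩, fun h i => h i i.2⟩

theorem assign_nextWalk (v : ℕ) :
    assign (walkRegs n w ρ v) (nextWalk (order (walkRegs n w ρ v))) =
      (walkRegs n w ρ (v + 1) : Reg t B → ℕ) := by
  funext x
  cases x with
  | walk i =>
    show _ = digit (n + 1) (v + 1) i
    rw [digit_succ]
    have h1 : (∀ j < i, same (order (walkRegs n w ρ v : Reg t B → ℕ)) (.walk j) .size = true) ↔
        ∀ j < i.val, digit (n + 1) v j = n := by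
      simp only [same_order, decide_eq_true_eq]
      constructor
      · exact fun h j hj => h ⟨j, hj.trans i.2⟩ hj
      · exact fun h j hj => h j hj
    have h2 : (same (order (walkRegs n w ρ v : Reg t B → ℕ)) (.walk i) .size = true) ↔
        digit (n + 1) v i = n := by
      simp only [same_order, decide_eq_true_eq]
      rfl
    simp only [assign, nextWalk, h1, h2]
    split_ifs <;> rfl
  | _ => rfl

variable {hB : 1 ≤ B}

theorem sysStep_eq (q : Option (Display t B × Bool)) (r : Reg t B → ℕ) (hr : r .size = n) :
    (program (t := t) hB).sysStep (encodeGraph G) ⟨q, r⟩ =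
      (programStep hB q (order r) (seenAdj G r) (overflow n (n * n))).map id
        fun y => ⟨y.1, assign r y.2⟩ := by
  unfold PatternMachine.sysStep
  simp only [seenAdj, hr, length_encodeGraph]

/-- The program tries all walks for a candidate. -/
theorem run_walks (hw : w ≤ n) (hρ : ∀ a, ρ a ≤ n) {l : List (Memory (Fin n))} {b : Bool}
    (h : ∀ bad : Bool, (bad = true ∨ ReachedBy G m w ρ ((n + 1) ^ (2 ^ t + 1) - 1) ↔
        ∃ v < (n + 1) ^ (2 ^ t + 1), ReachedBy G m w ρ v) →
      Run hB G ⟨some (m, bad), walkRegs n w ρ ((n + 1) ^ (2 ^ t + 1) - 1)⟩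
        (decodeMemory n ρ m.1 :: l) b) :
    Run hB G ⟨some (m, false), walkRegs n w ρ 0⟩ (decodeMemory n ρ m.1 :: l) b := by
  classical
  have hpos : 0 < (n + 1) ^ (2 ^ t + 1) := by positivity
  -- The flag records whether one of the walks before number `v` was successful; the last walk is
  -- tested separately by the deciding step.
  have key : ∀ e v, v + e = (n + 1) ^ (2 ^ t + 1) - 1 →
      Run hB G ⟨some (m, decide (∃ v' < v, ReachedBy G m w ρ v')), walkRegs n w ρ v⟩
        (decodeMemory n ρ m.1 :: l) b := by
    intro e
    induction e with
    | zero =>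
      intro v hv
      rw [Nat.add_zero] at hv
      subst hv
      refine h _ ?_
      rw [decide_eq_true_eq]
      constructor
      · rintro (⟨v, hv, h⟩ | h)
        · exact ⟨v, by omega, h⟩
        · exact ⟨_, by omega, h⟩
      · rintro ⟨v, hv, h⟩
        rcases Nat.lt_or_ge v ((n + 1) ^ (2 ^ t + 1) - 1) with hv' | hv'
        · exact Or.inl ⟨v, hv', h⟩
        · obtain rfl : v = (n + 1) ^ (2 ^ t + 1) - 1 := by omega
          exact Or.inr h
    | succ e ih =>
      intro v hv
      refine Produces.stay' ?_ (walkRegs_le hw hρ v) rfl (ih (v + 1) (by omega))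
      have hlast : ¬ LastWalk (order (walkRegs n w ρ v) : Reg t B → Reg t B → Bool) := by
        rw [lastWalk_iff (by omega)]
        omega
      refine (sysStep_eq _ _ rfl).trans ?_
      simp only [programStep, hlast, not_false_eq_true, if_true, Sum.map_inr]
      congr 2
      · congr 2
        rw [Bool.eq_iff_iff, Bool.or_eq_true, decide_eq_true_eq, decide_eq_true_eq,
          decide_eq_true_eq]
        constructor
        · rintro (⟨v', hv', h⟩ | h)
          · exact ⟨v', by omega, h⟩
          · exact ⟨v, by omega, h⟩
        · rintro ⟨v', hv', h⟩
          rcases Nat.lt_succ_iff_lt_or_eq.1 hv' with hv' | rfl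
          · exact Or.inl ⟨v', hv', h⟩
          · exact Or.inr h
      · exact assign_nextWalk v
  have := key _ 0 (Nat.zero_add _)
  simpa using this

end Loop

end SearchProgram

/-! ### The search -/

namespace SearchProgram

open PatternMachine (same same_order)
open RegMachine (order assign)
open AlgState Function

variable {t B n : ℕ} {G : SimpleGraph (Fin n)} {m : Display t B} {ρ : Fin (numNames t B) → ℕ}
  {w : ℕ} {hB : 1 ≤ B}

/-- The registers when the last walk is tried. -/
abbrev lastRegs (n w : ℕ) (ρ : Fin (numNames t B) → ℕ) : Reg t B → ℕ :=
  walkRegs n w ρ ((n + 1) ^ (2 ^ t + 1) - 1)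

-- At the last walk the recorded flag and the final test together say whether any walk succeeds, so
-- the branching depends only on the candidate and no longer on the walks.
open Classical in
theorem programStep_last {bad : Bool}
    (hbad : bad = true ∨ ReachedBy G m w ρ ((n + 1) ^ (2 ^ t + 1) - 1) ↔
      ∃ v < (n + 1) ^ (2 ^ t + 1), ReachedBy G m w ρ v) (ov : Bool) :
    programStep hB (some (m, bad)) (order (lastRegs n w ρ)) (seenAdj G (lastRegs n w ρ)) ov =
      if Accepts G m w ρ then
        if 2 ^ t < m.1.stack.length + 1 then .inl false
        else .inr (some (push (seenAdj G (lastRegs n w ρ)) m, false),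
          restart (push (seenAdj G (lastRegs n w ρ)) m) .zero)
      else if ρ (unused m) = n then
        match m.1.stack with
        | [] => .inl (!m.1.current.isEmpty)
        | a :: _ => .inr (some (pop m a, false), restart (pop m a) (.name a))
      else .inr (some (m, false), nextCandidate m) := by
  have hpos : 0 < (n + 1) ^ (2 ^ t + 1) := by positivity
  have hlast : LastWalk (order (lastRegs n w ρ) : Reg t B → Reg t B → Bool) := by
    rw [lastWalk_iff (by omega)]
    omega
  have hacc : Candidate (order (lastRegs n w ρ)) (seenAdj G (lastRegs n w ρ)) m ∧
      ¬ (bad = true ∨ Reaches (order (lastRegs n w ρ)) (seenAdj G (lastRegs n w ρ)) m) ↔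
      Accepts G m w ρ := and_congr_right fun _ => not_congr hbad
  have hsame : (same (order (lastRegs n w ρ : Reg t B → ℕ)) (.name (unused m)) .size = true) ↔
      ρ (unused m) = n := by
    rw [same_order, decide_eq_true_eq]; rfl
  simp only [programStep, hlast, not_true_eq_false, if_false, hacc, hsame]

theorem assign_restart (m' : Display t B) (src : Reg t B) (v : ℕ) :
    assign (walkRegs n w ρ v) (restart m' src) =
      walkRegs n (walkRegs n w ρ v src) (update ρ (unused m') 0) 0 := by
  funext x
  cases x with
  | walk i => exact (digit_zero _ _).symm
  | name a =>
    by_cases ha : a = unused m'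
    · subst ha
      simp [assign, restart, walkRegs, regs]
    · simp [assign, restart, walkRegs, regs, ha]
  | _ => rfl

theorem assign_nextCandidate (v : ℕ) : assign (walkRegs n w ρ v) (nextCandidate m) =
    walkRegs n w (update ρ (unused m) (ρ (unused m) + 1)) 0 := by
  funext x
  cases x with
  | walk i => exact (digit_zero _ _).symm
  | name a =>
    by_cases ha : a = unused m
    · subst ha
      simp [assign, nextCandidate, walkRegs, regs]
    · simp [assign, nextCandidate, walkRegs, regs, ha]
  | _ => rfl

/-! ### The outcomes for one candidate -/

section Branches

variable {l : List (Memory (Fin n))} {b : Bool}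

theorem run_deep (hw : w ≤ n) (hρ : ∀ a, ρ a ≤ n) (hacc : Accepts G m w ρ)
    (hdeep : 2 ^ t < m.1.stack.length + 1) :
    Run hB G ⟨some (m, false), walkRegs n w ρ 0⟩ [decodeMemory n ρ m.1] false := by
  refine run_walks hw hρ fun bad hbad => ?_
  refine Produces.halt (dec := fun c : (program (t := t) hB).Config => memoryOf n hB c.state c.reg)
    ⟨some (m, bad), lastRegs n w ρ⟩ false ?_ (walkRegs_le hw hρ _)
  refine (sysStep_eq (G := G) _ _ rfl).trans ?_
  rw [programStep_last hbad, if_pos hacc, if_pos hdeep]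
  rfl

theorem run_push (hw : w ≤ n) (hρ : ∀ a, ρ a ≤ n) (hacc : Accepts G m w ρ)
    (hdeep : ¬ 2 ^ t < m.1.stack.length + 1) {m' : Display t B}
    (hm' : push (seenAdj G (lastRegs n w ρ)) m = m')
    (h : Run hB G ⟨some (m', false), walkRegs n 0 (update ρ (unused m') 0) 0⟩ l b) :
    Run hB G ⟨some (m, false), walkRegs n w ρ 0⟩ (decodeMemory n ρ m.1 :: l) b := by
  refine run_walks hw hρ fun bad hbad => ?_
  refine Produces.move (dec := fun c : (program (t := t) hB).Config => memoryOf n hB c.state c.reg)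
    ⟨some (m, bad), lastRegs n w ρ⟩ _ l b ?_ (walkRegs_le hw hρ _) h
  refine (sysStep_eq (G := G) _ _ rfl).trans ?_
  rw [programStep_last hbad, if_pos hacc, if_neg hdeep, hm']
  simp only [Sum.map_inr, assign_restart]
  rfl

theorem run_done (hw : w ≤ n) (hρ : ∀ a, ρ a ≤ n) (hacc : ¬ Accepts G m w ρ)
    (hc : ρ (unused m) = n) (hst : m.1.stack = []) :
    Run hB G ⟨some (m, false), walkRegs n w ρ 0⟩ [decodeMemory n ρ m.1]
      (!m.1.current.isEmpty) := by
  refine run_walks hw hρ fun bad hbad => ?_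
  refine Produces.halt (dec := fun c : (program (t := t) hB).Config => memoryOf n hB c.state c.reg)
    ⟨some (m, bad), lastRegs n w ρ⟩ _ ?_ (walkRegs_le hw hρ _)
  refine (sysStep_eq (G := G) _ _ rfl).trans ?_
  rw [programStep_last hbad, if_neg hacc, if_pos hc, hst]
  rfl

theorem run_pop (hw : w ≤ n) (hρ : ∀ a, ρ a ≤ n) (hacc : ¬ Accepts G m w ρ)
    (hc : ρ (unused m) = n) {a : Fin (numNames t B)} {st : List (Fin (numNames t B))}
    (hst : m.1.stack = a :: st) {m' : Display t B} (hm' : pop m a = m')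
    (h : Run hB G ⟨some (m', false), walkRegs n (ρ a) (update ρ (unused m') 0) 0⟩ l b) :
    Run hB G ⟨some (m, false), walkRegs n w ρ 0⟩ (decodeMemory n ρ m.1 :: l) b := by
  refine run_walks hw hρ fun bad hbad => ?_
  refine Produces.move (dec := fun c : (program (t := t) hB).Config => memoryOf n hB c.state c.reg)
    ⟨some (m, bad), lastRegs n w ρ⟩ _ l b ?_ (walkRegs_le hw hρ _) h
  refine (sysStep_eq (G := G) _ _ rfl).trans ?_
  rw [programStep_last hbad, if_neg hacc, if_pos hc, hst]
  simp only [hm', Sum.map_inr, assign_restart]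
  rfl

theorem decodeMemory_update (k : ℕ) :
    decodeMemory n (update ρ (unused m) k) m.1 = decodeMemory n ρ m.1 :=
  decodeMemory_congr fun a ha => update_of_ne (by rintro rfl; exact not_uses_unused m ha) _ _

theorem run_next (hw : w ≤ n) (hρ : ∀ a, ρ a ≤ n) (hacc : ¬ Accepts G m w ρ)
    (hc : ρ (unused m) ≠ n)
    (h : Run hB G ⟨some (m, false), walkRegs n w (update ρ (unused m) (ρ (unused m) + 1)) 0⟩
      (decodeMemory n ρ m.1 :: l) b) :
    Run hB G ⟨some (m, false), walkRegs n w ρ 0⟩ (decodeMemory n ρ m.1 :: l) b := by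
  refine run_walks hw hρ fun bad hbad => ?_
  refine Produces.stay' (dec := fun c : (program (t := t) hB).Config => memoryOf n hB c.state c.reg)
    (c := ⟨some (m, bad), lastRegs n w ρ⟩) ?_ (walkRegs_le hw hρ _) rfl h
  refine (sysStep_eq (G := G) _ _ rfl).trans ?_
  rw [programStep_last hbad, if_neg hacc, if_neg hc]
  simp only [Sum.map_inr, assign_nextCandidate]

end Branches

/-- The program is in the memory `m` and represents the state `s`. -/
structure Simulates (G : SimpleGraph (Fin n)) (m : Display t B) (ρ : Fin (numNames t B) → ℕ)
    (w : ℕ) (s : AlgState (Fin n)) : Prop where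
  memory : s.memory = decodeMemory n ρ m.1
  valid : ValidNames n ρ {a | m.1.Uses a}
  visited : ∀ a, m.1.Uses a → ∀ v : Fin n, ρ a = v + 1 → v ∈ s.visited
  le : ∀ a, ρ a ≤ n
  low_le : w ≤ n
  search : SearchInv (2 ^ t) G s {v | v.val + 1 ≤ w}
  sized : m.1.Sized t

namespace Simulates

variable {s : AlgState (Fin n)}

/-- The register of the unused name is scratch space: neither the represented memory nor the
invariants depend on it. -/
theorem update (h : Simulates G m ρ w s) {k : ℕ} (hk : k ≤ n) :
    Simulates G m (update ρ (unused m) k) w s := by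
  have hne : ∀ a, m.1.Uses a → Function.update ρ (unused m) k a = ρ a := fun a ha =>
    update_of_ne (by rintro rfl; exact not_uses_unused m ha) _ _
  refine ⟨?_, ⟨fun a ha => ?_, fun a ha => ?_, fun a ha b hb hab => ?_⟩, fun a ha => ?_, fun a => ?_,
    h.low_le, h.search, h.sized⟩
  · rw [h.memory, decodeMemory_update]
  · rw [hne a ha]; exact h.valid.pos a ha
  · rw [hne a ha]; exact h.valid.le a ha
  · rw [hne a ha, hne b hb] at hab; exact h.valid.inj ha hb hab
  · rw [hne a ha]; exact h.visited a ha
  · by_cases ha : a = unused m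
    · rw [ha, update_self]; exact hk
    · rw [update_of_ne ha]; exact h.le a

theorem accepts_iff (h : Simulates G m ρ w s) :
    Accepts G m w ρ ↔ ∃ u : Fin n, ρ (unused m) = u + 1 ∧ u ∈ s.choices G :=
  SearchProgram.accepts_iff h.valid (h.le _) h.memory h.search

/-- The program passes over candidates that cannot be discovered. -/
theorem advance {l : List (Memory (Fin n))} {b : Bool} {k : ℕ} (hk : k ≤ n) :
    ∀ (e : ℕ) (ρ : Fin (numNames t B) → ℕ), ρ (unused m) + e = k →
    Simulates G m ρ w s → (∀ u ∈ s.choices G, k ≤ u.val + 1) →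
    Run hB G ⟨some (m, false), walkRegs n w (Function.update ρ (unused m) k) 0⟩
      (s.memory :: l) b →
    Run hB G ⟨some (m, false), walkRegs n w ρ 0⟩ (s.memory :: l) b := by
  intro e
  induction e with
  | zero =>
    intro ρ hρ _ _ hrun
    rw [Nat.add_zero] at hρ
    rwa [← hρ, update_eq_self] at hrun
  | succ e ih =>
    intro ρ hρ h hch hrun
    have hacc : ¬ Accepts G m w ρ := by
      rw [h.accepts_iff]
      rintro ⟨u, hu, hu'⟩
      have := hch u hu'
      omega
    have := ih (Function.update ρ (unused m) (ρ (unused m) + 1)) (by rw [update_self]; omega)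
      (h.update (by omega)) hch (by rwa [update_idem])
    rw [h.memory] at this ⊢
    exact run_next h.low_le h.le hacc (by omega) this

end Simulates

end SearchProgram

/-! ### The whole run -/

/-- From the state `s` the algorithm may pass through the states in the list `l` and return `b`. -/
inductive AlgState.RunsThrough {V : Type*} [LinearOrder V] (t : ℕ) (G : SimpleGraph V) :
    AlgState V → List (AlgState V) → Bool → Prop
  | returns (s : AlgState V) (b : Bool) (h : AlgState.Returns t G s b) : RunsThrough t G s [s] b
  | step (s s' : AlgState V) (l : List (AlgState V)) (b : Bool) (h : AlgState.Step t G s s')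
      (hl : RunsThrough t G s' l b) : RunsThrough t G s (s :: l) b

theorem AlgState.RunsThrough.exists_states {V : Type*} [LinearOrder V] {t : ℕ} {G : SimpleGraph V}
    {s : AlgState V} {l : List (AlgState V)} {b : Bool} (h : AlgState.RunsThrough t G s l b) :
    ∃ (k : ℕ) (f : ℕ → AlgState V), f 0 = s ∧ l.length = k + 1 ∧ (∀ i ≤ k, l[i]? = some (f i)) ∧
      (∀ i < k, AlgState.Step t G (f i) (f (i + 1))) ∧ AlgState.Returns t G (f k) b := by
  induction h with
  | returns s b h => exact ⟨0, fun _ => s, rfl, rfl, fun i hi => by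
      obtain rfl : i = 0 := by omega
      rfl, fun i hi => absurd hi (Nat.not_lt_zero i), h⟩
  | step s s' l b h hl ih =>
    obtain ⟨k, f, h0, hlen, hget, hstep, hret⟩ := ih
    refine ⟨k + 1, fun i => match i with
      | 0 => s
      | i + 1 => f i, rfl, congrArg (· + 1) hlen, fun i hi => ?_, fun i hi => ?_, hret⟩
    · cases i with
      | zero => rfl
      | succ i => exact hget i (by omega)
    · cases i with
      | zero => simpa only [h0] using h
      | succ i => exact hstep i (by omega)

namespace SearchProgram

open PatternMachine (overflow entries_encodeGraph overflow_sq)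
open AlgState Function

variable {t B n : ℕ} {G : SimpleGraph (Fin n)} {m : Display t B} {ρ : Fin (numNames t B) → ℕ}
  {w : ℕ} {hB : 1 ≤ B} {s : AlgState (Fin n)}

/-- In the situations that arise a fitting successor exists, so the default value in the definition
of `push` is not taken. -/
theorem push_spec (hbound : TableBound t B) (adj : Reg t B → Reg t B → Bool)
    (hs : m.1.Sized t) (hlen : m.1.stack.length + 1 ≤ 2 ^ t) :
    m.1.Push t (namesGraph fun a b => adj (.name a) (.name b)) (unused m) (push adj m).1 := by
  have h := Memory.exists_push hbound m.2 hs
    (namesGraph fun a b => adj (.name a) (.name b)) (c := unused m) hlen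
  unfold push
  rw [dif_pos h]
  exact h.choose_spec.2

theorem pop_spec (hbound : TableBound t B) (hs : m.1.Sized t) {a : Fin (numNames t B)}
    {l : List (Fin (numNames t B))} (hst : m.1.stack = a :: l) (ha : a ∉ l) :
    m.1.Pop t a (pop m a).1 := by
  have h := Memory.exists_pop hbound m.2 hs hst ha
  unfold pop
  rw [dif_pos h]
  exact h.choose_spec.2

theorem Simulates.stack_length (h : Simulates G m ρ w s) :
    s.memory.stack.length = m.1.stack.length := by
  rw [h.memory]
  exact h.valid.decode_stack_length (p := m.1.previous) (c := m.1.current) fun a ha => Or.inl ha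

theorem Simulates.bag_eq (h : Simulates G m ρ w s) : s.bag = (decodeMemory n ρ m.1).bag := by
  rw [← h.memory]; rfl

/-- Discovering a vertex. -/
theorem Simulates.discover (hbound : TableBound t B) (h : Simulates G m ρ w s) {u : Fin n}
    (hu : IsLeast (s.choices G) u) (hc : ρ (unused m) = u + 1)
    (hlen : m.1.stack.length + 1 ≤ 2 ^ t) {m' : Display t B}
    (hm' : push (seenAdj G (lastRegs n w ρ)) m = m') :
    ∃ A, AlgState.Step t G s ⟨⟨u :: s.memory.stack, s.memory.current, A⟩, insert u s.visited⟩ ∧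
      Simulates G m' (Function.update ρ (unused m') 0) 0
        ⟨⟨u :: s.memory.stack, s.memory.current, A⟩, insert u s.visited⟩ := by
  have hp := push_spec hbound (seenAdj G (lastRegs n w ρ)) h.sized hlen
  rw [hm'] at hp
  have hu0 : u ∉ s.visited := hu.1.1
  -- Names in use denote discovered vertices and `u` is undiscovered, so the candidate's name does
  -- not collide with them.
  have hv : ValidNames n ρ {a | a = unused m ∨ m.1.Uses a} := by
    refine ⟨fun a ha => ?_, fun a _ => h.le a, fun a ha b hb hab => ?_⟩
    · rcases ha with rfl | ha
      · omega
      · exact h.valid.pos a ha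
    · rcases ha with rfl | ha <;> rcases hb with rfl | hb
      · rfl
      · exact absurd (h.visited b hb u (by rw [← hab, hc])) hu0
      · exact absurd (h.visited a ha u (by rw [hab, hc])) hu0
      · exact h.valid.inj ha hb hab
  have hv' : ValidNames n ρ {a | m'.1.Uses a} := hv.mono hp.uses
  have hname : nameVertex n ρ (some (unused m)) = some u := nameVertex_some.2 hc
  have hintro := hp.isIntro h.sized (G := G) hv fun a b => entries_encodeGraph G (lastRegs n w ρ) _ _
  rw [hname, ← h.bag_eq] at hintro
  have hmem : s.memory.current = (decodeMemory n ρ m.1).current := by rw [h.memory]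
  refine ⟨(decodeMemory n ρ m'.1).current, .discover s u _ hu ?_ ?_, ?_⟩
  · rw [h.stack_length]; exact hlen
  · rw [hmem]; exact hintro
  · refine (Simulates.update (ρ := ρ) ⟨?_, hv', ?_, h.le, Nat.zero_le _, ?_, hp.sized⟩ (Nat.zero_le _))
    · show (⟨_, _, _⟩ : Memory (Fin n)) = ⟨_, _, _⟩
      rw [h.memory]
      congr 1
      · rw [hp.stack]
        exact (List.filterMap_cons_some (f := fun a => nameVertex n ρ (some a)) hname).symm
      · rw [hp.previous]; rfl
    · intro a ha v hav
      rcases hp.uses a ha with rfl | ha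
      · exact Or.inl (Fin.ext (by omega))
      · exact Or.inr (h.visited a ha v hav)
    · have hempty : {v : Fin n | v.val + 1 ≤ 0} = ∅ := by
        ext v; simp
      rw [hempty]
      exact h.search.discover hu (by rw [h.stack_length]; exact hlen) _ _

/-- Leaving a vertex. -/
theorem Simulates.leave (hbound : TableBound t B) (h : Simulates G m ρ w s)
    (hnone : s.choices G = ∅) {a : Fin (numNames t B)} {st : List (Fin (numNames t B))}
    (hst : m.1.stack = a :: st) {m' : Display t B} (hm' : pop m a = m') :
    ∃ (u : Fin n) (l : List (Fin n)) (A : Table (Fin n)), s.memory.stack = u :: l ∧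
      AlgState.Step t G s ⟨⟨l, s.memory.current, A⟩, s.visited⟩ ∧
      Simulates G m' (Function.update ρ (unused m') 0) (ρ a)
        ⟨⟨l, s.memory.current, A⟩, s.visited⟩ := by
  have hau : m.1.Uses a := Or.inl (hst ▸ List.mem_cons_self)
  obtain ⟨u, hname, hau'⟩ := h.valid.nameVertex_eq hau
  have hstack : s.memory.stack = u :: st.filterMap fun a => nameVertex n ρ (some a) := by
    rw [h.memory]
    show m.1.stack.filterMap _ = _
    rw [hst]
    exact List.filterMap_cons_some (f := fun a => nameVertex n ρ (some a)) hname
  -- A repeated name would repeat a vertex on the decoded stack.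
  have hnd : a ∉ st := by
    intro hmem
    have := h.search.nodup
    rw [hstack, List.nodup_cons] at this
    exact this.1 (List.mem_filterMap.2 ⟨a, hmem, hname⟩)
  have hp := pop_spec hbound h.sized hst hnd
  rw [hm'] at hp
  have hst' : m'.1.stack = st := by
    have := hp.stack
    rw [hst, List.cons.injEq] at this
    exact this.2.symm
  have hforget := hp.isForget h.sized h.valid
  rw [hname, ← h.bag_eq] at hforget
  have hmem : s.memory.current = (decodeMemory n ρ m.1).current := by rw [h.memory]
  refine ⟨u, _, (decodeMemory n ρ m'.1).current, hstack, .leave s u _ _ hnone hstack ?_, ?_⟩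
  · rw [hmem]; exact hforget
  · have hmem' : (⟨st.filterMap fun a => nameVertex n ρ (some a), s.memory.current,
        (decodeMemory n ρ m'.1).current⟩ : Memory (Fin n)) = decodeMemory n ρ m'.1 := by
      rw [hmem]
      unfold decodeMemory
      rw [hst', hp.previous]
    have hW : {v : Fin n | v.val + 1 ≤ ρ a} = Set.Iic u := by
      ext v
      rw [hau']
      exact Nat.succ_le_succ_iff
    have key : Simulates G m' ρ (ρ a) ⟨⟨st.filterMap fun a => nameVertex n ρ (some a),
        s.memory.current, (decodeMemory n ρ m'.1).current⟩, s.visited⟩ :=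
      ⟨hmem', h.valid.mono hp.uses, fun b hb => h.visited b (hp.uses b hb), h.le, h.le a,
        by rw [hW]; exact h.search.leave hnone hstack _ _, hp.sized⟩
    exact key.update (Nat.zero_le _)

/-- The program carries out the algorithm. -/
theorem Simulates.exists_run (hbound : TableBound t B) :
    ∀ (k : ℕ) {m : Display t B} {ρ : Fin (numNames t B) → ℕ} {w : ℕ} {s : AlgState (Fin n)},
    2 * (n - s.visited.ncard) + s.memory.stack.length < k → Simulates G m ρ w s →
    ρ (unused m) = 0 → ∃ l b, AlgState.RunsThrough t G s l b ∧
      Run hB G ⟨some (m, false), walkRegs n w ρ 0⟩ (l.map AlgState.memory) b := by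
  -- The measure decreases with every step of the search: a discovery lowers the first summand by
  -- two and raises the stack by one, and leaving a vertex lowers the stack by one.
  intro k
  induction k with
  | zero => intro m ρ w s hk; omega
  | succ k ih =>
    intro m ρ w s hk h h0
    by_cases hne : (s.choices G).Nonempty
    · obtain ⟨u, huS, humin⟩ := (wellFounded_lt (α := Fin n)).has_min _ hne
      have hu : IsLeast (s.choices G) u := ⟨huS, fun v hv => not_lt.1 (humin v hv)⟩
      -- The candidate register runs upwards from `0` and passes over everything below the least
      -- choice, so the first accepted candidate is the one the search takes.
      have h1 := h.update (k := u.val + 1) u.2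
      have hc : Function.update ρ (unused m) (u.val + 1) (unused m) = u.val + 1 := update_self ..
      have hacc := h1.accepts_iff.2 ⟨u, hc, huS⟩
      have adv : ∀ {l b}, Run hB G ⟨some (m, false),
          walkRegs n w (Function.update ρ (unused m) (u.val + 1)) 0⟩ (s.memory :: l) b →
          Run hB G ⟨some (m, false), walkRegs n w ρ 0⟩ (s.memory :: l) b := fun hrun =>
        Simulates.advance u.2 (u.val + 1) ρ (by rw [h0, zero_add]) h
          (fun v hv => Nat.succ_le_succ (hu.2 hv)) hrun
      by_cases hdeep : 2 ^ t < m.1.stack.length + 1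
      · refine ⟨[s], false, .returns s _ (.tooDeep s hne (by rwa [h.stack_length])), adv ?_⟩
        rw [h1.memory]
        exact run_deep h1.low_le h1.le hacc hdeep
      · obtain ⟨A, hstep, hsim⟩ := h1.discover hbound hu hc (not_lt.1 hdeep) rfl
        have hcard : (insert u s.visited).ncard = s.visited.ncard + 1 :=
          Set.ncard_insert_of_notMem hu.1.1
        have hle : (insert u s.visited).ncard ≤ n := by
          simpa using Set.ncard_le_ncard (Set.subset_univ (insert u s.visited))
        obtain ⟨l, b, hl, hrun⟩ := ih (by
          simp only [List.length_cons]
          omega) hsim (update_self ..)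
        refine ⟨s :: l, b, .step _ _ _ _ hstep hl, adv ?_⟩
        rw [h1.memory]
        exact run_push h1.low_le h1.le hacc hdeep rfl hrun
    · have hnone : s.choices G = ∅ := Set.not_nonempty_iff_eq_empty.1 hne
      have h1 := h.update (k := n) le_rfl
      have hc : Function.update ρ (unused m) n (unused m) = n := update_self ..
      have hacc : ¬ Accepts G m w (Function.update ρ (unused m) n) := by
        rw [h1.accepts_iff]
        rintro ⟨u, -, hu⟩
        exact hne ⟨u, hu⟩
      have adv : ∀ {l b}, Run hB G ⟨some (m, false),
          walkRegs n w (Function.update ρ (unused m) n) 0⟩ (s.memory :: l) b →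
          Run hB G ⟨some (m, false), walkRegs n w ρ 0⟩ (s.memory :: l) b := fun hrun =>
        Simulates.advance le_rfl n ρ (by rw [h0, zero_add]) h
          (fun v hv => absurd ⟨v, hv⟩ hne) hrun
      cases hst : m.1.stack with
      | nil =>
        have hstack : s.memory.stack = [] := by
          rw [← List.length_eq_zero_iff, h.stack_length, hst]; rfl
        refine ⟨[s], _, .returns s _ (.done s ⟨hnone, hstack⟩), adv ?_⟩
        have hempty : s.memory.current.isEmpty = m.1.current.isEmpty := by
          rw [h.memory]
          exact List.isEmpty_map
        rw [hempty, h1.memory]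
        exact run_done h1.low_le h1.le hacc hc hst
      | cons a st =>
        obtain ⟨u, l, A, hstack, hstep, hsim⟩ := h1.leave hbound hnone hst rfl
        obtain ⟨l, b, hl, hrun⟩ := ih (by
          rw [hstack, List.length_cons] at hk
          simp only
          omega) hsim (update_self ..)
        refine ⟨s :: l, b, .step _ _ _ _ hstep hl, adv ?_⟩
        rw [h1.memory]
        exact run_pop h1.low_le h1.le hacc hc hst rfl hrun

/-- The initial state. -/
noncomputable def initialState (t n : ℕ) (hB : 1 ≤ B) : AlgState (Fin n) where
  memory := decodeMemory n (fun _ => 0) (initialMemory hB : Display t B).1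
  visited := ∅

theorem initialState_isInitial : (initialState t n hB).IsInitial := by
  have hv : ValidNames n (fun _ => 0) {a | (initialMemory hB : Display t B).1.Uses a} :=
    ⟨fun a ha => absurd ha (not_uses_initialMemory hB a), fun _ _ => Nat.zero_le _,
      fun a ha => absurd ha (not_uses_initialMemory hB a)⟩
  have hiso := decodePD_isIso hv (P := PartialDecomposition.leaf _) fun a ha =>
    Or.inr ⟨_, Or.inr (List.mem_singleton_self _), ha⟩
  refine ⟨rfl, rfl, ⟨_, rfl, ?_, ?_, ?_⟩, rfl⟩
  · refine Finset.coe_injective ?_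
    rw [hiso.X_eq]
    simp [PartialDecomposition.leaf, nameVertex]
  · refine Finset.coe_injective ?_
    rw [← hiso.bijOn.image_eq]
    simp [PartialDecomposition.leaf, nameVertex, nameNode]
  · exact hiso.h_apply (Sum.inl none) (Finset.mem_singleton_self _)

theorem simulates_initial (G : SimpleGraph (Fin n)) :
    Simulates G (initialMemory hB : Display t B) (fun _ => 0) 0 (initialState t n hB) where
  memory := rfl
  valid := ⟨fun a ha => absurd ha (not_uses_initialMemory hB a), fun _ _ => Nat.zero_le _,
      fun a ha => absurd ha (not_uses_initialMemory hB a)⟩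
  visited a ha := absurd ha (not_uses_initialMemory hB a)
  le _ := Nat.zero_le _
  low_le := Nat.zero_le _
  search := by
    have hempty : {v : Fin n | v.val + 1 ≤ 0} = ∅ := by
      ext v; simp
    rw [hempty]
    exact SearchInv.initial _ _ rfl rfl
  sized P hP := by
    rw [List.mem_singleton.1 hP]
    refine ⟨rfl, Nat.mul_pos (Nat.succ_pos _) (Nat.succ_pos _), fun x hx => ?_⟩
    rw [Finset.mem_singleton.1 hx]
    exact Nat.succ_le_succ (Nat.zero_le _)

/-- The program determines the number of vertices and then starts the search. -/
theorem run_count {l : List (Memory (Fin n))} {b : Bool}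
    (h : Run hB G ⟨some ((initialMemory hB : Display t B), false), walkRegs n 0 (fun _ => 0) 0⟩
      ((initialState t n hB).memory :: l) b) :
    Run (t := t) hB G ⟨none, regs 0 0 (fun _ => 0) fun _ => 0⟩ ((initialState t n hB).memory :: l) b := by
  have hle : ∀ k ≤ n, ∀ i : Reg t B, regs k 0 (fun _ => 0) (fun _ => 0) i ≤ n * n + 1 := by
    intro k hk i
    cases i with
    | size => exact hk.trans ((Nat.le_mul_self n).trans (Nat.le_succ _))
    | one => exact Nat.succ_le_succ (Nat.zero_le _)
    | _ => exact Nat.zero_le _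
  have key : ∀ e k, k + e = n → Run (t := t) hB G ⟨none, regs k 0 (fun _ => 0) fun _ => 0⟩
      ((initialState t n hB).memory :: l) b := by
    intro e
    induction e with
    | zero =>
      intro k hk
      rw [Nat.add_zero] at hk
      subst hk
      refine Produces.stay' ?_ (hle k le_rfl) rfl h
      -- The input has `n * n` bits, so at `k = n` no row is left over and the count stops.
      have ho : ¬ overflow k (k * k) = true := by rw [overflow_sq]; exact lt_irrefl _
      refine (sysStep_eq (G := G) _ _ rfl).trans ?_
      simp only [programStep, ho]
      simp only [Bool.false_eq_true, if_false, Sum.map_inr]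
      congr 2
      funext x
      cases x with
      | walk i => exact (digit_zero _ _).symm
      | _ => rfl
    | succ e ih =>
      intro k hk
      refine Produces.stay' ?_ (hle k (by omega)) rfl (ih (k + 1) (by omega))
      have ho : overflow k (n * n) = true := by rw [overflow_sq]; omega
      unfold PatternMachine.sysStep
      simp only [length_encodeGraph, programStep]
      rw [if_pos (show overflow (regs k 0 (fun _ => 0) (fun _ => 0) (.size : Reg t B)) (n * n) = true
        from ho)]
      simp only [Sum.map_inr]
      congr 2
      funext x
      cases x <;> rfl
  exact key n 0 (Nat.zero_add n)

/-- Starting from its initial configuration the program carries out an execution of the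
algorithm. -/
theorem exists_execution (hB : 1 ≤ B) (hbound : TableBound t B) (G : SimpleGraph (Fin n)) :
    ∃ (ρ : Execution t G) (l : List (AlgState (Fin n))), l.length = ρ.length + 1 ∧
      (∀ i ≤ ρ.length, l[i]? = some (ρ.state i)) ∧
      Run (t := t) hB G ⟨none, regs 0 0 (fun _ => 0) fun _ => 0⟩ (l.map AlgState.memory) ρ.answer := by
  obtain ⟨l, b, hl, hrun⟩ := Simulates.exists_run (hB := hB) hbound _ (Nat.lt_succ_self _)
    (simulates_initial (hB := hB) G) rfl
  obtain ⟨k, f, h0, hlen, hget, hstep, hret⟩ := hl.exists_states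
  refine ⟨⟨k, f, b, h0 ▸ initialState_isInitial, hstep, hret⟩, l, hlen, hget, ?_⟩
  cases l with
  | nil => cases hlen
  | cons s' l =>
    have h1 := hget 0 (Nat.zero_le _)
    rw [h0] at h1
    simp only [List.getElem?_cons_zero, Option.some.injEq] at h1
    subst h1
    exact run_count hrun

end SearchProgram

/-! ### The machine -/

/-- With `a = Nat.log 2 n + 1` the hypothesis gives `2 ^ ℓ < 4 * (n + 1) ^ 2 ≤ 2 ^ (2 * a + 2)`.
Hence `ℓ + 2 ≤ 2 * a + 3 ≤ 5 * a`, the extra two cells being the one for the state and the blank at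
which the sweep turns. -/
theorem space_bound {n ℓ : ℕ} (h : 2 ^ ℓ ≤ 2 * (n * n + 1) + 1) :
    ℓ + 2 ≤ 5 * (Nat.log 2 n + 1) := by
  have h1 : n + 1 ≤ 2 ^ (Nat.log 2 n + 1) := Nat.lt_pow_succ_log_self (by norm_num) n
  have ha : 1 ≤ Nat.log 2 n + 1 := Nat.succ_le_succ (Nat.zero_le _)
  generalize Nat.log 2 n + 1 = a at *
  have h2 : (n + 1) * (n + 1) ≤ 2 ^ a * 2 ^ a := Nat.mul_le_mul h1 h1
  have h3 : 2 ^ ℓ < 2 ^ (2 * a + 2) := by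
    have : 2 ^ (2 * a + 2) = 4 * (2 ^ a * 2 ^ a) := by rw [pow_add, two_mul, pow_add]; ring
    rw [this]
    nlinarith
  have := (Nat.pow_lt_pow_iff_right (by norm_num)).1 h3
  omega

open SearchProgram PatternMachine RegMachine in
/-- A single machine carries out the algorithm in logarithmic space on all graphs. -/
theorem exists_logspace_machine {t B : ℕ} (hbound : TableBound t B) :
    ∃ (M : OfflineTM) (c : ℕ) (dec : (n : ℕ) → M.Work → Memory (Fin n)),
      ∀ (n : ℕ) (G : SimpleGraph (Fin n)),
        M.SpaceAtMost (encodeGraph G) (c * (Nat.log 2 n + 1)) ∧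
        ∃ ρ : Execution t G, M.Implements (dec n) (encodeGraph G) ρ := by
  have hB : 1 ≤ B := (Nat.succ_le_succ (Nat.zero_le t)).trans hbound.2.1
  have : Finite (Reg t B) := SearchReg.finite _ _
  have : Finite (program (t := t) hB).State := finite_state hB
  have : Finite (program (t := t) hB).toRegMachine.State := finite_scanState _
  let R := (program (t := t) hB).toRegMachine
  refine ⟨R.toTM, 5, fun n W => R.tapeDec (scanDec (memoryOf n hB)) (W (0 : Fin 1)), fun n G => ?_⟩
  obtain ⟨ρ, l, hlen, hget, hrun⟩ := exists_execution hB hbound G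
  have hD : ∀ (q : Option (Display t B × Bool)) (r r' : Reg t B → ℕ),
      (∀ x ∈ keep hB q, r x = r' x) → memoryOf n hB q r = memoryOf n hB q r' :=
    fun q r r' h => decodeMemory_congr fun a ha => h _ ⟨a, ha, rfl⟩
  have hboot := produces_boot (P := program (t := t) hB) (D := memoryOf n hB)
    (bound := n * n + 1) (fun q lt A ov q' upd h => (upd_spec hB q lt A ov q' upd h).1)
    (by rw [length_encodeGraph]) (r := regs 0 0 (fun _ => 0) fun _ => 0)
    (fun i hi => by cases i <;> first | rfl | exact absurd rfl hi) rfl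
    (hD _ _ _ fun x hx => by
      obtain ⟨a, -, rfl⟩ := hx
      rfl) hrun
  have htm := produces_initial (R := R) (D := scanDec (memoryOf n hB))
    (keep := fun s => Sum.inl '' keep hB s.toState) (s := 5 * (Nat.log 2 n + 1))
    (fun q r r' h => hD _ _ _ fun x hx => h _ ⟨x, hx, rfl⟩) (fun ℓ => space_bound)
    (transition_keep (one_notMem_keep hB) fun q lt A ov q' upd h =>
      (upd_spec hB q lt A ov q' upd h).2) hboot
  obtain ⟨T, idx, hidx0, hidx, hidxT, hdec, hhalt, hok⟩ := OfflineTM.produces_spec htm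
  -- The index never exceeds `ρ.length`, so every displayed memory belongs to a state of the
  -- execution.
  have hmono : ∀ j ≤ T, idx j ≤ idx T := by
    have : ∀ e j, j + e = T → idx j ≤ idx T := by
      intro e
      induction e with
      | zero => rintro j rfl; exact le_rfl
      | succ e ih =>
        intro j hj
        have h1 := ih (j + 1) (by omega)
        rcases hidx j (by omega) with h2 | h2 <;> omega
    exact fun j hj => this (T - j) j (by omega)
  rw [List.length_map, hlen, Nat.add_right_cancel_iff] at hidxT
  refine ⟨fun j i => ?_, ρ, T, idx, hidx0, hidx, hidxT, fun j hj => ?_, hhalt⟩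
  · obtain rfl : i = (0 : Fin 1) := Subsingleton.elim (α := Fin 1) _ _
    exact hok j
  · have h1 := hdec j hj
    rw [List.getElem?_map, hget _ (hidxT ▸ hmono j hj), Option.map_some, Option.some_inj] at h1
    exact h1.symm

theorem mainTheorem5 (t : ℕ) :
    ∃ B : ℕ,
      (∀ (n : ℕ) (G : SimpleGraph (Fin n)) (ρ : Execution t G),
        (ρ.answer = true ↔ treedepth G ≤ t) ∧
        (∀ i ≤ ρ.length, (ρ.state i).memory.stack.length ≤ 2 ^ t ∧
          TableSizeAtMost B (ρ.state i).memory.previous ∧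
          TableSizeAtMost B (ρ.state i).memory.current) ∧
        ((ρ.state ρ.length).Complete G →
          IsNicePathDecomposition (rootedGraph G) ρ.length (fun i => (ρ.state i).bag))) ∧
      -- A single machine carries out the algorithm in logarithmic space on all graphs.
      ∃ (M : OfflineTM) (c : ℕ) (dec : (n : ℕ) → M.Work → Memory (Fin n)),
        ∀ (n : ℕ) (G : SimpleGraph (Fin n)),
          M.SpaceAtMost (encodeGraph G) (c * (Nat.log 2 n + 1)) ∧
          ∃ ρ : Execution t G, M.Implements (dec n) (encodeGraph G) ρ := by
  obtain ⟨B, hB⟩ := exists_table_bound t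
  refine ⟨B, fun n G ρ => ⟨ρ.answer_iff, ρ.tableSizeAtMost hB, fun h => ?_⟩, ?_⟩
  -- Only the decidability instances may differ.
  · convert ρ.isNicePathDecomposition h
  · exact exists_logspace_machine hB
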